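/- **Theorem (super-exponential replacement estimate).** Let $\sigma:[0,1]\to\mathbb R$ be $\tfrac12$-Hölder. For $N\ge 1$ and $0\le k\le 2N$ put $k_N=\frac{k}{2N}$, and for $1\le k\le 2N-1$ let $p_N(k_N),q_N(k_N)>0$ be determined by $$p_N(k_N)+q_N(k_N)=(2N)^2,\qquad \log\frac{p_N(k_N)}{q_N(k_N)}=4\sigma(k_N)(2N)^{-3/2}.$$ *Interfaces.* Let $\mathcal C^{1}_N$ be the set of $h:[0,1]\to\mathbb R$ with $h(0)=h(1)=0$ and $h(k_N)=h((k-1)_N)\pm\frac1{\sqrt{2N}}$ for $1\le k\le 2N$, affine on each $[(k-1)_N,k_N]$; let $\mathcal C^{1w}_N=\{h\in\mathcal C^1_N: h\ge 0\}$ and $\mathcal C^2_N=\{(h^{(1)},h^{(2)}): h^{(i)}\in\mathcal C^1_N,\ h^{(1)}\ge h^{(2)}\}$. Put $\Delta h(k_N)=h((k+1)_N)-2h(k_N)+h((k-1)_N)$. *Dynamics.* In each model the càdlàg process $(\mathrm h_t)_{t\ge0}$ takes its values in the corresponding state space, is started from a random $\mathrm h_0$ independent of the Poisson processes, and solves the following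 equations for $1\le k\le 2N-1$, where indicators are evaluated just before the jump and all Poisson processes are independent. * Model 1 (in $\mathcal C^1_N$): $d\mathrm h_t(k_N)=\frac{2}{\sqrt{2N}}\big(d\mathcal L_t(k_N)\mathbf 1_{\{\Delta \mathrm h_t(k_N)>0\}}-d\mathcal R_t(k_N)\mathbf 1_{\{\Delta \mathrm h_t(k_N)<0\}}\big)$, with $\mathcal L(k_N),\mathcal R(k_N)$ of rates $p_N(k_N),q_N(k_N)$. * Model 1-w (in $\mathcal C^{1w}_N$): the same, with $\mathbf 1_{\{\Delta \mathrm h_t(k_N)<0\}}$ replaced by $\mathbf 1_{\{\Delta \mathrm h_t(k_N)<0,\ \mathrm h_t(k_N)>1/\sqrt{2N}\}}$. * Model 2 (in $\mathcal C^2_N$), with $\mathcal L^1(k_N),\mathcal R^2(k_N)$ of rate $p_N(k_N)$ and $\mathcal R^1(k_N),\mathcal L^2(k_N)$ of rate $q_N(k_N)$: $$d\mathrm h^{(1)}_t(k_N)=\tfrac{2}{\sqrt{2N}}\big(d\mathcal L^1_t(k_N)\mathbf 1_{\{\Delta \mathrm h^{(1)}_t(k_N)>0\}}-d\mathcal R^1_t(k_N)\mathbf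 1_{\{\Delta \mathrm h^{(1)}_t(k_N)<0,\ \mathrm h^{(1)}_t(k_N)>\mathrm h^{(2)}_t(k_N)\}}\big),$$ $$d\mathrm h^{(2)}_t(k_N)=\tfrac{2}{\sqrt{2N}}\big(d\mathcal L^2_t(k_N)\mathbf 1_{\{\Delta \mathrm h^{(2)}_t(k_N)>0,\ \mathrm h^{(1)}_t(k_N)>\mathrm h^{(2)}_t(k_N)\}}-d\mathcal R^2_t(k_N)\mathbf 1_{\{\Delta \mathrm h^{(2)}_t(k_N)<0\}}\big).$$ Write $\mathbb Q^N_{\nu_N}$ for the law of the process when $\mathrm h_0$ has law $\nu_N$. To $h\in\mathcal C^1_N$ associate $\eta\in\{0,1\}^{2N}$ with $\eta(k)=1$ if $h(k_N)>h((k-1)_N)$ and $\eta(k)=0$ otherwise; sites are taken modulo $2N$. Let $\upeta_t$ be the configuration (in Model 2, the pair of configurations $(\upeta^{(1)}_t,\upeta^{(2)}_t)$) associated with $\mathrm h_t$. *Potential.* Let $l\ge 1$ and $\Phi:\{0,1\}^l\to\mathbb R$. Put $\Phi(\eta)=\Phi(\eta(1),\dots,\eta(l))$, $\tau_j\eta(i)=\eta(i+j)$,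 and let $\tilde\Phi(a)=\sum_{\xi\in\{0,1\}^l}\Phi(\xi)a^{\#\{i:\xi(i)=1\}}(1-a)^{\#\{i:\xi(i)=0\}}$ be the mean of $\Phi$ under independent Bernoulli($a$) variables. For $\varepsilon>0$ and $m=\lfloor\varepsilon N\rfloor$ set $$V_{N,\varepsilon}(\eta)=\sum_{i=1}^{2N}\Big|\frac1{2m+1}\sum_{j:|i-j|\le m}\Phi(\tau_j\eta)-\tilde\Phi\Big(\frac1{2m+1}\sum_{j:|i-j|\le m}\eta(j)\Big)\Big|$$ in Models 1 and 1-w, and let $V_{N,\varepsilon}(\eta^{(1)},\eta^{(2)})$ be the sum of this quantity for $\eta^{(1)}$ and for $\eta^{(2)}$ in Model 2. *Conclusion.* In each of the three models, for every sequence $(\nu_N)_{N\ge1}$ of probability measures on the state spaces, every $\delta>0$ and every $t>0$, $$\varlimsup_{\varepsilon\downarrow0}\ \varlimsup_{N\to\infty}\ \frac1N\log\mathbb Q^N_{\nu_N}\Big(\frac1N\int_0^tV_{N,\varepsilon}(\upeta_s)\,ds>\delta\Big)=-\infty .$$ -/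

import Mathlib

open MeasureTheory ProbabilityTheory Filter Topology
open scoped NNReal ENNReal

namespace InterfaceModel

noncomputable section

/-! ### State-spaces -/

/-- The lattice point `k_N = k / (2N)` of `[0,1]` (for `N ≥ 1` and `0 ≤ k ≤ 2N`). -/
def pt (N k : ℕ) : unitInterval := Set.projIcc (0 : ℝ) 1 zero_le_one ((k : ℝ) / (2 * N))

/-- The space of interfaces of Model 1: functions on `[0,1]` vanishing at `0` and `1`, with
increments `± 1/√(2N)` between consecutive lattice points, affine between lattice points. -/
def Space1 (N : ℕ) : Set (unitInterval → ℝ) :=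
  {h | h 0 = 0 ∧ h 1 = 0 ∧
    (∀ k ∈ Set.Icc 1 (2 * N),
      h (pt N k) = h (pt N (k - 1)) + 1 / √(2 * N) ∨
      h (pt N k) = h (pt N (k - 1)) - 1 / √(2 * N)) ∧
    (∀ k ∈ Set.Icc 1 (2 * N), ∀ x ∈ Set.Icc (pt N (k - 1)) (pt N k),
      h x = h (pt N (k - 1)) +
        (2 * N * (x : ℝ) - ((k : ℝ) - 1)) * (h (pt N k) - h (pt N (k - 1))))}

/-- The space of interfaces of Model 1-w: the non-negative interfaces. -/
def Space1w (N : ℕ) : Set (unitInterval → ℝ) := {h | h ∈ Space1 N ∧ ∀ x, 0 ≤ h x}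

/-- The space of pairs of ordered interfaces of Model 2. -/
def Space2 (N : ℕ) : Set ((unitInterval → ℝ) × (unitInterval → ℝ)) :=
  {h | h.1 ∈ Space1 N ∧ h.2 ∈ Space1 N ∧ ∀ x, h.2 x ≤ h.1 x}

/-- The discrete Laplacian `Δh(k_N)`, for `1 ≤ k ≤ 2N - 1`. -/
def lap (N : ℕ) (h : unitInterval → ℝ) (k : ℕ) : ℝ :=
  h (pt N (k + 1)) - 2 * h (pt N k) + h (pt N (k - 1))

/-! ### Jump rates -/

/-- The rate `p_N(k_N)`; see `upRate_add_downRate` and `log_upRate_div_downRate`. -/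
def upRate (σ : unitInterval → ℝ) (N k : ℕ) : ℝ≥0 :=
  ((2 * N : ℝ) ^ 2 /
    (1 + Real.exp (-(4 * σ (pt N k) * (2 * N : ℝ) ^ (-(3 / 2) : ℝ))))).toNNReal

/-- The rate `q_N(k_N)`; see `upRate_add_downRate` and `log_upRate_div_downRate`. -/
def downRate (σ : unitInterval → ℝ) (N k : ℕ) : ℝ≥0 :=
  ((2 * N : ℝ) ^ 2 /
    (1 + Real.exp (4 * σ (pt N k) * (2 * N : ℝ) ^ (-(3 / 2) : ℝ)))).toNNReal

theorem upRate_add_downRate (σ : unitInterval → ℝ) (N k : ℕ) :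
    (upRate σ N k : ℝ) + downRate σ N k = (2 * N : ℝ) ^ 2 := by
  unfold upRate downRate
  rw [Real.coe_toNNReal _ (by positivity), Real.coe_toNNReal _ (by positivity), Real.exp_neg]
  have := Real.exp_pos (4 * σ (pt N k) * (2 * N : ℝ) ^ (-(3 / 2) : ℝ))
  field_simp
  ring

theorem log_upRate_div_downRate (σ : unitInterval → ℝ) {N : ℕ} (hN : 1 ≤ N) (k : ℕ) :
    0 < upRate σ N k ∧ 0 < downRate σ N k ∧
    Real.log ((upRate σ N k : ℝ) / downRate σ N k)
      = 4 * σ (pt N k) * (2 * N : ℝ) ^ (-(3 / 2) : ℝ) := by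
  have hN' : (0 : ℝ) < N := by exact_mod_cast hN
  unfold upRate downRate
  refine ⟨Real.toNNReal_pos.2 (by positivity), Real.toNNReal_pos.2 (by positivity), ?_⟩
  rw [Real.coe_toNNReal _ (by positivity), Real.coe_toNNReal _ (by positivity), Real.exp_neg]
  set a := 4 * σ (pt N k) * (2 * N : ℝ) ^ (-(3 / 2) : ℝ) with ha
  have := Real.exp_pos a
  rw [show (2 * N : ℝ) ^ 2 / (1 + (Real.exp a)⁻¹) / ((2 * N : ℝ) ^ 2 / (1 + Real.exp a))
    = Real.exp a by field_simp; ring, Real.log_exp]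

/-! ### Poisson clocks and the dynamics -/

/-- Right-continuous paths with left limits. -/
def IsCadlag {E : Type*} [TopologicalSpace E] (f : ℝ≥0 → E) : Prop :=
  ∀ t, ContinuousWithinAt f (Set.Ici t) t ∧ ∃ y, Tendsto f (𝓝[<] t) (𝓝 y)

/-- A family of independent Poisson processes, the `i`-th one with rate `rate i`. -/
structure IsPoissonFamily {Ω ι : Type*} [MeasurableSpace Ω] (P : Measure Ω)
    (rate : ι → ℝ≥0) (Z : ι → ℝ≥0 → Ω → ℕ) : Prop where
  measurable : ∀ i t, Measurable (Z i t)
  zero : ∀ i, ∀ᵐ ω ∂P, Z i 0 ω = 0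
  mono : ∀ i, ∀ᵐ ω ∂P, Monotone (fun t => Z i t ω)
  cadlag : ∀ i, ∀ᵐ ω ∂P, IsCadlag (fun t => Z i t ω)
  indep_increments : ∀ i, HasIndepIncrements (Z i) P
  law_increments : ∀ i, ∀ s t, s ≤ t →
    HasLaw (fun ω => Z i t ω - Z i s ω) (poissonMeasure (rate i * (t - s))) P
  indep : iIndepFun (fun i ω t => Z i t ω) P

/-- The jump `f(t) - f(t-)` of a path at time `t`. -/
def jump (f : ℝ≥0 → ℝ) (t : ℝ≥0) : ℝ := f t - Function.leftLim f t

/-- The interior lattice sites `1, …, 2N - 1`. -/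
abbrev Site (N : ℕ) : Type := Set.Ico 1 (2 * N)

open Classical in
/-- `ind A` is the indicator of the event `A`. -/
def ind (A : Prop) : ℝ := if A then 1 else 0

/-- Model 1 started from the law `ν`: `h` is a càdlàg process in the finite set `Space1 N`,
`h 0` has law `ν` and is independent of the clocks `L`, `R`, and `h` solves
`dh(k) = (2/√(2N)) (dL(k) 1{Δh(k) > 0} - dR(k) 1{Δh(k) < 0})`, the indicators being evaluated
just before the jump. As `h` is piecewise constant, the equation says what the jump of `h` is
at each time `t > 0`. -/
structure IsModel1 {Ω : Type*} [MeasurableSpace Ω] (σ : unitInterval → ℝ) (N : ℕ) (P : Measure Ω)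
    (ν : Measure (unitInterval → ℝ)) (L R : Site N → ℝ≥0 → Ω → ℕ) (h : ℝ≥0 → Ω → unitInterval → ℝ) : Prop where
  clocks : IsPoissonFamily P
    (Sum.elim (fun k : Site N => upRate σ N k) (fun k : Site N => downRate σ N k)) (Sum.elim L R)
  measurable : ∀ t, Measurable (h t)
  law_zero : HasLaw (h 0) ν P
  indep_zero : IndepFun (h 0) (fun ω i t => Sum.elim L R i t ω) P
  mem : ∀ᵐ ω ∂P, ∀ t, h t ω ∈ Space1 N
  cadlag : ∀ᵐ ω ∂P, IsCadlag (fun t => h t ω)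
  sde : ∀ᵐ ω ∂P, ∀ t, 0 < t → ∀ k : Site N,
    jump (fun s => h s ω (pt N k)) t = 2 / √(2 * N) *
      (jump (fun s => L k s ω) t * ind (0 < lap N (Function.leftLim (fun s => h s ω) t) k)
        - jump (fun s => R k s ω) t * ind (lap N (Function.leftLim (fun s => h s ω) t) k < 0))

/-- Model 1-w started from the law `ν`: as in Model 1, in the space of non-negative interfaces,
a downward jump at `k` being allowed only if moreover `h(k) > 1/√(2N)`. -/
structure IsModel1w {Ω : Type*} [MeasurableSpace Ω] (σ : unitInterval → ℝ) (N : ℕ) (P : Measure Ω)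
    (ν : Measure (unitInterval → ℝ)) (L R : Site N → ℝ≥0 → Ω → ℕ) (h : ℝ≥0 → Ω → unitInterval → ℝ) : Prop where
  clocks : IsPoissonFamily P
    (Sum.elim (fun k : Site N => upRate σ N k) (fun k : Site N => downRate σ N k)) (Sum.elim L R)
  measurable : ∀ t, Measurable (h t)
  law_zero : HasLaw (h 0) ν P
  indep_zero : IndepFun (h 0) (fun ω i t => Sum.elim L R i t ω) P
  mem : ∀ᵐ ω ∂P, ∀ t, h t ω ∈ Space1w N
  cadlag : ∀ᵐ ω ∂P, IsCadlag (fun t => h t ω)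
  sde : ∀ᵐ ω ∂P, ∀ t, 0 < t → ∀ k : Site N,
    jump (fun s => h s ω (pt N k)) t = 2 / √(2 * N) *
      (jump (fun s => L k s ω) t * ind (0 < lap N (Function.leftLim (fun s => h s ω) t) k)
        - jump (fun s => R k s ω) t * ind (lap N (Function.leftLim (fun s => h s ω) t) k < 0 ∧
            1 / √(2 * N) < Function.leftLim (fun s => h s ω) t (pt N k)))

/-- Model 2 started from the law `ν`: the upper interface `(h · ·).1` jumps upward at rate `p_N`
and downward at rate `q_N`, the lower interface `(h · ·).2` jumps upward at rate `q_N` and downward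
at rate `p_N`, and jumps that would break the ordering are erased. -/
structure IsModel2 {Ω : Type*} [MeasurableSpace Ω] (σ : unitInterval → ℝ) (N : ℕ) (P : Measure Ω)
    (ν : Measure ((unitInterval → ℝ) × (unitInterval → ℝ))) (L₁ R₁ L₂ R₂ : Site N → ℝ≥0 → Ω → ℕ)
    (h : ℝ≥0 → Ω → (unitInterval → ℝ) × (unitInterval → ℝ)) : Prop where
  clocks : IsPoissonFamily P
    (Sum.elim
      (Sum.elim (fun k : Site N => upRate σ N k) (fun k : Site N => downRate σ N k))
      (Sum.elim (fun k : Site N => downRate σ N k) (fun k : Site N => upRate σ N k)))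
    (Sum.elim (Sum.elim L₁ R₁) (Sum.elim L₂ R₂))
  measurable : ∀ t, Measurable (h t)
  law_zero : HasLaw (h 0) ν P
  indep_zero :
    IndepFun (h 0) (fun ω i t => Sum.elim (Sum.elim L₁ R₁) (Sum.elim L₂ R₂) i t ω) P
  mem : ∀ᵐ ω ∂P, ∀ t, h t ω ∈ Space2 N
  cadlag : ∀ᵐ ω ∂P, IsCadlag (fun t => h t ω)
  sde_upper : ∀ᵐ ω ∂P, ∀ t, 0 < t → ∀ k : Site N,
    jump (fun s => (h s ω).1 (pt N k)) t = 2 / √(2 * N) *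
      (jump (fun s => L₁ k s ω) t *
          ind (0 < lap N (Function.leftLim (fun s => h s ω) t).1 k)
        - jump (fun s => R₁ k s ω) t *
          ind (lap N (Function.leftLim (fun s => h s ω) t).1 k < 0 ∧
            (Function.leftLim (fun s => h s ω) t).2 (pt N k)
              < (Function.leftLim (fun s => h s ω) t).1 (pt N k)))
  sde_lower : ∀ᵐ ω ∂P, ∀ t, 0 < t → ∀ k : Site N,
    jump (fun s => (h s ω).2 (pt N k)) t = 2 / √(2 * N) *
      (jump (fun s => L₂ k s ω) t *
          ind (0 < lap N (Function.leftLim (fun s => h s ω) t).2 k ∧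
            (Function.leftLim (fun s => h s ω) t).2 (pt N k)
              < (Function.leftLim (fun s => h s ω) t).1 (pt N k))
        - jump (fun s => R₂ k s ω) t *
          ind (lap N (Function.leftLim (fun s => h s ω) t).2 k < 0))

/-! ### Particle configurations and the local functionals -/

open Classical in
/-- The particle configuration of an interface, extended `2N`-periodically to `ℤ`: for
`1 ≤ j ≤ 2N` there is a particle at site `j` iff the slope on `[(j-1)_N, j_N]` is positive. -/
def particles (N : ℕ) (h : unitInterval → ℝ) (j : ℤ) : Bool :=
  decide (h (pt N ((j - 1) % (2 * N : ℤ)).toNat) < h (pt N (((j - 1) % (2 * N : ℤ)).toNat + 1)))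

/-- The shift `τ_j η (i) = η (i + j)`. -/
def shift (j : ℤ) (η : ℤ → Bool) : ℤ → Bool := fun i => η (i + j)

/-- `Φ(η) = Φ(η(1), …, η(l))`. -/
def extend {l : ℕ} (Φ : (Fin l → Bool) → ℝ) (η : ℤ → Bool) : ℝ :=
  Φ (fun m => η ((m : ℤ) + 1))

/-- The expectation of `Φ` under the product of Bernoulli measures with parameter `a`. -/
def bernoulliMean {l : ℕ} (Φ : (Fin l → Bool) → ℝ) (a : ℝ) : ℝ :=
  ∑ ξ : Fin l → Bool, Φ ξ *
    (a ^ (Finset.univ.filter (fun i => ξ i = true)).card *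
      (1 - a) ^ (Finset.univ.filter (fun i => ξ i = false)).card)

/-- The average of `g` over the sites `j` with `|i - j| ≤ ⌊εN⌋`. -/
def blockAvg (N : ℕ) (ε : ℝ) (g : ℤ → ℝ) (i : ℤ) : ℝ :=
  (∑ j ∈ Finset.Icc (i - ⌊ε * N⌋) (i + ⌊ε * N⌋), g j) / (2 * (⌊ε * N⌋ : ℝ) + 1)

/-- The potential `V_{N,ε}` of one particle configuration. -/
def potential {l : ℕ} (Φ : (Fin l → Bool) → ℝ) (N : ℕ) (ε : ℝ) (η : ℤ → Bool) : ℝ :=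
  ∑ i ∈ Finset.Icc (1 : ℤ) (2 * N),
    |blockAvg N ε (fun j => extend Φ (shift j η)) i
      - bernoulliMean Φ (blockAvg N ε (fun j => ((η j).toNat : ℝ)) i)|

end

end InterfaceModel

namespace InterfaceModel

noncomputable section

/-! ### Exchanges of two sites -/

section Exchange

variable {K Y : Type*} [DecidableEq K]

/-- The state in which the values of the first configuration at `a` and `b` are exchanged. -/
def exchange (a b : K) (s : (K → Bool) × Y) : (K → Bool) × Y := (s.1 ∘ Equiv.swap a b, s.2)

theorem exchange_exchange (a b : K) (s : (K → Bool) × Y) :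
    exchange a b (exchange a b s) = s := by
  ext x <;> simp [exchange]

theorem exchange_of_eq {a b : K} {s : (K → Bool) × Y} (h : s.1 a = s.1 b) :
    exchange a b s = s := by
  refine Prod.ext (funext fun x => ?_) rfl
  simp only [exchange, Function.comp, Equiv.swap_apply_def]
  split_ifs with h1 h2
  · rw [h1, h]
  · rw [h2, h]
  · rfl

theorem exchange_comm (a b : K) (s : (K → Bool) × Y) : exchange a b s = exchange b a s := by
  rw [exchange, exchange, Equiv.swap_comm]

theorem exchange_fst_left (a b : K) (s : (K → Bool) × Y) : (exchange a b s).1 a = s.1 b := by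
  simp [exchange]

theorem exchange_fst_right (a b : K) (s : (K → Bool) × Y) : (exchange a b s).1 b = s.1 a := by
  simp [exchange]

theorem exchange_fst_of_ne {a b x : K} (s : (K → Bool) × Y) (h : x ≠ a) (h' : x ≠ b) :
    (exchange a b s).1 x = s.1 x := by
  simp [exchange, Equiv.swap_apply_of_ne_of_ne h h']

theorem exchange_braid {a b c : K} (hab : a ≠ b) (hbc : b ≠ c) (hac : a ≠ c)
    (s : (K → Bool) × Y) :
    exchange a c s = exchange b c (exchange a b (exchange b c s)) := by
  refine Prod.ext (funext fun x => ?_) rfl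
  simp only [exchange, Function.comp, Equiv.swap_apply_def]
  grind

/-- The exchange as a permutation of the states. -/
def exchangeEquiv (a b : K) : (K → Bool) × Y ≃ (K → Bool) × Y :=
  ⟨exchange a b, exchange a b, exchange_exchange a b, exchange_exchange a b⟩

theorem sum_exchange [Fintype K] [Fintype Y] (a b : K) (f : (K → Bool) × Y → ℝ) :
    ∑ s, f (exchange a b s) = ∑ s, f s :=
  Equiv.sum_comp (exchangeEquiv a b) f

/-- `S` is stable under the exchanges of `a` and `b` that bring the value `c` from `a` to `b`. -/
def StableAt (S : Set ((K → Bool) × Y)) (c : Bool) (a b : K) : Prop :=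
  ∀ s ∈ S, s.1 a = c → s.1 b = !c → exchange a b s ∈ S

open Classical in
/-- The contribution of a state to the Dirichlet form of the exchange of `a` and `b`. -/
def edgeEnergy (S : Set ((K → Bool) × Y)) (c : Bool) (u : (K → Bool) × Y → ℝ) (a b : K)
    (s : (K → Bool) × Y) : ℝ :=
  if s ∈ S ∧ s.1 a = c ∧ s.1 b = !c then (u (exchange a b s) - u s) ^ 2 else 0

/-- The Dirichlet form of the exchange of `a` and `b`. -/
def energy [Fintype K] [Fintype Y] (S : Set ((K → Bool) × Y)) (c : Bool) (u : (K → Bool) × Y → ℝ) (a b : K) : ℝ :=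
  ∑ s, edgeEnergy S c u a b s

theorem edgeEnergy_nonneg (S : Set ((K → Bool) × Y)) (c : Bool) (u : (K → Bool) × Y → ℝ) (a b : K)
    (s : (K → Bool) × Y) : 0 ≤ edgeEnergy S c u a b s := by
  unfold edgeEnergy; split_ifs <;> positivity

theorem energy_nonneg [Fintype K] [Fintype Y] (S : Set ((K → Bool) × Y)) (c : Bool) (u : (K → Bool) × Y → ℝ) (a b : K) :
    0 ≤ energy S c u a b := Finset.sum_nonneg fun _ _ => edgeEnergy_nonneg _ _ _ _ _ _

variable {S : Set ((K → Bool) × Y)} {c : Bool}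

theorem StableAt.trans_of_ne {x y z : K} (hxy : x ≠ y) (hyz : y ≠ z) (hxz : x ≠ z)
    (h1 : StableAt S c x y) (h2 : StableAt S c y z) : StableAt S c x z := by
  intro s hs hx hz
  rw [exchange_braid hxy hyz hxz]
  by_cases hy : s.1 y = c
  · have e1 : exchange y z s ∈ S := h2 s hs hy hz
    have e2 : exchange x y (exchange y z s) ∈ S := by
      refine h1 _ e1 ?_ ?_
      · rw [exchange_fst_of_ne _ hxy hxz, hx]
      · rw [exchange_fst_left, hz]
    rwa [exchange_of_eq (a := y) (b := z)]
    rw [exchange_fst_right, exchange_fst_of_ne _ hxy hxz,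
      exchange_fst_of_ne _ hxz.symm hyz.symm, exchange_fst_right, hx, hy]
  · have hy' : s.1 y = !c := by grind
    rw [exchange_of_eq (a := y) (b := z) (s := s) (by rw [hy', hz])]
    refine h2 _ (h1 s hs hx hy') ?_ ?_
    · rw [exchange_fst_right, hx]
    · rw [exchange_fst_of_ne _ hxz.symm hyz.symm, hz]

theorem sq_sub_le_of_pos {k : ℝ} (hk : 0 < k) (x y z : ℝ) :
    (x - z) ^ 2 ≤ (1 + 1 / k) * (x - y) ^ 2 + (1 + k) * (y - z) ^ 2 := by
  have : (1 + 1 / k) * (x - y) ^ 2 + (1 + k) * (y - z) ^ 2 - (x - z) ^ 2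
      = (1 / k) * ((x - y) - k * (y - z)) ^ 2 := by field_simp; ring
  nlinarith [mul_nonneg (one_div_pos.2 hk).le (sq_nonneg ((x - y) - k * (y - z)))]

open Classical in
theorem edgeEnergy_le {x y z : K} (hxy : x ≠ y) (hyz : y ≠ z) (hxz : x ≠ z)
    (h1 : StableAt S c x y) (h2 : StableAt S c y z) (u : (K → Bool) × Y → ℝ) {k : ℝ} (hk : 0 < k)
    (s : (K → Bool) × Y) :
    edgeEnergy S c u x z s ≤
      (1 + 1 / k) * ((if s.1 z = !c then edgeEnergy S c u x y s else 0)
        + (if (exchange y z s).1 z = c then edgeEnergy S c u x y (exchange y z s) else 0))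
      + (1 + k) * ((if (exchange x y s).1 x = !c then edgeEnergy S c u y z (exchange x y s) else 0)
        + (if s.1 x = c then edgeEnergy S c u y z s else 0)) := by
  have nn : ∀ (p : Prop) [Decidable p] (a b : K) (s : (K → Bool) × Y),
      0 ≤ (if p then edgeEnergy S c u a b s else 0) := fun p _ a b s => by
    split_ifs
    · exact edgeEnergy_nonneg _ _ _ _ _ _
    · rfl
  by_cases hs : s ∈ S ∧ s.1 x = c ∧ s.1 z = !c
  · obtain ⟨hs, hx, hz⟩ := hs
    have e0 : edgeEnergy S c u x z s = (u (exchange x z s) - u s) ^ 2 := if_pos ⟨hs, hx, hz⟩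
    rw [e0, exchange_braid hxy hyz hxz]
    by_cases hy : s.1 y = c
    · have e1 : exchange y z s ∈ S := h2 s hs hy hz
      have f1 : exchange y z (exchange x y (exchange y z s)) = exchange x y (exchange y z s) := by
        apply exchange_of_eq
        rw [exchange_fst_right, exchange_fst_of_ne _ hxy hxz,
          exchange_fst_of_ne _ hxz.symm hyz.symm, exchange_fst_right, hx, hy]
      rw [f1]
      have g1 : (if (exchange y z s).1 z = c then edgeEnergy S c u x y (exchange y z s) else 0)
          = (u (exchange x y (exchange y z s)) - u (exchange y z s)) ^ 2 := by
        rw [if_pos (by rw [exchange_fst_right, hy]), edgeEnergy, if_pos]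
        exact ⟨e1, by rw [exchange_fst_of_ne _ hxy hxz, hx], by rw [exchange_fst_left, hz]⟩
      have g2 : (if s.1 x = c then edgeEnergy S c u y z s else 0)
          = (u (exchange y z s) - u s) ^ 2 := by
        rw [if_pos hx, edgeEnergy, if_pos ⟨hs, hy, hz⟩]
      have key := sq_sub_le_of_pos hk (u (exchange x y (exchange y z s))) (u (exchange y z s)) (u s)
      rw [g1, g2]
      have t1 := mul_nonneg (by positivity : 0 ≤ 1 + 1 / k) (nn (s.1 z = !c) x y s)
      have t2 := mul_nonneg (by positivity : 0 ≤ 1 + k)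
        (nn ((exchange x y s).1 x = !c) y z (exchange x y s))
      linarith
    · have hy' : s.1 y = !c := by grind
      rw [exchange_of_eq (a := y) (b := z) (s := s) (by rw [hy', hz])]
      have e1 : exchange x y s ∈ S := h1 s hs hx hy'
      have g1 : (if s.1 z = !c then edgeEnergy S c u x y s else 0)
          = (u (exchange x y s) - u s) ^ 2 := by
        rw [if_pos hz, edgeEnergy, if_pos ⟨hs, hx, hy'⟩]
      have g2 : (if (exchange x y s).1 x = !c then edgeEnergy S c u y z (exchange x y s) else 0)
          = (u (exchange y z (exchange x y s)) - u (exchange x y s)) ^ 2 := by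
        rw [if_pos (by rw [exchange_fst_left, hy']), edgeEnergy, if_pos]
        exact ⟨e1, by rw [exchange_fst_right, hx],
          by rw [exchange_fst_of_ne _ hxz.symm hyz.symm, hz]⟩
      have key := sq_sub_le_of_pos hk (u s) (u (exchange x y s))
        (u (exchange y z (exchange x y s)))
      rw [g1, g2]
      have t1 := mul_nonneg (by positivity : 0 ≤ 1 + 1 / k)
        (nn (s.1 z = c) x y s)
      have t2 := mul_nonneg (by positivity : 0 ≤ 1 + k) (nn (s.1 x = c) y z s)
      have h3 : (u (exchange y z (exchange x y s)) - u s) ^ 2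
        = (u s - u (exchange y z (exchange x y s))) ^ 2 := by ring
      have h4 : (u (exchange x y s) - u s) ^ 2 = (u s - u (exchange x y s)) ^ 2 := by ring
      have h5 : (u (exchange y z (exchange x y s)) - u (exchange x y s)) ^ 2
        = (u (exchange x y s) - u (exchange y z (exchange x y s))) ^ 2 := by ring
      rw [h3, h4, h5]
      linarith
  · have e0 : edgeEnergy S c u x z s = 0 := if_neg hs
    rw [e0]
    exact add_nonneg (mul_nonneg (by positivity) (add_nonneg (nn _ _ _ _) (nn _ _ _ _)))
      (mul_nonneg (by positivity) (add_nonneg (nn _ _ _ _) (nn _ _ _ _)))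

variable [Fintype K] [Fintype Y]

theorem energy_trans_le {x y z : K} (hxy : x ≠ y) (hyz : y ≠ z) (hxz : x ≠ z)
    (h1 : StableAt S c x y) (h2 : StableAt S c y z) (u : (K → Bool) × Y → ℝ) {k : ℝ} (hk : 0 < k) :
    energy S c u x z ≤ (1 + 1 / k) * energy S c u x y + (1 + k) * energy S c u y z := by
  classical
  refine (Finset.sum_le_sum fun s _ => edgeEnergy_le hxy hyz hxz h1 h2 u hk s).trans_eq ?_
  rw [Finset.sum_add_distrib, ← Finset.mul_sum, ← Finset.mul_sum, Finset.sum_add_distrib,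
    Finset.sum_add_distrib,
    sum_exchange y z (fun s => if s.1 z = c then edgeEnergy S c u x y s else 0),
    sum_exchange x y (fun s => if s.1 x = !c then edgeEnergy S c u y z s else 0),
    ← Finset.sum_add_distrib, ← Finset.sum_add_distrib]
  have aux : ∀ (b : Bool) (r : ℝ), (if b = !c then r else 0) + (if b = c then r else 0) = r := by
    intro b r
    cases b <;> cases c <;> simp
  simp only [aux]
  rfl

/-- The sum of a function of the state against the weights `u²` on `S`. -/
def wsum (S : Set ((K → Bool) × Y)) (u f : (K → Bool) × Y → ℝ) : ℝ :=
  ∑ s, f s * S.indicator (fun s => u s ^ 2) s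

/-- The occupation number of a site. -/
def occ (x : K) (s : (K → Bool) × Y) : ℝ := ((s.1 x).toNat : ℝ)

/-- The sign with which occupation numbers decrease along the direction `c`. -/
def dirSign (c : Bool) : ℝ := if c then -1 else 1

theorem sum_eq_sum_exchange (c : Bool) (x y : K) (f : (K → Bool) × Y → ℝ)
    (hf : ∀ s, s.1 x = s.1 y → f s = 0) :
    ∑ s, f s = ∑ s, if s.1 x = c ∧ s.1 y = !c then f s + f (exchange x y s) else 0 := by
  have h1 : ∀ s, f s = (if s.1 x = c ∧ s.1 y = !c then f s else 0)
      + (if s.1 y = c ∧ s.1 x = !c then f s else 0) := by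
    intro s
    by_cases h : s.1 x = s.1 y
    · simp [hf s h]
    · rcases hx : s.1 x <;> rcases hy : s.1 y <;> cases c <;> simp_all
  have h2 : ∑ s, (if s.1 y = c ∧ s.1 x = !c then f s else 0)
      = ∑ s, (if s.1 x = c ∧ s.1 y = !c then f (exchange x y s) else 0) := by
    rw [← sum_exchange x y]
    simp only [exchange_fst_left, exchange_fst_right]
  rw [Finset.sum_congr rfl fun s _ => h1 s, Finset.sum_add_distrib, h2, ← Finset.sum_add_distrib]
  refine Finset.sum_congr rfl fun s _ => ?_
  split_ifs <;> simp

theorem sum_pair_le_wsum (S : Set ((K → Bool) × Y)) (c : Bool) (x y : K)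
    (u : (K → Bool) × Y → ℝ) :
    ∑ s, (if s.1 x = c ∧ s.1 y = !c then S.indicator (fun s => u s ^ 2) s
      + S.indicator (fun s => u s ^ 2) (exchange x y s) else 0) ≤ wsum S u 1 := by
  classical
  set q : (K → Bool) × Y → ℝ := S.indicator (fun s => u s ^ 2) with hq
  have hq0 : ∀ s, 0 ≤ q s := fun s => Set.indicator_nonneg (fun _ _ => sq_nonneg _) s
  have := sum_eq_sum_exchange c x y (fun s => if s.1 x = s.1 y then 0 else q s)
    (fun s hs => if_pos hs)
  refine le_trans (le_of_eq ?_) (this.symm.trans_le ?_)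
  · refine Finset.sum_congr rfl fun s _ => ?_
    by_cases hs : s.1 x = c ∧ s.1 y = !c
    · have h1 : s.1 x ≠ s.1 y := by rw [hs.1, hs.2]; cases c <;> simp
      rw [if_pos hs, if_pos hs, if_neg h1, if_neg]
      rwa [exchange_fst_left, exchange_fst_right, ne_comm] at *
    · rw [if_neg hs, if_neg hs]
  · refine Finset.sum_le_sum fun s _ => ?_
    split_ifs
    · simpa using hq0 s
    · simp [hq]

theorem abs_wsum_exchange_le {x y : K} (h : StableAt S c x y)
    (u : (K → Bool) × Y → ℝ) (W : (K → Bool) × Y → ℝ) (hW : ∀ s, |W s| ≤ 1) {κ lam : ℝ}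
    (hκ0 : 0 ≤ κ) (hκ : ∀ s, |W s - W (exchange x y s)| ≤ κ) (hlam : 0 < lam) :
    |wsum S u (fun s => W s * (occ x s - occ y s))| ≤
      dirSign c * wsum S u (fun s => occ x s - occ y s)
        + (lam * energy S c u x y + (2 / lam + κ) * wsum S u 1) := by
  classical
  set q : (K → Bool) × Y → ℝ := S.indicator (fun s => u s ^ 2) with hq
  have hq0 : ∀ s, 0 ≤ q s := fun s => Set.indicator_nonneg (fun _ _ => sq_nonneg _) s
  have hform : ∀ V : (K → Bool) × Y → ℝ, wsum S u (fun s => V s * (occ x s - occ y s))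
      = ∑ s, if s.1 x = c ∧ s.1 y = !c then
          dirSign c * (V (exchange x y s) * q (exchange x y s) - V s * q s) else 0 := by
    intro V
    rw [wsum, sum_eq_sum_exchange c x y _ (fun s hs => by simp [occ, hs])]
    refine Finset.sum_congr rfl fun s _ => ?_
    split_ifs with hs
    · simp only [occ, exchange_fst_left, exchange_fst_right, hs.1, hs.2, ← hq, dirSign]
      cases c <;> simp <;> ring
    · rfl
  have hone : wsum S u (fun s => occ x s - occ y s)
      = wsum S u (fun s => 1 * (occ x s - occ y s)) := by simp
  have hmass := sum_pair_le_wsum S c x y u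
  rw [← hq] at hmass
  have hd : dirSign c * dirSign c = 1 := by cases c <;> simp [dirSign]
  have hdabs : |dirSign c| = 1 := by cases c <;> simp [dirSign]
  rw [hone, hform W, hform (fun _ => 1), Finset.mul_sum]
  calc _ ≤ ∑ s, |if s.1 x = c ∧ s.1 y = !c then
          dirSign c * (W (exchange x y s) * q (exchange x y s) - W s * q s) else 0| :=
        Finset.abs_sum_le_sum_abs _ _
    _ ≤ ∑ s, (dirSign c * (if s.1 x = c ∧ s.1 y = !c then
          dirSign c * (1 * q (exchange x y s) - 1 * q s) else 0)
          + (lam * edgeEnergy S c u x y s + (2 / lam + κ) *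
            (if s.1 x = c ∧ s.1 y = !c then q s + q (exchange x y s) else 0))) := by
        refine Finset.sum_le_sum fun s _ => ?_
        by_cases hs : s.1 x = c ∧ s.1 y = !c
        · rw [if_pos hs, if_pos hs, if_pos hs, abs_mul, hdabs, ← mul_assoc, hd, one_mul, one_mul,
            one_mul, one_mul]
          have hW1 := hW (exchange x y s)
          have hq1 := hq0 s
          have hq2 := hq0 (exchange x y s)
          have hW2 : |W (exchange x y s) * q (exchange x y s)| ≤ q (exchange x y s) := by
            rw [abs_mul, abs_of_nonneg hq2]
            exact mul_le_of_le_one_left hq2 hW1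
          by_cases hS : s ∈ S
          · have e1 : edgeEnergy S c u x y s = (u (exchange x y s) - u s) ^ 2 :=
              if_pos ⟨hS, hs⟩
            have e2 : q s = u s ^ 2 := Set.indicator_of_mem hS _
            have e3 : q (exchange x y s) = u (exchange x y s) ^ 2 :=
              Set.indicator_of_mem (h s hS hs.1 hs.2) _
            have k1 : |W (exchange x y s) * q (exchange x y s) - W s * q s|
                ≤ |q (exchange x y s) - q s| + κ * q s := by
              have : W (exchange x y s) * q (exchange x y s) - W s * q s
                = W (exchange x y s) * (q (exchange x y s) - q s)
                  - (W s - W (exchange x y s)) * q s := by ring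
              rw [this]
              refine (abs_sub _ _).trans (add_le_add ?_ ?_)
              · rw [abs_mul]
                exact mul_le_of_le_one_left (abs_nonneg _) hW1
              · rw [abs_mul, abs_of_nonneg hq1]
                exact mul_le_mul_of_nonneg_right (hκ s) hq1
            have k2 : 2 * |q (exchange x y s) - q s|
                ≤ lam * (u (exchange x y s) - u s) ^ 2
                  + 2 / lam * (q s + q (exchange x y s)) := by
              rw [e2, e3, show u (exchange x y s) ^ 2 - u s ^ 2
                = (u (exchange x y s) - u s) * (u (exchange x y s) + u s) by ring, abs_mul]
              generalize u (exchange x y s) = α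
              generalize u s = β
              have a1 : 2 / lam * (β ^ 2 + α ^ 2)
                = 1 / lam * (|α + β| ^ 2 + |α - β| ^ 2) := by
                rw [sq_abs, sq_abs]; field_simp; ring
              have a2 : lam * (α - β) ^ 2 + 1 / lam * |α + β| ^ 2 - 2 * (|α - β| * |α + β|)
                = 1 / lam * (lam * |α - β| - |α + β|) ^ 2 := by
                rw [← sq_abs (α - β)]; field_simp; ring
              have a3 : 0 ≤ 1 / lam * (lam * |α - β| - |α + β|) ^ 2 := by positivity
              have a4 : 0 ≤ 1 / lam * |α - β| ^ 2 := by positivity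
              linarith
            have k3 := neg_abs_le (q (exchange x y s) - q s)
            have k4 : 0 ≤ κ * q (exchange x y s) := mul_nonneg hκ0 hq2
            rw [e1]
            linarith
          · have e2 : q s = 0 := Set.indicator_of_notMem hS _
            have e1 := mul_nonneg hlam.le (edgeEnergy_nonneg S c u x y s)
            have e3 : 0 ≤ (2 / lam + κ) * q (exchange x y s) :=
              mul_nonneg (add_nonneg (by positivity) hκ0) hq2
            rw [e2, mul_zero, sub_zero, sub_zero, zero_add]
            linarith
        · rw [if_neg hs, if_neg hs, if_neg hs]
          have e1 := mul_nonneg hlam.le (edgeEnergy_nonneg S c u x y s)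
          simpa using e1
    _ ≤ _ := by
        rw [Finset.sum_add_distrib, Finset.sum_add_distrib, ← Finset.mul_sum, ← Finset.mul_sum,
          energy]
        have := mul_le_mul_of_nonneg_left hmass (add_nonneg (by positivity) hκ0 : 0 ≤ 2 / lam + κ)
        rw [← Finset.mul_sum]
        linarith

end Exchange

/-! ### Long-range exchanges -/

section Chain

variable {n : ℕ}

theorem intCast_ne_of_lt {a b : ℤ} (ha : 1 ≤ a) (hab : a < b) (hb : b ≤ n) :
    (a : ZMod n) ≠ (b : ZMod n) := by
  intro h
  rw [ZMod.intCast_eq_intCast_iff_dvd_sub] at h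
  have := Int.le_of_dvd (by omega) h
  omega

theorem intCast_eq_iff_of_mem {a b : ℤ} (ha : a ∈ Set.Icc (1 : ℤ) n) (hb : b ∈ Set.Icc (1 : ℤ) n) :
    (a : ZMod n) = (b : ZMod n) ↔ a = b := by
  refine ⟨fun h => ?_, fun h => by rw [h]⟩
  rcases lt_trichotomy a b with h' | h' | h'
  · exact absurd h (intCast_ne_of_lt ha.1 h' hb.2)
  · exact h'
  · exact absurd h.symm (intCast_ne_of_lt hb.1 h' ha.2)

variable [NeZero n] {Y : Type*} [Fintype Y]

/-- `S` is stable under the exchanges of neighbouring sites that bring the value `c` to the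
right, the sites `n` and `1` not being neighbours. -/
def ChainStable (S : Set ((ZMod n → Bool) × Y)) (c : Bool) : Prop :=
  ∀ k : ℤ, 1 ≤ k → k + 1 ≤ n → StableAt S c (k : ZMod n) ((k + 1 : ℤ) : ZMod n)

/-- The Dirichlet form of the exchanges of neighbouring sites. -/
def chainEnergy (S : Set ((ZMod n → Bool) × Y)) (c : Bool) (u : (ZMod n → Bool) × Y → ℝ) : ℝ :=
  ∑ k ∈ Finset.Ico (1 : ℤ) n, energy S c u (k : ZMod n) ((k + 1 : ℤ) : ZMod n)

theorem chainEnergy_nonneg (S : Set ((ZMod n → Bool) × Y)) (c : Bool)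
    (u : (ZMod n → Bool) × Y → ℝ) : 0 ≤ chainEnergy S c u :=
  Finset.sum_nonneg fun _ _ => energy_nonneg _ _ _ _ _

variable {S : Set ((ZMod n → Bool) × Y)} {c : Bool}

theorem ChainStable.energy_le_sum (h : ChainStable S c) (u : (ZMod n → Bool) × Y → ℝ) {a : ℤ}
    (ha : 1 ≤ a) (d : ℕ) (hd : a + (d + 1) ≤ n) :
    StableAt S c (a : ZMod n) ((a + (d + 1) : ℤ) : ZMod n) ∧
    energy S c u (a : ZMod n) ((a + (d + 1) : ℤ) : ZMod n) ≤
      (d + 1) * ∑ k ∈ Finset.Ico a (a + (d + 1)), energy S c u (k : ZMod n) ((k + 1 : ℤ) : ZMod n) := by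
  induction d with
  | zero =>
    refine ⟨by simpa using h a ha (by simpa using hd), ?_⟩
    have : Finset.Ico a (a + ((0 : ℕ) + 1)) = {a} := by ext; simp; omega
    rw [this]
    simp
  | succ d ih =>
    simp only [Nat.cast_add, Nat.cast_one] at hd ⊢
    obtain ⟨ih1, ih2⟩ := ih (by omega)
    have hk := h (a + (d + 1)) (by omega) (by omega)
    have n1 := intCast_ne_of_lt (n := n) ha (show a < a + (d + 1) by omega) (by omega)
    have n2 := intCast_ne_of_lt (n := n) (show 1 ≤ a + (d + 1) by omega)
      (show a + (d + 1) < a + (d + 1) + 1 by omega) (by omega)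
    have n3 := intCast_ne_of_lt (n := n) ha (show a < a + (d + 1) + 1 by omega) (by omega)
    rw [show a + ((d : ℤ) + 1 + 1) = a + (d + 1) + 1 by ring]
    have hpos : (0 : ℝ) < d + 1 := by positivity
    refine ⟨ih1.trans_of_ne n1 n2 n3 hk, (energy_trans_le n1 n2 n3 ih1 hk u hpos).trans ?_⟩
    have hs : Finset.Ico a (a + (d + 1) + 1) = insert (a + (d + 1)) (Finset.Ico a (a + (d + 1))) := by
      ext; simp; omega
    rw [hs, Finset.sum_insert (by simp)]
    have := mul_le_mul_of_nonneg_left ih2 (by positivity : (0 : ℝ) ≤ 1 + 1 / (d + 1))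
    have e : ((1 : ℝ) + 1 / (d + 1)) * ((d + 1) *
      ∑ k ∈ Finset.Ico a (a + (d + 1)), energy S c u (k : ZMod n) ((k + 1 : ℤ) : ZMod n))
      = (d + 1 + 1) *
      ∑ k ∈ Finset.Ico a (a + (d + 1)), energy S c u (k : ZMod n) ((k + 1 : ℤ) : ZMod n) := by
      field_simp
    linarith

theorem ChainStable.energy_le (h : ChainStable S c) (u : (ZMod n → Bool) × Y → ℝ) {a b : ℤ}
    (ha : 1 ≤ a) (hab : a < b) (hb : b ≤ n) :
    StableAt S c (a : ZMod n) (b : ZMod n) ∧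
    energy S c u (a : ZMod n) (b : ZMod n) ≤ (b - a) * chainEnergy S c u := by
  obtain ⟨d, rfl⟩ : ∃ d : ℕ, b = a + (d + 1) := ⟨(b - a - 1).toNat, by omega⟩
  obtain ⟨h1, h2⟩ := h.energy_le_sum u ha d hb
  refine ⟨h1, h2.trans ?_⟩
  have : ∑ k ∈ Finset.Ico a (a + (d + 1)), energy S c u (k : ZMod n) ((k + 1 : ℤ) : ZMod n)
      ≤ chainEnergy S c u := by
    refine Finset.sum_le_sum_of_subset_of_nonneg (fun k hk => ?_)
      fun _ _ _ => energy_nonneg _ _ _ _ _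
    simp only [Finset.mem_Ico] at hk ⊢
    omega
  rw [show ((a + (d + 1) : ℤ) : ℝ) - a = d + 1 by push_cast; ring]
  exact mul_le_mul_of_nonneg_left this (by positivity)

theorem wsum_add (S : Set ((ZMod n → Bool) × Y)) (u f g : (ZMod n → Bool) × Y → ℝ) :
    wsum S u (fun s => f s + g s) = wsum S u f + wsum S u g := by
  simp only [wsum, ← Finset.sum_add_distrib, add_mul]

theorem wsum_sub (S : Set ((ZMod n → Bool) × Y)) (u f g : (ZMod n → Bool) × Y → ℝ) :
    wsum S u (fun s => f s - g s) = wsum S u f - wsum S u g := by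
  simp only [wsum, ← Finset.sum_sub_distrib, sub_mul]

theorem wsum_const_mul (S : Set ((ZMod n → Bool) × Y)) (u f : (ZMod n → Bool) × Y → ℝ) (r : ℝ) :
    wsum S u (fun s => r * f s) = r * wsum S u f := by
  simp only [wsum, Finset.mul_sum, mul_assoc]

theorem wsum_sum {ι : Type*} (I : Finset ι) (S : Set ((ZMod n → Bool) × Y))
    (u : (ZMod n → Bool) × Y → ℝ) (f : ι → (ZMod n → Bool) × Y → ℝ) :
    wsum S u (fun s => ∑ i ∈ I, f i s) = ∑ i ∈ I, wsum S u (f i) := by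
  simp only [wsum, Finset.sum_mul]
  rw [Finset.sum_comm]

theorem wsum_mono (S : Set ((ZMod n → Bool) × Y)) (u : (ZMod n → Bool) × Y → ℝ)
    {f g : (ZMod n → Bool) × Y → ℝ} (h : ∀ s, f s ≤ g s) : wsum S u f ≤ wsum S u g :=
  Finset.sum_le_sum fun s _ => mul_le_mul_of_nonneg_right (h s)
    (Set.indicator_nonneg (fun _ _ => sq_nonneg _) s)

theorem wsum_const (S : Set ((ZMod n → Bool) × Y)) (u : (ZMod n → Bool) × Y → ℝ) (r : ℝ) :
    wsum S u (fun _ => r) = r * wsum S u 1 := by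
  simp only [wsum, Finset.mul_sum, Pi.one_apply, one_mul]

theorem wsum_nonneg (S : Set ((ZMod n → Bool) × Y)) (u : (ZMod n → Bool) × Y → ℝ)
    {f : (ZMod n → Bool) × Y → ℝ} (h : ∀ s, 0 ≤ f s) : 0 ≤ wsum S u f :=
  Finset.sum_nonneg fun s _ => mul_nonneg (h s)
    (Set.indicator_nonneg (fun _ _ => sq_nonneg _) s)

theorem wsum_occ_mem (S : Set ((ZMod n → Bool) × Y)) (u : (ZMod n → Bool) × Y → ℝ) (x : ZMod n) :
    0 ≤ wsum S u (occ x) ∧ wsum S u (occ x) ≤ wsum S u 1 := by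
  refine ⟨wsum_nonneg _ _ fun s => by simp [occ], wsum_mono _ _ fun s => ?_⟩
  cases h : s.1 x <;> simp [occ, h]

theorem ChainStable.abs_wsum_le (h : ChainStable S c) (u : (ZMod n → Bool) × Y → ℝ) {a b : ℤ}
    (ha : a ∈ Set.Icc (1 : ℤ) n) (hb : b ∈ Set.Icc (1 : ℤ) n) (W : (ZMod n → Bool) × Y → ℝ)
    (hW : ∀ s, |W s| ≤ 1) {κ lam : ℝ} (hκ0 : 0 ≤ κ)
    (hκ : ∀ s, |W s - W (exchange (a : ZMod n) (b : ZMod n) s)| ≤ κ) (hlam : 0 < lam) :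
    |wsum S u (fun s => W s * (occ (a : ZMod n) s - occ (b : ZMod n) s))| ≤
      dirSign c * ((b - a).sign : ℝ) * (wsum S u (occ (a : ZMod n)) - wsum S u (occ (b : ZMod n)))
        + (lam * |(a : ℝ) - b| * chainEnergy S c u + (2 / lam + κ) * wsum S u 1) := by
  have hQ : 0 ≤ wsum S u 1 := wsum_nonneg _ _ fun _ => zero_le_one
  have hE := chainEnergy_nonneg S c u
  rcases lt_trichotomy a b with hab | rfl | hab
  · obtain ⟨h1, h2⟩ := h.energy_le u ha.1 hab hb.2
    refine (abs_wsum_exchange_le h1 u W hW hκ0 hκ hlam).trans ?_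
    rw [Int.sign_eq_one_of_pos (by omega), wsum_sub, abs_sub_comm,
      abs_of_pos (by exact_mod_cast sub_pos.2 hab : (0 : ℝ) < b - a)]
    have := mul_le_mul_of_nonneg_left h2 hlam.le
    push_cast
    linarith
  · have e : (fun s : (ZMod n → Bool) × Y => W s * (occ (a : ZMod n) s - occ (a : ZMod n) s))
        = fun _ => 0 := by funext s; ring
    rw [e, wsum_const]
    have : 0 ≤ (2 / lam + κ) * wsum S u 1 := mul_nonneg (by positivity) hQ
    simpa using this
  · obtain ⟨h1, h2⟩ := h.energy_le u hb.1 hab ha.2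
    have key := abs_wsum_exchange_le h1 u W hW hκ0
      (fun s => by rw [exchange_comm]; exact hκ s) hlam
    have e : (fun s : (ZMod n → Bool) × Y => W s * (occ (a : ZMod n) s - occ (b : ZMod n) s))
        = fun s => (-1) * (W s * (occ (b : ZMod n) s - occ (a : ZMod n) s)) := by funext s; ring
    rw [e, wsum_const_mul, abs_mul, abs_neg, abs_one, one_mul]
    refine key.trans ?_
    rw [Int.sign_eq_neg_one_of_neg (by omega), wsum_sub,
      abs_of_pos (by exact_mod_cast sub_pos.2 hab : (0 : ℝ) < a - b)]
    have := mul_le_mul_of_nonneg_left h2 hlam.le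
    push_cast
    linarith

theorem abs_sum_shift_sub_le {f : ℤ → ℝ} {Q : ℝ} (h0 : ∀ j, 0 ≤ f j) (h1 : ∀ j, f j ≤ Q)
    (p : ℤ) (k : ℕ) (a b : ℤ) :
    |∑ i ∈ Finset.range k, (f (p + i + a) - f (p + i + b))| ≤ |(a : ℝ) - b| * Q := by
  have step : ∀ b : ℤ, ∀ d : ℕ,
      |∑ i ∈ Finset.range k, (f (p + i + (b + d)) - f (p + i + b))| ≤ d * Q := by
    intro b d
    induction d with
    | zero => simp
    | succ d ih =>
      have e : ∑ i ∈ Finset.range k, (f (p + i + (b + (d + 1 : ℕ))) - f (p + i + b))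
          = (f (p + k + (b + d)) - f (p + (0 : ℕ) + (b + d)))
            + ∑ i ∈ Finset.range k, (f (p + i + (b + d)) - f (p + i + b)) := by
        rw [← Finset.sum_range_sub (fun i : ℕ => f (p + i + (b + d))), ← Finset.sum_add_distrib]
        refine Finset.sum_congr rfl fun i _ => ?_
        push_cast
        rw [show p + (i : ℤ) + (b + (d + 1)) = p + (i + 1) + (b + d) by ring]
        ring
      rw [e]
      refine (abs_add_le _ _).trans ?_
      rw [add_comm]
      have : |f (p + k + (b + d)) - f (p + (0 : ℕ) + (b + d))| ≤ Q := by
        rw [abs_le]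
        constructor <;> linarith [h0 (p + k + (b + d)), h0 (p + (0 : ℕ) + (b + d)),
          h1 (p + k + (b + d)), h1 (p + (0 : ℕ) + (b + d))]
      rw [Nat.cast_succ, add_one_mul]
      exact add_le_add ih this
  rcases le_total b a with hab | hab
  · obtain ⟨d, rfl⟩ := Int.le.dest hab
    have := step b d
    push_cast
    rwa [add_sub_cancel_left, abs_of_nonneg (by positivity : (0 : ℝ) ≤ d)]
  · obtain ⟨d, rfl⟩ := Int.le.dest hab
    have := step a d
    rw [← abs_neg, ← Finset.sum_neg_distrib]
    push_cast
    rw [abs_sub_comm, add_sub_cancel_left, abs_of_nonneg (by positivity : (0 : ℝ) ≤ d)]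
    simpa using this

end Chain

/-! ### Block averages -/

section Block

/-- The average over the sites at distance at most `m`. -/
def bavg (m : ℤ) (g : ℤ → ℝ) (i : ℤ) : ℝ :=
  (∑ j ∈ Finset.Icc (i - m) (i + m), g j) / (2 * (m : ℝ) + 1)

theorem blockAvg_eq_bavg (N : ℕ) (ε : ℝ) (g : ℤ → ℝ) (i : ℤ) :
    blockAvg N ε g i = bavg ⌊ε * N⌋ g i := rfl

variable {m : ℤ}

theorem card_block (hm : 0 ≤ m) (i : ℤ) :
    ((Finset.Icc (i - m) (i + m)).card : ℝ) = 2 * (m : ℝ) + 1 := by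
  rw [Int.card_Icc]
  have : ((i + m + 1 - (i - m)).toNat : ℤ) = 2 * m + 1 := by omega
  exact_mod_cast this

theorem block_pos (hm : 0 ≤ m) : (0 : ℝ) < 2 * (m : ℝ) + 1 := by
  have : (0 : ℝ) ≤ m := by exact_mod_cast hm
  linarith

theorem bavg_mem_Icc (hm : 0 ≤ m) {g : ℤ → ℝ} {i : ℤ} {x y : ℝ}
    (h : ∀ j, g j ∈ Set.Icc x y) : bavg m g i ∈ Set.Icc x y := by
  have hp := block_pos hm
  rw [bavg, Set.mem_Icc, le_div_iff₀ hp, div_le_iff₀ hp, ← card_block hm i, mul_comm x, mul_comm y,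
    ← nsmul_eq_mul, ← nsmul_eq_mul]
  exact ⟨Finset.card_nsmul_le_sum _ _ _ fun j _ => (h j).1,
    Finset.sum_le_card_nsmul _ _ _ fun j _ => (h j).2⟩

theorem bavg_const (hm : 0 ≤ m) (r : ℝ) (i : ℤ) : bavg m (fun _ => r) i = r := by
  have := bavg_mem_Icc hm (g := fun _ => r) (i := i) (x := r) (y := r) (by simp)
  simpa using this

theorem bavg_add (m : ℤ) (f g : ℤ → ℝ) (i : ℤ) :
    bavg m (fun j => f j + g j) i = bavg m f i + bavg m g i := by
  simp only [bavg, Finset.sum_add_distrib, add_div]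

theorem bavg_sub (m : ℤ) (f g : ℤ → ℝ) (i : ℤ) :
    bavg m (fun j => f j - g j) i = bavg m f i - bavg m g i := by
  simp only [bavg, Finset.sum_sub_distrib, sub_div]

theorem bavg_const_mul (m : ℤ) (r : ℝ) (f : ℤ → ℝ) (i : ℤ) :
    bavg m (fun j => r * f j) i = r * bavg m f i := by
  simp only [bavg, ← Finset.mul_sum, mul_div_assoc]

theorem bavg_sum {ι : Type*} (I : Finset ι) (m : ℤ) (f : ι → ℤ → ℝ) (i : ℤ) :
    bavg m (fun j => ∑ k ∈ I, f k j) i = ∑ k ∈ I, bavg m (f k) i := by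
  simp only [bavg, Finset.sum_div]
  rw [Finset.sum_comm]

theorem bavg_eq_sum (m : ℤ) (g : ℤ → ℝ) (i : ℤ) :
    bavg m g i = (∑ α ∈ Finset.Icc (-m) m, g (i + α)) / (2 * (m : ℝ) + 1) := by
  rw [bavg]
  congr 1
  have := Finset.sum_map (Finset.Icc (-m) m) (addLeftEmbedding i) g
  rw [Finset.map_add_left_Icc] at this
  simpa [sub_eq_add_neg] using this

theorem abs_bavg_sub_le (hm : 0 ≤ m) {g g' : ℤ → ℝ} {i : ℤ} (A : Finset ℤ)
    (h1 : ∀ j, |g j - g' j| ≤ 1)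
    (h : ∀ j ∈ Finset.Icc (i - m) (i + m), j ∉ A → g j = g' j) :
    |bavg m g i - bavg m g' i| ≤ A.card / (2 * (m : ℝ) + 1) := by
  have hp := block_pos hm
  rw [bavg, bavg, ← sub_div, abs_div, abs_of_pos hp, ← Finset.sum_sub_distrib]
  refine div_le_div_of_nonneg_right ?_ hp.le
  calc _ ≤ ∑ j ∈ Finset.Icc (i - m) (i + m), |g j - g' j| := Finset.abs_sum_le_sum_abs _ _
    _ ≤ ∑ j ∈ Finset.Icc (i - m) (i + m), if j ∈ A then (1 : ℝ) else 0 := by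
        refine Finset.sum_le_sum fun j hj => ?_
        split_ifs with hA
        · exact h1 j
        · rw [h j hj hA]; simp
    _ ≤ A.card := by
        rw [← Finset.sum_filter, Finset.sum_const, nsmul_eq_mul, mul_one]
        exact_mod_cast Finset.card_le_card fun j hj => (Finset.mem_filter.1 hj).2

/-- The occupation numbers of a configuration on `ℤ`. -/
def occZ (η : ℤ → Bool) (j : ℤ) : ℝ := ((η j).toNat : ℝ)

theorem occZ_mem (η : ℤ → Bool) (j : ℤ) : occZ η j ∈ Set.Icc (0 : ℝ) 1 := by
  cases h : η j <;> simp [occZ, h]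

/-- The indicator that the sites `j + 1, …, j + r` carry the values `ξ 0, …, ξ (r - 1)`. -/
def pattern (ξ : ℕ → Bool) (r : ℕ) (j : ℤ) (η : ℤ → Bool) : ℝ :=
  ∏ x ∈ Finset.range r, if η (j + x + 1) = ξ x then 1 else 0

theorem pattern_mem (ξ : ℕ → Bool) (r : ℕ) (j : ℤ) (η : ℤ → Bool) :
    pattern ξ r j η ∈ Set.Icc (0 : ℝ) 1 :=
  ⟨Finset.prod_nonneg fun x _ => by split_ifs <;> simp,
    Finset.prod_le_one (fun x _ => by split_ifs <;> simp) fun x _ => by split_ifs <;> simp⟩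

theorem pattern_congr (ξ : ℕ → Bool) (r : ℕ) (j : ℤ) {η η' : ℤ → Bool}
    (h : ∀ k, j + 1 ≤ k → k ≤ j + r → η k = η' k) : pattern ξ r j η = pattern ξ r j η' := by
  refine Finset.prod_congr rfl fun x hx => ?_
  rw [Finset.mem_range] at hx
  rw [h _ (by omega) (by omega)]

/-- The average over a block of the product of a pattern with the centred occupation number of the
next site. -/
def defect (m : ℤ) (ξ : ℕ → Bool) (r : ℕ) (i : ℤ) (η : ℤ → Bool) : ℝ :=
  bavg m (fun j => pattern ξ r j η * (occZ η (j + r + 1) - bavg m (occZ η) i)) i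

theorem abs_defect_le (hm : 0 ≤ m) (ξ : ℕ → Bool) (r : ℕ) (i : ℤ) (η : ℤ → Bool) :
    |defect m ξ r i η| ≤ 1 := by
  rw [abs_le]
  refine bavg_mem_Icc hm fun j => ?_
  have h1 := pattern_mem ξ r j η
  have h2 := occZ_mem η (j + r + 1)
  have h3 := bavg_mem_Icc hm (i := i) (occZ_mem η)
  rw [Set.mem_Icc, ← abs_le, abs_mul, abs_of_nonneg h1.1]
  refine mul_le_one₀ h1.2 (abs_nonneg _) ?_
  rw [abs_le]
  constructor <;> linarith [h2.1, h2.2, h3.1, h3.2]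

theorem abs_bavg_pattern_sub_prod_le (hm : 0 ≤ m) (ξ : ℕ → Bool) (i : ℤ) (η : ℤ → Bool) (l : ℕ) :
    |bavg m (fun j => pattern ξ l j η) i
      - ∏ x ∈ Finset.range l, (if ξ x then bavg m (occZ η) i else 1 - bavg m (occZ η) i)|
      ≤ ∑ r ∈ Finset.range l, |defect m ξ r i η| := by
  have hρ := bavg_mem_Icc hm (i := i) (occZ_mem η)
  set ρ := bavg m (occZ η) i with hρd
  induction l with
  | zero => simp [pattern, bavg_const hm]
  | succ l ih =>
    rw [Finset.sum_range_succ, Finset.prod_range_succ]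
    set b : ℝ := if ξ l then ρ else 1 - ρ with hb
    have hb01 : |b| ≤ 1 := by
      rw [abs_le, hb]; split_ifs <;> constructor <;> linarith [hρ.1, hρ.2]
    set p := ∏ x ∈ Finset.range l, (if ξ x then ρ else 1 - ρ)
    have e1 : bavg m (fun j => pattern ξ (l + 1) j η) i
        = b * bavg m (fun j => pattern ξ l j η) i
          + (if ξ l then 1 else -1) * defect m ξ l i η := by
      rw [defect, ← bavg_const_mul, ← bavg_const_mul, ← bavg_add]
      congr 1
      funext j
      rw [pattern, Finset.prod_range_succ, ← pattern, ← hρd, hb, occZ]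
      cases h1 : ξ l <;> cases h2 : η (j + l + 1) <;> simp <;> ring
    have e2 : bavg m (fun j => pattern ξ (l + 1) j η) i - p * b
        = b * (bavg m (fun j => pattern ξ l j η) i - p)
          + (if ξ l then 1 else -1) * defect m ξ l i η := by rw [e1]; ring
    rw [e2]
    refine (abs_add_le _ _).trans (add_le_add ?_ ?_)
    · rw [abs_mul]
      exact (mul_le_of_le_one_left (abs_nonneg _) hb01).trans ih
    · rw [abs_mul]
      split_ifs <;> simp

/-- A word of length `l`, continued by `false`. -/
def padWord {l : ℕ} (ξ : Fin l → Bool) (x : ℕ) : Bool := if h : x < l then ξ ⟨x, h⟩ else false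

theorem abs_block_term_le {l : ℕ} (Φ : (Fin l → Bool) → ℝ) (hm : 0 ≤ m) (i : ℤ) (η : ℤ → Bool) :
    |bavg m (fun j => extend Φ (shift j η)) i - bernoulliMean Φ (bavg m (occZ η) i)|
      ≤ ∑ ξ, |Φ ξ| * ∑ r ∈ Finset.range l, |defect m (padWord ξ) r i η| := by
  set ρ := bavg m (occZ η) i with hρ
  have e1 : ∀ j, extend Φ (shift j η) = ∑ ξ, Φ ξ * pattern (padWord ξ) l j η := by
    intro j
    have hp : ∀ ξ : Fin l → Bool, pattern (padWord ξ) l j η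
        = if ξ = (fun x : Fin l => η ((x : ℤ) + 1 + j)) then 1 else 0 := by
      intro ξ
      rw [pattern, Finset.prod_ite_zero]
      simp only [Finset.prod_const_one]
      congr 1
      rw [eq_iff_iff, funext_iff]
      constructor
      · intro h x
        have := h x (Finset.mem_range.2 x.2)
        rw [padWord, dif_pos x.2] at this
        rw [← this]
        congr 1; ring
      · intro h x hx
        rw [Finset.mem_range] at hx
        rw [padWord, dif_pos hx, h]
        congr 1; simp; ring
    simp only [hp, mul_ite, mul_one, mul_zero, Finset.sum_ite_eq', Finset.mem_univ, if_true]
    rfl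
  have e2 : bernoulliMean Φ ρ = ∑ ξ, Φ ξ *
      ∏ x ∈ Finset.range l, (if padWord ξ x then ρ else 1 - ρ) := by
    rw [bernoulliMean]
    refine Finset.sum_congr rfl fun ξ _ => ?_
    congr 1
    rw [← Fin.prod_univ_eq_prod_range (fun x => if padWord ξ x then ρ else 1 - ρ) l]
    have : ∀ x : Fin l, padWord ξ x = ξ x := fun x => by rw [padWord, dif_pos x.2]
    simp only [this]
    rw [Finset.prod_ite, Finset.prod_const, Finset.prod_const]
    simp
  rw [e2]
  simp only [e1]
  rw [bavg_sum, ← Finset.sum_sub_distrib]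
  refine (Finset.abs_sum_le_sum_abs _ _).trans (Finset.sum_le_sum fun ξ _ => ?_)
  rw [bavg_const_mul, ← mul_sub, abs_mul]
  exact mul_le_mul_of_nonneg_left (abs_bavg_pattern_sub_prod_le hm _ i η l) (abs_nonneg _)

end Block

/-! ### The replacement estimate for a fixed density -/

section Replacement

variable {n : ℕ}

/-- The `n`-periodic configuration on `ℤ` given by a configuration on `ZMod n`. -/
def periodic (x : ZMod n → Bool) (j : ℤ) : Bool := x (j : ZMod n)

variable {Y : Type*} {m : ℤ}

theorem occZ_periodic (s : (ZMod n → Bool) × Y) (j : ℤ) :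
    occZ (periodic s.1) j = occ (j : ZMod n) s := rfl

theorem periodic_exchange {a b k : ℤ} (ha : a ∈ Set.Icc (1 : ℤ) n) (hb : b ∈ Set.Icc (1 : ℤ) n)
    (hk : k ∈ Set.Icc (1 : ℤ) n) (h1 : k ≠ a) (h2 : k ≠ b) (s : (ZMod n → Bool) × Y) :
    periodic (exchange (a : ZMod n) (b : ZMod n) s).1 k = periodic s.1 k :=
  exchange_fst_of_ne s (fun h => h1 ((intCast_eq_iff_of_mem hk ha).1 h))
    (fun h => h2 ((intCast_eq_iff_of_mem hk hb).1 h))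

theorem defect_eq_sub (m : ℤ) (ξ : ℕ → Bool) (r : ℕ) (i : ℤ) (η : ℤ → Bool) :
    defect m ξ r i η = bavg m (fun j => pattern ξ r j η * occZ η (j + r + 1)) i
      - bavg m (occZ η) i * bavg m (fun j => pattern ξ r j η) i := by
  rw [defect, ← bavg_const_mul, ← bavg_sub]
  congr 1
  funext j
  ring

theorem abs_sub_le_one_of_mem {x y : ℝ} (hx : x ∈ Set.Icc (0 : ℝ) 1) (hy : y ∈ Set.Icc (0 : ℝ) 1) :
    |x - y| ≤ 1 := by
  rw [abs_le]; constructor <;> linarith [hx.1, hx.2, hy.1, hy.2]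

theorem mul_mem_unit {x y : ℝ} (hx : x ∈ Set.Icc (0 : ℝ) 1) (hy : y ∈ Set.Icc (0 : ℝ) 1) :
    x * y ∈ Set.Icc (0 : ℝ) 1 :=
  ⟨mul_nonneg hx.1 hy.1, mul_le_one₀ hx.2 hy.1 hy.2⟩

theorem abs_defect_sub_exchange_le (hm : 0 ≤ m) (ξ : ℕ → Bool) {r l : ℕ} (hr : r + 1 ≤ l) {i : ℤ}
    (hi : m + 1 ≤ i) (hi' : i + m + l ≤ n) {a b : ℤ} (ha : a ∈ Set.Icc (1 : ℤ) n)
    (hb : b ∈ Set.Icc (1 : ℤ) n) (s : (ZMod n → Bool) × Y) :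
    |defect m ξ r i (periodic s.1)
      - defect m ξ r i (periodic (exchange (a : ZMod n) (b : ZMod n) s).1)|
      ≤ 6 * l / (2 * (m : ℝ) + 1) := by
  have hp := block_pos hm
  set η := periodic s.1 with hη
  set η' := periodic (exchange (a : ZMod n) (b : ZMod n) s).1 with hη'
  have hk : ∀ k : ℤ, 1 ≤ k → k ≤ n → k ≠ a → k ≠ b → η k = η' k := fun k h1 h2 h3 h4 =>
    (periodic_exchange ha hb ⟨h1, h2⟩ h3 h4 s).symm
  set A : Finset ℤ := Finset.Icc (a - l) (a - 1) ∪ Finset.Icc (b - l) (b - 1) with hA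
  have hAc : (A.card : ℝ) ≤ 2 * l := by
    have h1 : A.card ≤ _ := Finset.card_union_le _ _
    rw [Int.card_Icc, Int.card_Icc] at h1
    have : A.card ≤ 2 * l := by omega
    exact_mod_cast this
  have hdiv : ∀ {x : ℝ}, x ≤ 2 * l → x / (2 * (m : ℝ) + 1) ≤ 2 * l / (2 * (m : ℝ) + 1) :=
    fun h => div_le_div_of_nonneg_right h hp.le
  have hpat : ∀ j ∈ Finset.Icc (i - m) (i + m), j ∉ A →
      pattern ξ r j η = pattern ξ r j η' := by
    intro j hj hjA
    simp only [hA, Finset.mem_union, Finset.mem_Icc, not_or, not_and, not_le] at hj hjA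
    exact pattern_congr ξ r j fun k h1 h2 => hk k (by omega) (by omega) (by omega) (by omega)
  have hocc : ∀ j ∈ Finset.Icc (i - m) (i + m), j ∉ A → occZ η (j + r + 1) = occZ η' (j + r + 1) := by
    intro j hj hjA
    simp only [hA, Finset.mem_union, Finset.mem_Icc, not_or, not_and, not_le] at hj hjA
    rw [occZ, occZ, hk _ (by omega) (by omega) (by omega) (by omega)]
  have b1 : |bavg m (fun j => pattern ξ r j η * occZ η (j + r + 1)) i
      - bavg m (fun j => pattern ξ r j η' * occZ η' (j + r + 1)) i| ≤ 2 * l / (2 * (m : ℝ) + 1) := by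
    refine (abs_bavg_sub_le hm A (fun j => abs_sub_le_one_of_mem
      (mul_mem_unit (pattern_mem _ _ _ _) (occZ_mem _ _))
      (mul_mem_unit (pattern_mem _ _ _ _) (occZ_mem _ _))) fun j hj hjA => ?_).trans (hdiv hAc)
    rw [hpat j hj hjA, hocc j hj hjA]
  have b2 : |bavg m (fun j => pattern ξ r j η) i - bavg m (fun j => pattern ξ r j η') i|
      ≤ 2 * l / (2 * (m : ℝ) + 1) :=
    (abs_bavg_sub_le hm A (fun j => abs_sub_le_one_of_mem (pattern_mem _ _ _ _)
      (pattern_mem _ _ _ _)) hpat).trans (hdiv hAc)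
  have b3 : |bavg m (occZ η) i - bavg m (occZ η') i| ≤ 2 * l / (2 * (m : ℝ) + 1) := by
    refine (abs_bavg_sub_le hm {a, b} (fun j => abs_sub_le_one_of_mem (occZ_mem _ _)
      (occZ_mem _ _)) fun j hj hjA => ?_).trans (hdiv ?_)
    · simp only [Finset.mem_insert, Finset.mem_singleton, not_or, Finset.mem_Icc] at hj hjA
      rw [occZ, occZ, hk j (by omega) (by omega) hjA.1 hjA.2]
    · have h1 : ({a, b} : Finset ℤ).card ≤ 2 := Finset.card_le_two
      have : ({a, b} : Finset ℤ).card ≤ 2 * l := by omega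
      exact_mod_cast this
  have m1 := bavg_mem_Icc hm (i := i) (occZ_mem η')
  have m2 := bavg_mem_Icc hm (i := i) (fun j => pattern_mem ξ r j η)
  rw [defect_eq_sub, defect_eq_sub]
  set P := bavg m (fun j => pattern ξ r j η * occZ η (j + r + 1)) i
  set P' := bavg m (fun j => pattern ξ r j η' * occZ η' (j + r + 1)) i
  set R := bavg m (fun j => pattern ξ r j η) i
  set R' := bavg m (fun j => pattern ξ r j η') i
  set ρ := bavg m (occZ η) i
  set ρ' := bavg m (occZ η') i
  have e : P - ρ * R - (P' - ρ' * R') = (P - P') - (ρ - ρ') * R - ρ' * (R - R') := by ring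
  rw [e]
  have t1 : |(ρ - ρ') * R| ≤ |ρ - ρ'| := by
    rw [abs_mul, abs_of_nonneg m2.1]; exact mul_le_of_le_one_right (abs_nonneg _) m2.2
  have t2 : |ρ' * (R - R')| ≤ |R - R'| := by
    rw [abs_mul, abs_of_nonneg m1.1]; exact mul_le_of_le_one_left (abs_nonneg _) m1.2
  have t3 := abs_sub (P - P') ((ρ - ρ') * R)
  have t4 := abs_sub (P - P' - (ρ - ρ') * R) (ρ' * (R - R'))
  have e6 : 6 * (l : ℝ) / (2 * (m : ℝ) + 1) = 3 * (2 * l / (2 * (m : ℝ) + 1)) := by ring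
  linarith

theorem defect_eq_double_sum (hm : 0 ≤ m) (ξ : ℕ → Bool) (r : ℕ) (i : ℤ) (η : ℤ → Bool) :
    defect m ξ r i η = (∑ α ∈ Finset.Icc (-m) m, ∑ β ∈ Finset.Icc (-m) m,
      pattern ξ r (i + α) η * (occZ η (i + α + r + 1) - occZ η (i + β))) / (2 * (m : ℝ) + 1) ^ 2 := by
  have hp := block_pos hm
  have hc : ((Finset.Icc (-m) m).card : ℝ) = 2 * (m : ℝ) + 1 := by
    simpa using card_block hm 0
  rw [defect, bavg_eq_sum, eq_div_iff (pow_ne_zero 2 hp.ne'), sq, ← mul_assoc,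
    div_mul_cancel₀ _ hp.ne', Finset.sum_mul]
  refine Finset.sum_congr rfl fun α _ => ?_
  rw [← Finset.mul_sum, Finset.sum_sub_distrib, Finset.sum_const, nsmul_eq_mul, hc, bavg_eq_sum]
  field_simp

theorem abs_pattern_sub_exchange_le (ξ : ℕ → Bool) (r : ℕ) {j a b : ℤ} (hj : 0 ≤ j) (hjn : j + r ≤ n)
    (haj : a = j + r + 1) (ha : a ∈ Set.Icc (1 : ℤ) n) (hb : b ∈ Set.Icc (1 : ℤ) n)
    (s : (ZMod n → Bool) × Y) :
    |pattern ξ r j (periodic s.1)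
      - pattern ξ r j (periodic (exchange (a : ZMod n) (b : ZMod n) s).1)|
      ≤ if b ∈ Finset.Icc (j + 1) (j + r) then 1 else 0 := by
  split_ifs with h
  · exact abs_sub_le_one_of_mem (pattern_mem _ _ _ _) (pattern_mem _ _ _ _)
  · rw [Finset.mem_Icc] at h
    rw [pattern_congr ξ r j (fun k h1 h2 => (periodic_exchange ha hb ⟨by omega, by omega⟩
      (by omega) (by omega) s).symm), sub_self, abs_zero]

variable [NeZero n] [Fintype Y] {S : Set ((ZMod n → Bool) × Y)} {c : Bool}

theorem ChainStable.sum_wsum_defect_sq_le (h : ChainStable S c) (u : (ZMod n → Bool) × Y → ℝ)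
    (hm : 0 ≤ m) (ξ : ℕ → Bool) {r l : ℕ} (hr : r + 1 ≤ l) (K : ℕ) (hK : 2 * m + l + K ≤ n)
    {lam : ℝ} (hlam : 0 < lam) :
    ∑ k ∈ Finset.range K, wsum S u (fun s => defect m ξ r (m + 1 + k) (periodic s.1) ^ 2) ≤
      (2 * m + l) * wsum S u 1 + n * (lam * (2 * m + l) * chainEnergy S c u
        + (2 / lam + 7 * l / (2 * (m : ℝ) + 1)) * wsum S u 1) := by
  have hp := block_pos hm
  have hQ : 0 ≤ wsum S u 1 := wsum_nonneg _ _ fun _ => zero_le_one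
  have hE := chainEnergy_nonneg S c u
  set Q := wsum S u 1 with hQd
  set E := chainEnergy S c u with hEd
  set M : ℝ := 2 * (m : ℝ) + 1 with hM
  set f : ℤ → ℝ := fun j => wsum S u (occ (j : ZMod n)) with hf
  have hmR : (0 : ℝ) ≤ m := by exact_mod_cast hm
  have hML : (0 : ℝ) ≤ 2 * m + l := by positivity
  let B : ℤ → ℤ → ℝ := fun α β => lam * (2 * m + l) * E
    + (2 / lam + (6 * l / M + if β ∈ Finset.Icc (α + 1) (α + r) then 1 else 0)) * Q
  have hB0 : ∀ α β, 0 ≤ B α β := fun α β => by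
    have : (0 : ℝ) ≤ if β ∈ Finset.Icc (α + 1) (α + r) then 1 else 0 := by split_ifs <;> simp
    positivity
  have hpair : ∀ k ∈ Finset.range K, ∀ α ∈ Finset.Icc (-m) m, ∀ β ∈ Finset.Icc (-m) m,
      wsum S u (fun s => defect m ξ r (m + 1 + k) (periodic s.1)
        * pattern ξ r (m + 1 + k + α) (periodic s.1)
        * (occ ((m + 1 + k + α + r + 1 : ℤ) : ZMod n) s - occ ((m + 1 + k + β : ℤ) : ZMod n) s)) ≤
      dirSign c * ((β - α - r - 1).sign : ℝ)
        * (f (m + 1 + k + (α + r + 1)) - f (m + 1 + k + β)) + B α β := by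
    intro k hk α hα β hβ
    rw [Finset.mem_range] at hk
    rw [Finset.mem_Icc] at hα hβ
    have ha : m + 1 + k + α + r + 1 ∈ Set.Icc (1 : ℤ) n := ⟨by omega, by omega⟩
    have hb : m + 1 + k + β ∈ Set.Icc (1 : ℤ) n := ⟨by omega, by omega⟩
    have key := h.abs_wsum_le u ha hb
      (fun s => defect m ξ r (m + 1 + k) (periodic s.1)
        * pattern ξ r (m + 1 + k + α) (periodic s.1)) (fun s => by
          rw [abs_mul]
          have h2 := pattern_mem ξ r (m + 1 + k + α) (periodic s.1)
          refine mul_le_one₀ (abs_defect_le hm _ _ _ _) (abs_nonneg _) ?_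
          rw [abs_of_nonneg h2.1]; exact h2.2)
      (κ := 6 * l / M + if β ∈ Finset.Icc (α + 1) (α + r) then 1 else 0) (lam := lam)
      (by
        have : (0 : ℝ) ≤ if β ∈ Finset.Icc (α + 1) (α + r) then 1 else 0 := by split_ifs <;> simp
        positivity)
      (fun s => by
        have d1 := abs_defect_sub_exchange_le hm ξ hr (i := m + 1 + k) (by omega)
          (by omega) ha hb s
        have d2 := abs_pattern_sub_exchange_le ξ r (j := m + 1 + k + α) (by omega) (by omega) rfl
          ha hb s
        have hiff : (m + 1 + k + β ∈ Finset.Icc (m + 1 + k + α + 1) (m + 1 + k + α + r))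
            ↔ β ∈ Finset.Icc (α + 1) (α + r) := by
          simp only [Finset.mem_Icc]; omega
        simp only [hiff] at d2
        have p1 := pattern_mem ξ r (m + 1 + k + α) (periodic s.1)
        have p2 := abs_defect_le hm ξ r (m + 1 + k)
          (periodic (exchange ((m + 1 + k + α + r + 1 : ℤ) : ZMod n)
            ((m + 1 + k + β : ℤ) : ZMod n) s).1)
        revert d1 d2 p1 p2
        generalize defect m ξ r (m + 1 + k) (periodic s.1) = x
        generalize pattern ξ r (m + 1 + k + α) (periodic s.1) = y
        generalize defect m ξ r (m + 1 + k) _ = x'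
        generalize pattern ξ r (m + 1 + k + α) _ = y'
        intro d1 d2 p1 p2
        have e : x * y - x' * y' = (x - x') * y + x' * (y - y') := by ring
        rw [e]
        refine (abs_add_le _ _).trans (add_le_add ?_ ?_)
        · rw [abs_mul, abs_of_nonneg p1.1]
          exact (mul_le_of_le_one_right (abs_nonneg _) p1.2).trans d1
        · rw [abs_mul]
          exact (mul_le_of_le_one_left (abs_nonneg _) p2).trans d2)
      hlam
    refine (le_abs_self _).trans (key.trans ?_)
    rw [show m + 1 + k + β - (m + 1 + k + α + r + 1) = β - α - r - 1 by ring,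
      show m + 1 + k + (α + r + 1) = m + 1 + k + α + r + 1 by ring]
    refine add_le_add le_rfl (add_le_add ?_ le_rfl)
    refine mul_le_mul_of_nonneg_right (mul_le_mul_of_nonneg_left ?_ hlam.le) hE
    have h1 : (α : ℝ) ≤ m := by exact_mod_cast hα.2
    have h2 : -(m : ℝ) ≤ α := by exact_mod_cast hα.1
    have h3 : (β : ℝ) ≤ m := by exact_mod_cast hβ.2
    have h4 : -(m : ℝ) ≤ β := by exact_mod_cast hβ.1
    have h5 : (r : ℝ) + 1 ≤ l := by exact_mod_cast hr
    have h6 : (0 : ℝ) ≤ r := by positivity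
    push_cast
    rw [abs_le]
    constructor <;> linarith
  have hsum : ∀ α ∈ Finset.Icc (-m) m, ∀ β ∈ Finset.Icc (-m) m,
      ∑ k ∈ Finset.range K, wsum S u (fun s => defect m ξ r (m + 1 + k) (periodic s.1)
        * pattern ξ r (m + 1 + k + α) (periodic s.1)
        * (occ ((m + 1 + k + α + r + 1 : ℤ) : ZMod n) s - occ ((m + 1 + k + β : ℤ) : ZMod n) s)) ≤
      (2 * m + l) * Q + n * B α β := by
    intro α hα β hβ
    refine (Finset.sum_le_sum fun k hk => hpair k hk α hα β hβ).trans ?_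
    rw [Finset.sum_add_distrib, Finset.sum_const, Finset.card_range, nsmul_eq_mul,
      ← Finset.mul_sum]
    rw [Finset.mem_Icc] at hα hβ
    refine add_le_add ?_ (mul_le_mul_of_nonneg_right ?_ (hB0 α β))
    · refine (le_abs_self _).trans ?_
      rw [abs_mul]
      have h1 : |dirSign c * ((β - α - r - 1).sign : ℝ)| ≤ 1 := by
        have e1 : |dirSign c| = 1 := by cases c <;> simp [dirSign]
        rw [abs_mul, e1, one_mul]
        rcases Int.sign_trichotomy (β - α - r - 1) with h | h | h <;> rw [h] <;> simp
      refine (mul_le_of_le_one_left (abs_nonneg _) h1).trans ?_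
      refine (abs_sum_shift_sub_le (f := f) (fun j => (wsum_occ_mem S u _).1)
        (fun j => (wsum_occ_mem S u _).2) (m + 1) K (α + r + 1) β).trans ?_
      refine mul_le_mul_of_nonneg_right ?_ hQ
      have h1 : (α : ℝ) ≤ m := by exact_mod_cast hα.2
      have h2 : -(m : ℝ) ≤ α := by exact_mod_cast hα.1
      have h3 : (β : ℝ) ≤ m := by exact_mod_cast hβ.2
      have h4 : -(m : ℝ) ≤ β := by exact_mod_cast hβ.1
      have h5 : (r : ℝ) + 1 ≤ l := by exact_mod_cast hr
      have h6 : (0 : ℝ) ≤ r := by positivity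
      push_cast
      rw [abs_le]
      constructor <;> linarith
    · have : (K : ℤ) ≤ n := by omega
      exact_mod_cast this
  have hexp : ∀ k ∈ Finset.range K, wsum S u (fun s => defect m ξ r (m + 1 + k) (periodic s.1) ^ 2)
      = (∑ α ∈ Finset.Icc (-m) m, ∑ β ∈ Finset.Icc (-m) m,
        wsum S u (fun s => defect m ξ r (m + 1 + k) (periodic s.1)
        * pattern ξ r (m + 1 + k + α) (periodic s.1)
        * (occ ((m + 1 + k + α + r + 1 : ℤ) : ZMod n) s
          - occ ((m + 1 + k + β : ℤ) : ZMod n) s))) / M ^ 2 := by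
    intro k _
    have : (fun s : (ZMod n → Bool) × Y => defect m ξ r (m + 1 + k) (periodic s.1) ^ 2)
        = fun s => (1 / M ^ 2) * ∑ α ∈ Finset.Icc (-m) m, ∑ β ∈ Finset.Icc (-m) m,
          (defect m ξ r (m + 1 + k) (periodic s.1)
          * pattern ξ r (m + 1 + k + α) (periodic s.1)
          * (occ ((m + 1 + k + α + r + 1 : ℤ) : ZMod n) s
            - occ ((m + 1 + k + β : ℤ) : ZMod n) s)) := by
      funext s
      rw [sq]
      nth_rewrite 2 [defect_eq_double_sum hm]
      simp only [mul_assoc, ← Finset.mul_sum, occZ_periodic, ← hM]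
      ring
    rw [this, wsum_const_mul, wsum_sum, one_div, inv_mul_eq_div]
    simp only [wsum_sum]
  rw [Finset.sum_congr rfl hexp, ← Finset.sum_div, Finset.sum_comm, div_le_iff₀ (by positivity)]
  have hswap : ∀ α ∈ Finset.Icc (-m) m, ∑ k ∈ Finset.range K, ∑ β ∈ Finset.Icc (-m) m,
        wsum S u (fun s => defect m ξ r (m + 1 + k) (periodic s.1)
        * pattern ξ r (m + 1 + k + α) (periodic s.1)
        * (occ ((m + 1 + k + α + r + 1 : ℤ) : ZMod n) s
          - occ ((m + 1 + k + β : ℤ) : ZMod n) s))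
      ≤ M * ((2 * m + l) * Q + n * (lam * (2 * m + l) * E + (2 / lam + 6 * l / M) * Q))
        + l * (n * Q) := by
    intro α hα
    rw [Finset.sum_comm]
    refine (Finset.sum_le_sum fun β hβ => hsum α hα β hβ).trans ?_
    have e : ∀ β, (2 * m + l) * Q + n * B α β
      = ((2 * m + l) * Q + n * (lam * (2 * m + l) * E + (2 / lam + 6 * l / M) * Q))
        + (if β ∈ Finset.Icc (α + 1) (α + r) then 1 else 0) * (n * Q) := by
      intro β; simp only [B]; ring
    simp only [e]
    have hc : ((Finset.Icc (-m) m).card : ℝ) = M := by simpa using card_block hm 0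
    rw [Finset.sum_add_distrib, Finset.sum_const, nsmul_eq_mul, hc, ← Finset.sum_mul]
    refine add_le_add le_rfl (mul_le_mul_of_nonneg_right ?_ (by positivity))
    rw [← Finset.sum_filter, Finset.sum_const, nsmul_eq_mul, mul_one]
    have h1 : (Finset.filter (fun β => β ∈ Finset.Icc (α + 1) (α + r)) (Finset.Icc (-m) m)).card
        ≤ (Finset.Icc (α + 1) (α + r)).card :=
      Finset.card_le_card fun j hj => (Finset.mem_filter.1 hj).2
    rw [Int.card_Icc] at h1
    have h2 : (Finset.filter (fun β => β ∈ Finset.Icc (α + 1) (α + r)) (Finset.Icc (-m) m)).card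
        ≤ l := by omega
    exact_mod_cast h2
  refine (Finset.sum_le_sum hswap).trans (le_of_eq ?_)
  have hc : ((Finset.Icc (-m) m).card : ℝ) = M := by simpa using card_block hm 0
  rw [Finset.sum_const, nsmul_eq_mul, hc]
  field_simp
  ring

/-- The potential of a configuration on `ℤ`, for blocks of radius `m` and period `n`. -/
def blockPotential {l : ℕ} (Φ : (Fin l → Bool) → ℝ) (n : ℕ) (m : ℤ) (η : ℤ → Bool) : ℝ :=
  ∑ i ∈ Finset.Icc (1 : ℤ) n,
    |bavg m (fun j => extend Φ (shift j η)) i - bernoulliMean Φ (bavg m (occZ η) i)|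

theorem ChainStable.wsum_blockPotential_le (h : ChainStable S c) (u : (ZMod n → Bool) × Y → ℝ)
    (hm : 0 ≤ m) {l : ℕ} (Φ : (Fin l → Bool) → ℝ) (hn : 2 * m + l ≤ n)
    {lam θ : ℝ} (hlam : 0 < lam) (hθ : 0 < θ) :
    wsum S u (fun s => blockPotential Φ n m (periodic s.1)) ≤
      (∑ ξ, |Φ ξ|) * l * ((2 * m + l) * wsum S u 1 + (n * θ * wsum S u 1
        + 1 / θ * ((2 * m + l) * wsum S u 1 + n * (lam * (2 * m + l) * chainEnergy S c u
        + (2 / lam + 7 * l / (2 * (m : ℝ) + 1)) * wsum S u 1)))) := by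
  have hQ : 0 ≤ wsum S u 1 := wsum_nonneg _ _ fun _ => zero_le_one
  set Q := wsum S u 1 with hQd
  obtain ⟨K, hK⟩ : ∃ K : ℕ, 2 * m + l + K = n := ⟨(n - 2 * m - l).toNat, by omega⟩
  set X : ℝ := (2 * m + l) * Q + n * (lam * (2 * m + l) * chainEnergy S c u
        + (2 / lam + 7 * l / (2 * (m : ℝ) + 1)) * Q) with hX
  have habs : ∀ x : ℝ, |x| ≤ θ + 1 / θ * x ^ 2 := by
    intro x
    have h1 : θ + 1 / θ * x ^ 2 - |x| = 1 / θ * ((|x| - θ / 2) ^ 2 + 3 / 4 * θ ^ 2) := by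
      rw [← sq_abs x]; field_simp; ring
    have h2 : 0 ≤ 1 / θ * ((|x| - θ / 2) ^ 2 + 3 / 4 * θ ^ 2) := by positivity
    linarith
  have hdef : ∀ (ξ : Fin l → Bool), ∀ r ∈ Finset.range l,
      ∑ i ∈ Finset.Icc (1 : ℤ) n, wsum S u (fun s => |defect m (padWord ξ) r i (periodic s.1)|)
        ≤ (2 * m + l) * Q + (n * θ * Q + 1 / θ * X) := by
    intro ξ r hr
    rw [Finset.mem_range] at hr
    have hsub : Finset.Icc (1 : ℤ) n
        = Finset.Icc (1 : ℤ) m ∪ Finset.Icc (m + K + 1) n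
          ∪ (Finset.range K).map (Nat.castEmbedding.trans (addLeftEmbedding (m + 1))) := by
      ext i
      simp only [Finset.mem_union, Finset.mem_Icc, Finset.mem_map, Finset.mem_range,
        Function.Embedding.trans_apply, Nat.castEmbedding_apply, addLeftEmbedding_apply]
      constructor
      · intro hi
        by_cases h1 : i ≤ m
        · exact Or.inl (Or.inl ⟨hi.1, h1⟩)
        · by_cases h2 : m + K + 1 ≤ i
          · exact Or.inl (Or.inr ⟨h2, hi.2⟩)
          · exact Or.inr ⟨(i - m - 1).toNat, by omega, by omega⟩
      · rintro ((⟨h1, h2⟩ | ⟨h1, h2⟩) | ⟨k, hk, rfl⟩) <;> omega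
    have hnn : ∀ i, 0 ≤ wsum S u (fun s => |defect m (padWord ξ) r i (periodic s.1)|) :=
      fun i => wsum_nonneg _ _ fun s => abs_nonneg _
    have hle : ∀ i, wsum S u (fun s => |defect m (padWord ξ) r i (periodic s.1)|) ≤ Q :=
      fun i => wsum_mono _ _ fun s => abs_defect_le hm _ _ _ _
    have hdisj : Disjoint (Finset.Icc (1 : ℤ) m ∪ Finset.Icc (m + K + 1) n)
        ((Finset.range K).map (Nat.castEmbedding.trans (addLeftEmbedding (m + 1)))) := by
      rw [Finset.disjoint_left]
      intro i hi hi'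
      simp only [Finset.mem_union, Finset.mem_Icc, Finset.mem_map, Finset.mem_range,
        Function.Embedding.trans_apply, Nat.castEmbedding_apply, addLeftEmbedding_apply] at hi hi'
      obtain ⟨k, hk, rfl⟩ := hi'
      omega
    rw [hsub, Finset.sum_union hdisj, Finset.sum_map]
    refine add_le_add ?_ ?_
    · refine (Finset.sum_le_card_nsmul _ _ Q fun i _ => hle i).trans ?_
      rw [nsmul_eq_mul]
      refine mul_le_mul_of_nonneg_right ?_ hQ
      have h1 := Finset.card_union_le (Finset.Icc (1 : ℤ) m) (Finset.Icc (m + K + 1) n)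
      rw [Int.card_Icc, Int.card_Icc] at h1
      have h2 : ((Finset.Icc (1 : ℤ) m ∪ Finset.Icc (m + K + 1) n).card : ℤ) ≤ 2 * m + l := by omega
      exact_mod_cast h2
    · have key := h.sum_wsum_defect_sq_le u hm (padWord ξ) (show r + 1 ≤ l from hr) K hK.le hlam
      calc _ ≤ ∑ k ∈ Finset.range K, (θ * Q
            + 1 / θ * wsum S u (fun s => defect m (padWord ξ) r (m + 1 + k) (periodic s.1) ^ 2)) := by
            refine Finset.sum_le_sum fun k _ => ?_
            refine (wsum_mono S u fun s => habs _).trans_eq ?_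
            rw [wsum_add, wsum_const, wsum_const_mul]
            rfl
        _ = K * (θ * Q) + 1 / θ * ∑ k ∈ Finset.range K,
            wsum S u (fun s => defect m (padWord ξ) r (m + 1 + k) (periodic s.1) ^ 2) := by
            rw [Finset.sum_add_distrib, Finset.sum_const, Finset.card_range, nsmul_eq_mul,
              Finset.mul_sum]
        _ ≤ _ := by
            rw [mul_assoc (n : ℝ)]
            refine add_le_add (mul_le_mul_of_nonneg_right ?_ (by positivity))
              (mul_le_mul_of_nonneg_left key (by positivity))
            have : (K : ℤ) ≤ n := by omega
            exact_mod_cast this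
  calc _ ≤ wsum S u (fun s => ∑ i ∈ Finset.Icc (1 : ℤ) n, ∑ ξ, |Φ ξ| * ∑ r ∈ Finset.range l,
          |defect m (padWord ξ) r i (periodic s.1)|) :=
        wsum_mono _ _ fun s => Finset.sum_le_sum fun i _ => abs_block_term_le Φ hm i _
    _ = ∑ ξ, |Φ ξ| * ∑ r ∈ Finset.range l, ∑ i ∈ Finset.Icc (1 : ℤ) n,
          wsum S u (fun s => |defect m (padWord ξ) r i (periodic s.1)|) := by
        simp only [wsum_sum, wsum_const_mul]
        rw [Finset.sum_comm]
        refine Finset.sum_congr rfl fun ξ _ => ?_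
        rw [← Finset.mul_sum, Finset.sum_comm]
    _ ≤ ∑ ξ, |Φ ξ| * ∑ r ∈ Finset.range l, ((2 * m + l) * Q + (n * θ * Q + 1 / θ * X)) :=
        Finset.sum_le_sum fun ξ _ => mul_le_mul_of_nonneg_left
          (Finset.sum_le_sum fun r hr => hdef ξ r hr) (abs_nonneg _)
    _ = _ := by
        rw [Finset.sum_const, Finset.card_range, nsmul_eq_mul, ← Finset.sum_mul]
        ring

end Replacement

/-! ### The quadratic form of the generator -/

section Generator

variable {K Y : Type*} [DecidableEq K]

open Classical in
/-- The exchange of `x` and `y`, performed only if it brings the value `b` from `x` to `y` without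
leaving `S`. -/
def move (S : Set ((K → Bool) × Y)) (b : Bool) (x y : K) (s : (K → Bool) × Y) : (K → Bool) × Y :=
  if s ∈ S ∧ exchange x y s ∈ S ∧ s.1 x = b ∧ s.1 y = !b then exchange x y s else s

theorem sum_bool_eq (f : Bool → ℝ) (c : Bool) : ∑ b, f b = f c + f (!c) := by
  cases c <;> simp [add_comm]

theorem StableAt.sum_move_le [Fintype K] [Fintype Y] {S : Set ((K → Bool) × Y)} {c : Bool} {x y : K}
    (h : StableAt S c x y) (u : (K → Bool) × Y → ℝ) (rate : Bool → ℝ) {R D : ℝ} (hR : 0 < R)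
    (hsum : rate false + rate true = R) (hD : (rate false - rate true) ^ 2 ≤ D) :
    ∑ s, u s * ∑ b, rate b * (u (move S b x y s) - u s) ≤
      -(R / 4) * energy S c u x y + D / (2 * R) * wsum S u 1 := by
  classical
  set q : (K → Bool) × Y → ℝ := S.indicator (fun s => u s ^ 2) with hq
  have hq0 : ∀ s, 0 ≤ q s := fun s => Set.indicator_nonneg (fun _ _ => sq_nonneg _) s
  have hD0 : 0 ≤ D := (sq_nonneg _).trans hD
  have hmass := sum_pair_le_wsum S c x y u
  rw [← hq] at hmass
  rw [sum_eq_sum_exchange c x y]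
  swap
  · intro s hs
    have : ∀ b, move S b x y s = s := by
      intro b
      rw [move, if_neg]
      rintro ⟨-, -, h1, h2⟩
      rw [h1, h2] at hs
      cases b <;> simp at hs
    simp [this]
  have key : ∀ s, (if s.1 x = c ∧ s.1 y = !c then
      u s * ∑ b, rate b * (u (move S b x y s) - u s)
        + u (exchange x y s) * ∑ b, rate b * (u (move S b x y (exchange x y s)) - u (exchange x y s))
      else 0) ≤ -(R / 4) * edgeEnergy S c u x y s + D / (2 * R) *
        (if s.1 x = c ∧ s.1 y = !c then q s + q (exchange x y s) else 0) := by
    intro s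
    by_cases hs : s.1 x = c ∧ s.1 y = !c
    · rw [if_pos hs, if_pos hs]
      by_cases hS : s ∈ S
      · have hS' := h s hS hs.1 hs.2
        have e1 : move S c x y s = exchange x y s := by rw [move, if_pos ⟨hS, hS', hs⟩]
        have e2 : move S (!c) x y s = s := by
          rw [move, if_neg]
          rintro ⟨-, -, h1, -⟩
          rw [hs.1] at h1; cases c <;> simp at h1
        have e3 : move S c x y (exchange x y s) = exchange x y s := by
          rw [move, if_neg]
          rintro ⟨-, -, h1, -⟩
          rw [exchange_fst_left, hs.2] at h1; cases c <;> simp at h1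
        have e4 : move S (!c) x y (exchange x y s) = s := by
          rw [move, exchange_exchange, if_pos]
          refine ⟨hS', hS, ?_, ?_⟩
          · rw [exchange_fst_left, hs.2]
          · rw [exchange_fst_right, hs.1, Bool.not_not]
        have e5 : edgeEnergy S c u x y s = (u (exchange x y s) - u s) ^ 2 := if_pos ⟨hS, hs⟩
        have e6 : q s = u s ^ 2 := Set.indicator_of_mem hS _
        have e7 : q (exchange x y s) = u (exchange x y s) ^ 2 := Set.indicator_of_mem hS' _
        rw [sum_bool_eq _ c, sum_bool_eq _ c, e1, e2, e3, e4, e5, e6, e7]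
        have hsum' : rate c + rate (!c) = R := by cases c <;> simp <;> linarith
        have hD' : (rate c - rate (!c)) ^ 2 ≤ D := by
          cases c
          · simpa using hD
          · simp only [Bool.not_true]
            rwa [← neg_sub, neg_sq]
        generalize rate c = p at *
        generalize rate (!c) = p' at *
        generalize u s = α
        generalize u (exchange x y s) = β
        have i1 : (p - p') ^ 2 / (4 * R) * (α + β) ^ 2 ≤ D / (2 * R) * (α ^ 2 + β ^ 2) := by
          have j1 : (p - p') ^ 2 / (4 * R) * (α + β) ^ 2 ≤ D / (4 * R) * (2 * (α ^ 2 + β ^ 2)) := by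
            refine mul_le_mul (div_le_div_of_nonneg_right hD' (by positivity)) ?_ (sq_nonneg _)
              (by positivity)
            nlinarith [sq_nonneg (α - β)]
          refine j1.trans_eq ?_
          field_simp; ring
        have i2 : -(R / 4) * (β - α) ^ 2 + (p - p') ^ 2 / (4 * R) * (α + β) ^ 2
            - (α * (p * (β - α) + p' * (α - α)) + β * (p * (β - β) + p' * (α - β)))
            = (R * (β - α) - (p - p') * (α + β)) ^ 2 / (4 * R) := by
          subst hsum'
          field_simp
          ring
        have i3 : 0 ≤ (R * (β - α) - (p - p') * (α + β)) ^ 2 / (4 * R) := by positivity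
        linarith
      · have e1 : ∀ b, move S b x y s = s := fun b => by
          rw [move, if_neg]; exact fun h => hS h.1
        have e2 : ∀ b, move S b x y (exchange x y s) = exchange x y s := fun b => by
          rw [move, if_neg]; rw [exchange_exchange]; exact fun h => hS h.2.1
        have e3 : edgeEnergy S c u x y s = 0 := if_neg fun h => hS h.1
        simp only [e1, e2, e3, sub_self, mul_zero, Finset.sum_const_zero, add_zero, zero_add]
        have := hq0 s
        have := hq0 (exchange x y s)
        positivity
    · have e3 : edgeEnergy S c u x y s = 0 := if_neg fun h => hs h.2
      rw [if_neg hs, if_neg hs, e3]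
      simp
  refine (Finset.sum_le_sum fun s _ => key s).trans ?_
  rw [Finset.sum_add_distrib, ← Finset.mul_sum, ← Finset.mul_sum, energy]
  exact add_le_add le_rfl (mul_le_mul_of_nonneg_left hmass (by positivity))

theorem ChainStable.sum_move_le {N : ℕ} [NeZero (2 * N)] [Fintype Y]
    {S : Set ((ZMod (2 * N) → Bool) × Y)} {c : Bool}
    (h : ChainStable S c) (u : (ZMod (2 * N) → Bool) × Y → ℝ) (rate : Bool → Site N → ℝ) {R D : ℝ}
    (hR : 0 < R) (hsum : ∀ k, rate false k + rate true k = R)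
    (hD : ∀ k, (rate false k - rate true k) ^ 2 ≤ D) :
    ∑ s, u s * ∑ k, ∑ b, rate b k *
      (u (move S b ((k : ℕ) : ZMod (2 * N)) (((k : ℕ) + 1 : ℕ) : ZMod (2 * N)) s) - u s) ≤
      -(R / 4) * chainEnergy S c u + 2 * N * (D / (2 * R) * wsum S u 1) := by
  have hQ : 0 ≤ wsum S u 1 := wsum_nonneg _ _ fun _ => zero_le_one
  have h1 : ∀ k : Site N, ∑ s, u s * ∑ b, rate b k *
      (u (move S b ((k : ℕ) : ZMod (2 * N)) (((k : ℕ) + 1 : ℕ) : ZMod (2 * N)) s) - u s) ≤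
      -(R / 4) * energy S c u ((k : ℕ) : ZMod (2 * N)) (((k : ℕ) + 1 : ℕ) : ZMod (2 * N))
        + D / (2 * R) * wsum S u 1 := by
    intro k
    have hk := k.2
    rw [Set.mem_Ico] at hk
    have := h (k : ℕ) (by omega) (by omega)
    exact StableAt.sum_move_le (by exact_mod_cast this) u (fun b => rate b k) hR (hsum k) (hD k)
  have e1 : chainEnergy S c u = ∑ k : Site N,
      energy S c u ((k : ℕ) : ZMod (2 * N)) (((k : ℕ) + 1 : ℕ) : ZMod (2 * N)) := by
    rw [chainEnergy]
    refine (Finset.sum_bij (fun (k : Site N) _ => ((k : ℕ) : ℤ)) ?_ ?_ ?_ ?_).symm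
    · intro k _
      have hk := k.2
      rw [Set.mem_Ico] at hk
      rw [Finset.mem_Ico]
      omega
    · intro a _ b _ hab
      exact Subtype.ext (by exact_mod_cast hab)
    · intro b hb
      rw [Finset.mem_Ico] at hb
      exact ⟨⟨b.toNat, by rw [Set.mem_Ico]; omega⟩, Finset.mem_univ _, by simp; omega⟩
    · intro k _
      push_cast
      rfl
  have hD0 : ∀ k : Site N, 0 ≤ D := fun k => (sq_nonneg _).trans (hD k)
  calc _ = ∑ k : Site N, ∑ s, u s * ∑ b, rate b k *
      (u (move S b ((k : ℕ) : ZMod (2 * N)) (((k : ℕ) + 1 : ℕ) : ZMod (2 * N)) s) - u s) := by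
        rw [Finset.sum_comm]
        refine Finset.sum_congr rfl fun s _ => ?_
        rw [Finset.mul_sum]
    _ ≤ ∑ k : Site N, (-(R / 4) * energy S c u ((k : ℕ) : ZMod (2 * N))
          (((k : ℕ) + 1 : ℕ) : ZMod (2 * N)) + D / (2 * R) * wsum S u 1) :=
        Finset.sum_le_sum fun k _ => h1 k
    _ = -(R / 4) * chainEnergy S c u + Fintype.card (Site N) * (D / (2 * R) * wsum S u 1) := by
        rw [Finset.sum_add_distrib, ← Finset.mul_sum, e1, Finset.sum_const, nsmul_eq_mul,
          Finset.card_univ]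
    _ ≤ _ := by
        refine add_le_add le_rfl ?_
        rcases isEmpty_or_nonempty (Site N) with h0 | ⟨⟨k⟩⟩
        · rw [Fintype.card_eq_zero]
          have : (2 * N : ℕ) ≤ 1 := by
            by_contra hlt
            exact h0.false ⟨1, by rw [Set.mem_Ico]; omega⟩
          have h2 := NeZero.ne (2 * N)
          omega
        · have := hD0 k
          refine mul_le_mul_of_nonneg_right ?_ (by positivity)
          have : Fintype.card (Site N) ≤ 2 * N := by
            rw [Fintype.card_ofFinset]; simp
          exact_mod_cast this

end Generator

/-! ### The quadratic form of one time step -/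

section Step

variable {ι T : Type*} [Fintype ι]

/-- One time step of the Feynman–Kac semigroup: at most one clock rings. -/
def stepOp (rate : ι → ℝ) (U : ι → T → T) (V : T → ℝ) (s : ℝ) (u : T → ℝ) (x : T) : ℝ :=
  Real.exp (s * V x) *
    (u x + ∑ i, rate i * s * Real.exp (-((∑ i, rate i) * s)) * (u (U i x) - u x))

variable [Fintype T]

theorem eventually_sum_stepOp_sq_le (rate : ι → ℝ) (U : ι → T → T) (V : T → ℝ) {Λ : ℝ}
    (hΛ : ∀ u : T → ℝ, ∑ x, V x * u x ^ 2 + ∑ x, u x * ∑ i, rate i * (u (U i x) - u x)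
      ≤ Λ * ∑ x, u x ^ 2) {γ : ℝ} (hγ : 0 < γ) :
    ∀ᶠ s in 𝓝[>] (0 : ℝ), ∀ u : T → ℝ,
      ∑ x, stepOp rate U V s u x ^ 2 ≤ (1 + (2 * Λ + γ) * s) * ∑ x, u x ^ 2 := by
  classical
  let δ : T → T → ℝ := fun x y => if x = y then 1 else 0
  have hδ : ∀ (x : T) (u : T → ℝ), ∑ y, δ x y * u y = u x := fun x u => by simp [δ]
  obtain ⟨R, hR⟩ : ∃ R, R = ∑ i, rate i := ⟨_, rfl⟩
  let a : ℝ → T → T → ℝ := fun s x y => Real.exp (s * V x) *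
    (δ x y + ∑ i, rate i * s * Real.exp (-(R * s)) * (δ (U i x) y - δ x y))
  let a' : T → T → ℝ := fun x y => V x * δ x y + ∑ i, rate i * (δ (U i x) y - δ x y)
  have ha : ∀ s u x, stepOp rate U V s u x = ∑ y, a s x y * u y := by
    intro s u x
    simp only [a, mul_assoc, ← Finset.mul_sum, add_mul, Finset.sum_add_distrib, hδ, stepOp, ← hR]
    congr 2
    simp only [Finset.sum_mul]
    rw [Finset.sum_comm]
    refine Finset.sum_congr rfl fun i _ => ?_
    simp only [mul_assoc, ← Finset.mul_sum, sub_mul, Finset.sum_sub_distrib, hδ]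
  have ha0 : ∀ x y, a 0 x y = δ x y := fun x y => by simp [a]
  have hda : ∀ x y, HasDerivAt (fun s => a s x y) (a' x y) 0 := by
    intro x y
    have h1 : HasDerivAt (fun s : ℝ => Real.exp (s * V x)) (V x) 0 := by
      have := ((hasDerivAt_id (0 : ℝ)).mul_const (V x)).exp
      simpa using this
    have h2 : ∀ i, HasDerivAt (fun s : ℝ => rate i * s * Real.exp (-(R * s)) *
        (δ (U i x) y - δ x y)) (rate i * (δ (U i x) y - δ x y)) 0 := by
      intro i
      have e1 : HasDerivAt (fun s : ℝ => Real.exp (-(R * s))) (-R) 0 := by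
        have := (((hasDerivAt_id (0 : ℝ)).const_mul R).neg).exp
        simpa using this
      have e2 := (((hasDerivAt_id (0 : ℝ)).const_mul (rate i)).mul e1).mul_const
        (δ (U i x) y - δ x y)
      simpa using e2
    have h3 := h1.fun_mul ((HasDerivAt.fun_sum fun i (_ : i ∈ Finset.univ) => h2 i).const_add (δ x y))
    simpa [a, a'] using h3
  let b : ℝ → T → T → ℝ := fun s y z => ∑ x, a s x y * a s x z
  have hdb : ∀ y z, HasDerivAt (fun s => b s y z) (a' z y + a' y z) 0 := by
    intro y z
    have h1 := HasDerivAt.fun_sum fun x (_ : x ∈ Finset.univ) => (hda x y).fun_mul (hda x z)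
    simp only [ha0, Finset.sum_add_distrib] at h1
    have e1 : ∑ x, a' x y * δ x z = a' z y := by simp [δ]
    have e2 : ∑ x, δ x y * a' x z = a' y z := by simp [δ]
    rw [e1, e2] at h1
    exact h1
  have hb0 : ∀ y z, b 0 y z = δ y z := fun y z => by
    simp only [b, ha0]
    simp [δ]
    congr 1
    exact propext eq_comm
  set C : ℝ := (Fintype.card T : ℝ) with hC
  have hγ' : 0 < γ / (C + 1) := by positivity
  have hev : ∀ᶠ s in 𝓝[>] (0 : ℝ), ∀ y z, |b s y z - δ y z - s * (a' z y + a' y z)|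
      ≤ γ / (C + 1) * s := by
    rw [eventually_all]; intro y
    rw [eventually_all]; intro z
    have h1 := (hasDerivAt_iff_isLittleO.1 (hdb y z)).def hγ'
    filter_upwards [h1.filter_mono nhdsWithin_le_nhds, self_mem_nhdsWithin] with s hs hs0
    have hs0' : (0 : ℝ) < s := hs0
    simpa [hb0, Real.norm_eq_abs, abs_of_pos hs0', sub_zero] using hs
  filter_upwards [hev, self_mem_nhdsWithin] with s hs hs0 u
  have hs0' : (0 : ℝ) < s := hs0
  have e1 : ∑ x, stepOp rate U V s u x ^ 2 = ∑ y, ∑ z, b s y z * (u y * u z) := by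
    simp only [ha, sq, Finset.sum_mul_sum, b]
    simp only [Finset.sum_mul]
    rw [Finset.sum_comm]
    refine Finset.sum_congr rfl fun y _ => ?_
    rw [Finset.sum_comm]
    refine Finset.sum_congr rfl fun z _ => Finset.sum_congr rfl fun x _ => ?_
    ring
  have e2 : ∑ y, ∑ z, δ y z * (u y * u z) = ∑ x, u x ^ 2 := by
    refine Finset.sum_congr rfl fun y _ => ?_
    rw [hδ y (fun z => u y * u z), sq]
  have e3 : ∑ y, ∑ z, a' y z * (u y * u z)
      = ∑ x, V x * u x ^ 2 + ∑ x, u x * ∑ i, rate i * (u (U i x) - u x) := by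
    rw [← Finset.sum_add_distrib]
    refine Finset.sum_congr rfl fun y _ => ?_
    simp only [a', add_mul, Finset.sum_add_distrib, mul_assoc, ← Finset.mul_sum]
    rw [hδ y (fun z => u y * u z)]
    congr 1
    · ring
    · simp only [Finset.sum_mul]
      rw [Finset.sum_comm, Finset.mul_sum]
      refine Finset.sum_congr rfl fun i _ => ?_
      simp only [mul_assoc, ← Finset.mul_sum, sub_mul, Finset.sum_sub_distrib]
      rw [hδ (U i y) (fun z => u y * u z), hδ y (fun z => u y * u z)]
      ring
  have e4 : ∑ y, ∑ z, a' z y * (u y * u z) = ∑ y, ∑ z, a' y z * (u y * u z) := by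
    rw [Finset.sum_comm]
    refine Finset.sum_congr rfl fun y _ => Finset.sum_congr rfl fun z _ => ?_
    ring
  have e5 : ∑ y, ∑ z, b s y z * (u y * u z) ≤ ∑ y, ∑ z, (δ y z * (u y * u z)
      + s * (a' z y * (u y * u z)) + s * (a' y z * (u y * u z))
      + γ / (C + 1) * s * (|u y| * |u z|)) := by
    refine Finset.sum_le_sum fun y _ => Finset.sum_le_sum fun z _ => ?_
    have h1 : (b s y z - δ y z - s * (a' z y + a' y z)) * (u y * u z)
        ≤ γ / (C + 1) * s * (|u y| * |u z|) := by
      refine (le_abs_self _).trans ?_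
      rw [abs_mul, abs_mul]
      exact mul_le_mul_of_nonneg_right (hs y z) (by positivity)
    linarith
  have e6 : ∑ y, ∑ z, |u y| * |u z| ≤ C * ∑ x, u x ^ 2 := by
    rw [← Finset.sum_mul_sum, ← sq]
    have := sq_sum_le_card_mul_sum_sq (s := (Finset.univ : Finset T)) (f := fun x => |u x|)
    simpa [sq_abs, hC] using this
  have e7 : γ / (C + 1) * s * ∑ y, ∑ z, |u y| * |u z| ≤ γ * s * ∑ x, u x ^ 2 := by
    have hN : 0 ≤ ∑ x, u x ^ 2 := Finset.sum_nonneg fun _ _ => sq_nonneg _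
    have hC0 : 0 ≤ C := by positivity
    calc _ ≤ γ / (C + 1) * s * (C * ∑ x, u x ^ 2) :=
          mul_le_mul_of_nonneg_left e6 (by positivity)
      _ ≤ γ / (C + 1) * s * ((C + 1) * ∑ x, u x ^ 2) := by
          refine mul_le_mul_of_nonneg_left ?_ (by positivity)
          exact mul_le_mul_of_nonneg_right (by linarith) hN
      _ = _ := by field_simp
  have e8 := mul_le_mul_of_nonneg_left (hΛ u) (by positivity : 0 ≤ 2 * s)
  rw [e1]
  refine e5.trans ?_
  simp only [Finset.sum_add_distrib, ← Finset.mul_sum]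
  rw [e4, e3, e2]
  simp only [← Finset.mul_sum] at e7
  linarith

theorem sum_iterate_stepOp_sq_le (rate : ι → ℝ) (U : ι → T → T) (V : T → ℝ) {ρ s : ℝ}
    (h : ∀ u : T → ℝ, ∑ x, stepOp rate U V s u x ^ 2 ≤ ρ * ∑ x, u x ^ 2) (hρ : 0 ≤ ρ)
    (u : T → ℝ) (k : ℕ) :
    ∑ x, (stepOp rate U V s)^[k] u x ^ 2 ≤ ρ ^ k * ∑ x, u x ^ 2 := by
  induction k with
  | zero => simp
  | succ k ih =>
    rw [Function.iterate_succ_apply', pow_succ', mul_assoc]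
    exact (h _).trans (mul_le_mul_of_nonneg_left ih hρ)

end Step

/-! ### The chain observed on a grid of times -/

section Grid

variable {ι T : Type*} [DecidableEq ι]

open Classical in
/-- The update of a state if exactly one clock rings, and once. -/
def update (U : ι → T → T) (x : T) (v : ι → ℕ) : T :=
  if h : ∃ i, v = Pi.single i 1 then U h.choose x else x

theorem single_one_injective : Function.Injective fun i : ι => (Pi.single i 1 : ι → ℕ) := by
  intro i j h
  by_contra hij
  have := congrFun h i
  simp [hij] at this

theorem update_single (U : ι → T → T) (x : T) (i : ι) : update U x (Pi.single i 1) = U i x := by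
  have h : ∃ j, (Pi.single i 1 : ι → ℕ) = Pi.single j 1 := ⟨i, rfl⟩
  rw [update, dif_pos h, ← single_one_injective h.choose_spec]

theorem update_zero (U : ι → T → T) (x : T) : update U x 0 = x := by
  rw [update, dif_neg]
  rintro ⟨i, hi⟩
  have := congrFun hi i
  simp at this

theorem apply_update [Fintype ι] (U : ι → T → T) (x : T) (v : ι → ℕ) (u : T → ℝ) :
    u (update U x v) = u x + ∑ i, (u (U i x) - u x) * if v = Pi.single i 1 then 1 else 0 := by
  by_cases h : ∃ i, v = Pi.single i 1
  · obtain ⟨i, rfl⟩ := h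
    have : ∀ j, (if (Pi.single i 1 : ι → ℕ) = Pi.single j 1 then (1 : ℝ) else 0)
        = if i = j then 1 else 0 := fun j => by
      congr 1
      exact propext single_one_injective.eq_iff
    simp [update_single, this]
  · have : ∀ i, ¬ v = Pi.single i 1 := fun i hi => h ⟨i, hi⟩
    rw [update, dif_neg h]
    simp [this]

/-- The chain driven by a sequence of innovations. -/
def chain (U : ι → T → T) (x : T) (z : ℕ → ι → ℕ) : ℕ → T
  | 0 => x
  | j + 1 => update U (chain U x z j) (z j)

theorem chain_congr (U : ι → T → T) (x : T) {z z' : ℕ → ι → ℕ} {j : ℕ}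
    (h : ∀ l < j, z l = z' l) : chain U x z j = chain U x z' j := by
  induction j with
  | zero => rfl
  | succ j ih => rw [chain, chain, ih fun l hl => h l (by omega), h j (by omega)]

end Grid

theorem indepFun_prodMk_left {Ω α β γ : Type*} [MeasurableSpace Ω] [MeasurableSpace α]
    [MeasurableSpace β] [MeasurableSpace γ] {P : Measure Ω} [IsProbabilityMeasure P]
    {f : Ω → α} {g : Ω → β} {h : Ω → γ} (hf : Measurable f) (hg : Measurable g) (hh : Measurable h)
    (h1 : IndepFun f (fun ω => (g ω, h ω)) P) (h2 : IndepFun g h P) :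
    IndepFun (fun ω => (f ω, g ω)) h P := by
  have h3 : IndepFun f g P := h1.comp measurable_id measurable_fst
  have : IsProbabilityMeasure (P.map f) := Measure.isProbabilityMeasure_map hf.aemeasurable
  have : IsProbabilityMeasure (P.map g) := Measure.isProbabilityMeasure_map hg.aemeasurable
  have : IsProbabilityMeasure (P.map h) := Measure.isProbabilityMeasure_map hh.aemeasurable
  rw [indepFun_iff_map_prod_eq_prod_map_map hf.aemeasurable (hg.prodMk hh).aemeasurable] at h1
  rw [indepFun_iff_map_prod_eq_prod_map_map hg.aemeasurable hh.aemeasurable] at h2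
  rw [indepFun_iff_map_prod_eq_prod_map_map hf.aemeasurable hg.aemeasurable] at h3
  rw [indepFun_iff_map_prod_eq_prod_map_map (hf.prodMk hg).aemeasurable hh.aemeasurable]
  rw [h3]
  have e : (fun ω => ((f ω, g ω), h ω))
      = MeasurableEquiv.prodAssoc.symm ∘ (fun ω => (f ω, (g ω, h ω))) := rfl
  rw [e, ← Measure.map_map (MeasurableEquiv.measurable _) (hf.prodMk (hg.prodMk hh)), h1, h2,
    ← Measure.prodAssoc_prod, Measure.map_map (MeasurableEquiv.measurable _)
      (MeasurableEquiv.measurable _)]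
  simp

section Clocks

variable {Ω ι : Type*} [MeasurableSpace Ω] {P : Measure Ω} {rate : ι → ℝ≥0}
  {Z : ι → ℝ≥0 → Ω → ℕ}

/-- The increments of the clocks over the `l`-th interval of a grid of mesh `τ`. -/
def incr (Z : ι → ℝ≥0 → Ω → ℕ) (τ : ℝ≥0) (l : ℕ) (ω : Ω) (i : ι) : ℕ :=
  Z i ((l + 1 : ℕ) * τ) ω - Z i ((l : ℕ) * τ) ω

theorem IsPoissonFamily.measurable_incr (hZ : IsPoissonFamily P rate Z) (τ : ℝ≥0) (l : ℕ) :
    Measurable (incr Z τ l) :=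
  measurable_pi_lambda _ fun i => (hZ.measurable i _).sub (hZ.measurable i _)

theorem IsPoissonFamily.iIndepFun_incr (hZ : IsPoissonFamily P rate Z) (τ : ℝ≥0) :
    iIndepFun (fun (p : ι × ℕ) ω => incr Z τ p.2 ω p.1) P := by
  refine iIndepFun_uncurry' (X := fun i l ω => incr Z τ l ω i)
    (fun i l => (hZ.measurable i _).sub (hZ.measurable i _)) ?_ fun i => ?_
  · have hm : ∀ i : ι, Measurable (fun (p : ℝ≥0 → ℕ) (l : ℕ) =>
        p ((l + 1 : ℕ) * τ) - p ((l : ℕ) * τ)) := fun i =>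
      measurable_pi_lambda _ fun l => (measurable_pi_apply _).sub (measurable_pi_apply _)
    exact hZ.indep.comp _ hm
  · have hmono : Monotone fun l : ℕ => ((l : ℕ) : ℝ≥0) * τ := fun a b hab =>
      mul_le_mul_left (Nat.cast_le.2 hab) τ
    exact (hZ.indep_increments i).nat hmono

variable [IsProbabilityMeasure P] [Fintype ι] {T : Type*} [Fintype T] [MeasurableSpace T]
  [MeasurableSingletonClass T] {X₀ : Ω → T}

theorem IsPoissonFamily.indepFun_history (hZ : IsPoissonFamily P rate Z) (hX : Measurable X₀)
    (hind : IndepFun X₀ (fun ω i t => Z i t ω) P) (τ : ℝ≥0) (j : ℕ) {β : Type*} [MeasurableSpace β]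
    (φ : T → (ℕ → ι → ℕ) → β) (hφ : ∀ x z z', (∀ l < j, z l = z' l) → φ x z = φ x z') :
    Measurable (fun ω => φ (X₀ ω) (fun l => incr Z τ l ω)) ∧
    IndepFun (fun ω => φ (X₀ ω) (fun l => incr Z τ l ω)) (incr Z τ j) P := by
  classical
  let I : Finset (ι × ℕ) := Finset.univ ×ˢ Finset.range j
  let J : Finset (ι × ℕ) := Finset.univ ×ˢ {j}
  have hIJ : Disjoint I J := by
    rw [Finset.disjoint_left]
    intro p hp hp'
    simp only [I, J, Finset.mem_product, Finset.mem_range, Finset.mem_singleton] at hp hp'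
    omega
  have hm : ∀ p : ι × ℕ, Measurable (fun ω => incr Z τ p.2 ω p.1) := fun p =>
    (hZ.measurable _ _).sub (hZ.measurable _ _)
  have h1 := (hZ.iIndepFun_incr τ).indepFun_finset I J hIJ hm
  let past : Ω → (I → ℕ) := fun ω p => incr Z τ p.1.2 ω p.1.1
  have hpast : Measurable past := measurable_pi_lambda _ fun p => hm p.1
  have h2 : IndepFun past (incr Z τ j) P := by
    have := h1.comp (φ := id) (ψ := fun (y : J → ℕ) (i : ι) =>
      y ⟨(i, j), by simp [J]⟩) measurable_id
      (measurable_pi_lambda _ fun i => measurable_pi_apply _)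
    exact this
  have hev : ∀ i t, Measurable (fun y : ι → ℝ≥0 → ℕ => y i t) := fun i t =>
    (measurable_pi_apply t).comp (measurable_pi_apply i)
  have h3 : IndepFun X₀ (fun ω => (past ω, incr Z τ j ω)) P := by
    have := hind.comp (φ := id) (ψ := fun (y : ι → ℝ≥0 → ℕ) =>
      ((fun p : I => y p.1.1 ((p.1.2 + 1 : ℕ) * τ) - y p.1.1 ((p.1.2 : ℕ) * τ)),
        (fun i : ι => y i ((j + 1 : ℕ) * τ) - y i ((j : ℕ) * τ)))) measurable_id (by
        refine Measurable.prodMk (measurable_pi_lambda _ fun p => ?_)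
          (measurable_pi_lambda _ fun i => ?_)
        · exact (hev _ _).sub (hev _ _)
        · exact (hev _ _).sub (hev _ _))
    exact this
  have h4 := indepFun_prodMk_left hX hpast (hZ.measurable_incr τ j) h3 h2
  let ψ : T × (I → ℕ) → β := fun y => φ y.1 (fun l i =>
    if h : (i, l) ∈ I then y.2 ⟨(i, l), h⟩ else 0)
  have hψ : Measurable ψ := Measurable.of_discrete
  have e : (fun ω => φ (X₀ ω) (fun l => incr Z τ l ω)) = fun ω => ψ (X₀ ω, past ω) := by
    funext ω
    refine hφ _ _ _ fun l hl => funext fun i => ?_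
    have : (i, l) ∈ I := by simp [I, hl]
    rw [dif_pos this]
  rw [e]
  exact ⟨hψ.comp (hX.prodMk hpast), h4.comp hψ measurable_id⟩

omit [IsProbabilityMeasure P] in
theorem IsPoissonFamily.measureReal_incr_eq (hZ : IsPoissonFamily P rate Z) (τ : ℝ≥0) (j : ℕ)
    (v : ι → ℕ) : P.real {ω | incr Z τ j ω = v} =
      ∏ i, (poissonMeasure (rate i * τ)).real {v i} := by
  have h1 : iIndepFun (fun i ω => incr Z τ j ω i) P :=
    (hZ.iIndepFun_incr τ).precomp (g := fun i : ι => (i, j)) fun a b hab => by simpa using hab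
  have h2 := h1.measure_inter_preimage_eq_mul Finset.univ (sets := fun i => {v i})
    (fun i _ => measurableSet_singleton _)
  have e : {ω | incr Z τ j ω = v}
      = ⋂ i ∈ Finset.univ, (fun ω => incr Z τ j ω i) ⁻¹' {v i} := by
    ext ω
    simp [funext_iff]
  rw [Measure.real, e, h2, ENNReal.toReal_prod]
  refine Finset.prod_congr rfl fun i _ => ?_
  have h3 := hZ.law_increments i ((j : ℕ) * τ) ((j + 1 : ℕ) * τ)
    (mul_le_mul_left (Nat.cast_le.2 (Nat.le_succ j)) τ)
  have h4 : ((j + 1 : ℕ) : ℝ≥0) * τ - (j : ℕ) * τ = τ := by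
    rw [Nat.cast_succ, add_one_mul, add_tsub_cancel_left]
  rw [h4] at h3
  rw [← h3.map_eq, Measure.real, Measure.map_apply_of_aemeasurable h3.aemeasurable
    (measurableSet_singleton _)]
  rfl

theorem prod_poisson_zero (τ : ℝ≥0) :
    ∏ i, (poissonMeasure (rate i * τ)).real {(0 : ι → ℕ) i}
      = Real.exp (-((∑ i, (rate i : ℝ)) * τ)) := by
  simp only [poissonMeasure_real_singleton, Pi.zero_apply, pow_zero, Nat.factorial_zero,
    Nat.cast_one, div_one, mul_one]
  rw [← Real.exp_sum, Finset.sum_mul, ← Finset.sum_neg_distrib]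
  simp

variable [DecidableEq ι]

theorem prod_poisson_single (τ : ℝ≥0) (i : ι) :
    ∏ k, (poissonMeasure (rate k * τ)).real {(Pi.single i 1 : ι → ℕ) k}
      = rate i * τ * Real.exp (-((∑ i, (rate i : ℝ)) * τ)) := by
  rw [← prod_poisson_zero, ← Finset.mul_prod_erase _ _ (Finset.mem_univ i),
    ← Finset.mul_prod_erase (f := fun k => (poissonMeasure (rate k * τ)).real {(0 : ι → ℕ) k})
      _ (Finset.mem_univ i), ← mul_assoc]
  congr 1
  · simp [poissonMeasure_real_singleton]
    ring
  · refine Finset.prod_congr rfl fun k hk => ?_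
    rw [Pi.single_eq_of_ne (Finset.ne_of_mem_erase hk)]
    rfl

/-- Several clocks ring, or one clock rings several times, in the `l`-th interval. -/
def multipleRings (Z : ι → ℝ≥0 → Ω → ℕ) (τ : ℝ≥0) (l : ℕ) : Set Ω :=
  {ω | ¬ (incr Z τ l ω = 0 ∨ ∃ i, incr Z τ l ω = Pi.single i 1)}

theorem IsPoissonFamily.measureReal_multipleRings_le (hZ : IsPoissonFamily P rate Z) (τ : ℝ≥0)
    (l : ℕ) : P.real (multipleRings Z τ l) ≤ ((∑ i, (rate i : ℝ)) * τ) ^ 2 := by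
  let A : Finset (ι → ℕ) := insert 0 (Finset.univ.image fun i => Pi.single i 1)
  have hA : (0 : ι → ℕ) ∉ Finset.univ.image fun i : ι => (Pi.single i 1 : ι → ℕ) := by
    simp only [Finset.mem_image, Finset.mem_univ, true_and, not_exists]
    intro i hi
    have := congrFun hi i
    simp at this
  have hm := hZ.measurable_incr τ l
  have e1 : multipleRings Z τ l = (⋃ v ∈ A, {ω | incr Z τ l ω = v})ᶜ := by
    ext ω
    simp [multipleRings, A]
  have hms : ∀ v, MeasurableSet {ω | incr Z τ l ω = v} := fun v =>
    hm (measurableSet_singleton v)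
  have e2 : P.real (⋃ v ∈ A, {ω | incr Z τ l ω = v}) = ∑ v ∈ A, P.real {ω | incr Z τ l ω = v} := by
    refine measureReal_biUnion_finset (fun v _ w _ hvw => ?_) fun v _ => hms v
    rw [Function.onFun, Set.disjoint_left]
    intro ω h1 h2
    exact hvw (h1.symm.trans h2)
  rw [e1, probReal_compl_eq_one_sub (Finset.measurableSet_biUnion _ fun v _ => hms v), e2,
    Finset.sum_insert hA, Finset.sum_image fun i _ j _ h => single_one_injective h]
  simp only [hZ.measureReal_incr_eq]
  rw [prod_poisson_zero]
  simp only [prod_poisson_single]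
  rw [← Finset.sum_mul, ← Finset.sum_mul]
  set x := (∑ i, (rate i : ℝ)) * τ with hx
  have hx0 : 0 ≤ x := by positivity
  have h1 := Real.add_one_le_exp (-x)
  nlinarith

theorem IsPoissonFamily.integral_chain_eq (hZ : IsPoissonFamily P rate Z) (hX : Measurable X₀)
    (hind : IndepFun X₀ (fun ω i t => Z i t ω) P) (U : ι → T → T) (V : T → ℝ) (τ : ℝ≥0) (j : ℕ)
    (u : T → ℝ) :
    Integrable (fun ω => Real.exp (τ * ∑ l ∈ Finset.range j, V (chain U (X₀ ω) (incr Z τ · ω) l))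
      * u (chain U (X₀ ω) (incr Z τ · ω) j)) P ∧
    ∫ ω, Real.exp (τ * ∑ l ∈ Finset.range j, V (chain U (X₀ ω) (incr Z τ · ω) l))
      * u (chain U (X₀ ω) (incr Z τ · ω) j) ∂P
      = ∫ ω, (stepOp (fun i => (rate i : ℝ)) U V τ)^[j] u (X₀ ω) ∂P := by
  have hint : ∀ (j : ℕ) (u : T → ℝ),
      Integrable (fun ω => Real.exp (τ * ∑ l ∈ Finset.range j,
        V (chain U (X₀ ω) (incr Z τ · ω) l)) * u (chain U (X₀ ω) (incr Z τ · ω) j)) P := by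
    intro j u
    have hmeas := (hZ.indepFun_history hX hind τ j (fun x z =>
      Real.exp (τ * ∑ l ∈ Finset.range j, V (chain U x z l)) * u (chain U x z j))
      (fun x z z' h => by
        rw [chain_congr U x h, Finset.sum_congr rfl fun l hl => by
          rw [chain_congr U x (z' := z') fun k hk => h k
            (hk.trans (Finset.mem_range.1 hl))]])).1
    refine Integrable.of_bound hmeas.aestronglyMeasurable
      (Real.exp (τ * (j * ∑ x, |V x|)) * ∑ x, |u x|) (ae_of_all _ fun ω => ?_)
    rw [norm_mul, Real.norm_eq_abs, Real.norm_eq_abs, Real.abs_exp]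
    have hb : ∀ (f : T → ℝ) x, |f x| ≤ ∑ x, |f x| := fun f x =>
      Finset.single_le_sum (f := fun x => |f x|) (fun _ _ => abs_nonneg _) (Finset.mem_univ x)
    refine mul_le_mul (Real.exp_le_exp.2 (mul_le_mul_of_nonneg_left ?_ τ.2)) (hb u _)
      (abs_nonneg _) (Real.exp_pos _).le
    refine (Finset.sum_le_card_nsmul _ _ _ fun l _ => (le_abs_self _).trans (hb V _)).trans_eq ?_
    rw [Finset.card_range, nsmul_eq_mul]
  refine ⟨hint j u, ?_⟩
  induction j generalizing u with
  | zero => simp [chain]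
  | succ j ih =>
    rw [Function.iterate_succ_apply, ← ih]
    set H : Ω → ℕ → T := fun ω => chain U (X₀ ω) (incr Z τ · ω) with hH
    have hexp : ∀ ω, Real.exp (τ * ∑ l ∈ Finset.range (j + 1), V (H ω l)) * u (H ω (j + 1))
        = Real.exp (τ * ∑ l ∈ Finset.range j, V (H ω l)) * (Real.exp (τ * V (H ω j)) * u (H ω j))
          + ∑ i, (Real.exp (τ * ∑ l ∈ Finset.range j, V (H ω l)) *
            (Real.exp (τ * V (H ω j)) * (u (U i (H ω j)) - u (H ω j))))
              * if incr Z τ j ω = Pi.single i 1 then 1 else 0 := by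
      intro ω
      have : H ω (j + 1) = update U (H ω j) (incr Z τ j ω) := rfl
      rw [this, apply_update U _ _ u, Finset.sum_range_succ, mul_add (τ : ℝ), Real.exp_add]
      generalize Real.exp (τ * ∑ l ∈ Finset.range j, V (H ω l)) = E
      rw [mul_add, Finset.mul_sum, mul_assoc]
      congr 1
      refine Finset.sum_congr rfl fun i _ => ?_
      ring
    have hms : ∀ i : ι, MeasurableSet {ω | incr Z τ j ω = Pi.single i 1} := fun i =>
      hZ.measurable_incr τ j (measurableSet_singleton _)
    have hmi : ∀ i : ι, Measurable fun v : ι → ℕ => if v = Pi.single i 1 then (1 : ℝ) else 0 :=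
      fun i => Measurable.of_discrete
    have hterm : ∀ i, Integrable (fun ω => (Real.exp (τ * ∑ l ∈ Finset.range j, V (H ω l)) *
            (Real.exp (τ * V (H ω j)) * (u (U i (H ω j)) - u (H ω j))))
              * if incr Z τ j ω = Pi.single i 1 then 1 else 0) P ∧
        ∫ ω, (Real.exp (τ * ∑ l ∈ Finset.range j, V (H ω l)) *
            (Real.exp (τ * V (H ω j)) * (u (U i (H ω j)) - u (H ω j))))
              * (if incr Z τ j ω = Pi.single i 1 then 1 else 0) ∂P
        = (∫ ω, Real.exp (τ * ∑ l ∈ Finset.range j, V (H ω l)) *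
            (Real.exp (τ * V (H ω j)) * (u (U i (H ω j)) - u (H ω j))) ∂P)
          * (rate i * τ * Real.exp (-((∑ i, (rate i : ℝ)) * τ))) := by
      intro i
      have h1 := (hZ.indepFun_history hX hind τ j (fun x z =>
        Real.exp (τ * ∑ l ∈ Finset.range j, V (chain U x z l)) *
          (Real.exp (τ * V (chain U x z j)) * (u (U i (chain U x z j)) - u (chain U x z j))))
        (fun x z z' h => by
          rw [chain_congr U x h, Finset.sum_congr rfl fun l hl => by
            rw [chain_congr U x (z' := z') fun k hk => h k
              (hk.trans (Finset.mem_range.1 hl))]]))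
      have h2 := h1.2.comp (φ := id) measurable_id (hmi i)
      have h3 : AEStronglyMeasurable (fun ω => if incr Z τ j ω = Pi.single i 1 then (1 : ℝ) else 0)
          P := ((hmi i).comp (hZ.measurable_incr τ j)).aestronglyMeasurable
      constructor
      · refine (hint j fun x => Real.exp (τ * V x) * (u (U i x) - u x)).mul_bdd (c := 1) h3
          (ae_of_all _ fun ω => ?_)
        split_ifs <;> simp
      · have h4 := h2.integral_fun_mul_eq_mul_integral h1.1.aestronglyMeasurable h3
        refine h4.trans ?_
        congr 1
        have : (fun ω => if incr Z τ j ω = Pi.single i 1 then (1 : ℝ) else 0)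
            = Set.indicator {ω | incr Z τ j ω = Pi.single i 1} 1 := by
          funext ω
          simp [Set.indicator_apply]
        refine (congrArg (fun f => ∫ ω, f ω ∂P) this).trans ?_
        rw [integral_indicator_one (hms i), hZ.measureReal_incr_eq, prod_poisson_single]
    rw [integral_congr_ae (ae_of_all _ hexp), integral_add
      (hint j fun x => Real.exp (τ * V x) * u x) (integrable_finsetSum _ fun i _ => (hterm i).1),
      integral_finsetSum _ fun i _ => (hterm i).1]
    simp only [fun i => (hterm i).2]
    simp only [← integral_mul_const]
    rw [← integral_finsetSum _ fun i _ => ((hint j fun x =>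
        Real.exp (τ * V x) * (u (U i x) - u x)).mul_const _),
      ← integral_add (hint j fun x => Real.exp (τ * V x) * u x)
        (integrable_finsetSum _ fun i _ => ((hint j fun x =>
        Real.exp (τ * V x) * (u (U i x) - u x)).mul_const _))]
    congr 1
    funext ω
    generalize Real.exp (τ * ∑ l ∈ Finset.range j, V (H ω l)) = E
    rw [stepOp, mul_add, mul_add, Finset.mul_sum, Finset.mul_sum]
    congr 1
    refine Finset.sum_congr rfl fun i _ => ?_
    ring

end Clocks

/-! ### From the chain to the process in continuous time -/

section Continuous

variable {Ω ι : Type*} [MeasurableSpace Ω] {P : Measure Ω} [IsProbabilityMeasure P] [Fintype ι]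
  {rate : ι → ℝ≥0} {Z : ι → ℝ≥0 → Ω → ℕ}
  {T : Type*} [Fintype T] [MeasurableSpace T] [MeasurableSingletonClass T]

theorem IsPoissonFamily.measureReal_chain_le [DecidableEq ι] (hZ : IsPoissonFamily P rate Z) {X₀ : Ω → T}
    (hX : Measurable X₀) (hind : IndepFun X₀ (fun ω i t => Z i t ω) P) (U : ι → T → T) (V : T → ℝ)
    (τ : ℝ≥0) (j : ℕ) {a : ℝ}
    (h : ∀ u : T → ℝ, ∑ x, stepOp (fun i => (rate i : ℝ)) U V τ u x ^ 2
      ≤ Real.exp (2 * a * τ) * ∑ x, u x ^ 2) (c : ℝ) :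
    P.real {ω | c ≤ τ * ∑ l ∈ Finset.range j, V (chain U (X₀ ω) (incr Z τ · ω) l)} ≤
      Real.exp (-c) * (√(Fintype.card T) * Real.exp (a * (j * τ))) := by
  classical
  obtain ⟨h1, h2⟩ := hZ.integral_chain_eq hX hind U V τ j (fun _ => 1)
  simp only [mul_one] at h1 h2
  have hmgf := measure_ge_le_exp_mul_mgf (μ := P)
    (X := fun ω => τ * ∑ l ∈ Finset.range j, V (chain U (X₀ ω) (incr Z τ · ω) l)) c
    zero_le_one (by simpa using h1)
  refine hmgf.trans ?_
  rw [neg_mul, one_mul]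
  refine mul_le_mul_of_nonneg_left ?_ (Real.exp_pos _).le
  simp only [mgf, one_mul]
  rw [h2]
  set w := (stepOp (fun i => (rate i : ℝ)) U V τ)^[j] (fun _ => (1 : ℝ)) with hw
  have h3 := sum_iterate_stepOp_sq_le _ U V h (Real.exp_pos _).le (fun _ => 1) j
  have h4 : ∀ x, w x ≤ √(Fintype.card T) * Real.exp (a * (j * τ)) := by
    intro x
    refine (Real.le_sqrt_of_sq_le (y := Fintype.card T * Real.exp (2 * (a * (j * τ)))) ?_).trans_eq
      ?_
    · have h5 := Finset.single_le_sum (f := fun x => w x ^ 2) (fun _ _ => sq_nonneg _)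
        (Finset.mem_univ x)
      refine h5.trans (h3.trans_eq ?_)
      rw [← Real.exp_nat_mul]
      simp
      rw [mul_comm]
      congr 2
      ring
    · rw [Real.sqrt_mul (by positivity)]
      congr 1
      rw [mul_comm (2 : ℝ), Real.exp_mul, Real.rpow_two, Real.sqrt_sq (Real.exp_pos _).le]
  have h6 : ∀ᵐ ω ∂P, w (X₀ ω) ≤ √(Fintype.card T) * Real.exp (a * (j * τ)) :=
    ae_of_all _ fun ω => h4 _
  have hwm : Measurable w := Measurable.of_discrete
  have h7 : Integrable (fun ω => w (X₀ ω)) P := by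
    refine Integrable.of_bound (hwm.comp hX).aestronglyMeasurable (∑ x, ‖w x‖)
      (ae_of_all _ fun ω => ?_)
    exact Finset.single_le_sum (f := fun x => ‖w x‖) (fun _ _ => norm_nonneg _)
      (Finset.mem_univ _)
  refine (integral_mono_ae h7 (integrable_const _) h6).trans_eq ?_
  simp

theorem integral_floor_eq_sum {τ : ℝ} (hτ : 0 < τ) {g : ℕ → ℝ} (n : ℕ) :
    ∫ s in (0 : ℝ)..(n * τ), g ⌊s / τ⌋₊ = τ * ∑ l ∈ Finset.range n, g l := by
  have hae : ∀ l : ℕ, (fun s : ℝ => g ⌊s / τ⌋₊) =ᵐ[volume.restrict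
      (Set.uIoc (l * τ) ((l + 1 : ℕ) * τ))] fun _ => g l := by
    intro l
    have hle : (l : ℝ) * τ ≤ (l + 1 : ℕ) * τ := by
      push_cast; linarith
    rw [Set.uIoc_of_le hle]
    have h1 : ∀ᵐ s : ℝ, s ≠ (l + 1 : ℕ) * τ := by
      simp [ae_iff, measure_singleton]
    rw [EventuallyEq, ae_restrict_iff' measurableSet_Ioc]
    filter_upwards [h1] with s hs hs'
    have : ⌊s / τ⌋₊ = l := by
      rw [Nat.floor_eq_iff (div_nonneg ((by positivity : (0 : ℝ) ≤ l * τ).trans hs'.1.le) hτ.le)]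
      refine ⟨(le_div_iff₀ hτ).2 hs'.1.le, (div_lt_iff₀ hτ).2 ?_⟩
      have := lt_of_le_of_ne hs'.2 hs
      push_cast at this
      exact this
    rw [this]
  have h2 := intervalIntegral.sum_integral_adjacent_intervals (n := n)
    (a := fun l : ℕ => (l : ℝ) * τ) (f := fun s : ℝ => g ⌊s / τ⌋₊) (μ := volume) fun l _ => by
      rw [intervalIntegrable_iff]
      exact IntegrableOn.congr_fun_ae (integrableOn_const (by simp)) (hae l).symm
  simp only [Nat.cast_zero, zero_mul] at h2
  rw [← h2, Finset.mul_sum]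
  refine Finset.sum_congr rfl fun l _ => ?_
  rw [intervalIntegral.integral_congr_ae ((ae_restrict_iff' measurableSet_uIoc).1 (hae l)),
    intervalIntegral.integral_const, smul_eq_mul]
  push_cast
  ring

theorem tendsto_riemannSum {E : Type*} {z : ι → ℝ≥0 → ℕ} (hz : ∀ i, Monotone (z i))
    {x : ℝ≥0 → E} (hx : ∀ a b, a ≤ b → (∀ i, z i b = z i a) → x b = x a)
    (V : E → ℝ) {B : ℝ} (hV : ∀ e, |V e| ≤ B) (t : ℝ≥0) :
    Tendsto (fun n : ℕ => ((t / (n + 1 : ℕ) : ℝ≥0) : ℝ) *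
      ∑ l ∈ Finset.range (n + 1), V (x ((l : ℕ) * (t / (n + 1 : ℕ))))) atTop
      (𝓝 (∫ s in (0 : ℝ)..t, V (x s.toNNReal))) := by
  rcases eq_or_ne t 0 with rfl | ht
  · simp
  have ht0 : 0 < t := pos_iff_ne_zero.2 ht
  let τ : ℕ → ℝ≥0 := fun n => t / (n + 1 : ℕ)
  have hτ0 : ∀ n, 0 < τ n := fun n => by positivity
  have hτ0' : ∀ n, (0 : ℝ) < τ n := fun n => hτ0 n
  have hτlim : Tendsto τ atTop (𝓝 0) := by
    have h1 : Tendsto (fun n : ℕ => ((n + 1 : ℕ) : ℝ)) atTop atTop :=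
      tendsto_natCast_atTop_atTop.comp (tendsto_add_atTop_nat 1)
    rw [← NNReal.tendsto_coe]
    simpa [τ] using h1.const_div_atTop (t : ℝ)
  have e1 : ∀ n : ℕ, ((τ n : ℝ≥0) : ℝ) * ∑ l ∈ Finset.range (n + 1), V (x ((l : ℕ) * τ n))
      = ∫ s in (0 : ℝ)..t, V (x ((⌊s / (τ n : ℝ)⌋₊ : ℕ) * τ n)) := by
    intro n
    have h1 := integral_floor_eq_sum (hτ0' n) (g := fun l => V (x ((l : ℕ) * τ n))) (n + 1)
    rw [← h1]
    congr 1
    simp only [τ]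
    push_cast
    field_simp
  change Tendsto (fun n : ℕ => ((τ n : ℝ≥0) : ℝ) *
      ∑ l ∈ Finset.range (n + 1), V (x ((l : ℕ) * τ n))) atTop _
  simp only [e1]
  refine intervalIntegral.tendsto_integral_filter_of_dominated_convergence (fun _ => B) ?_ ?_ ?_ ?_
  · refine Eventually.of_forall fun n => ?_
    have h1 : Measurable fun s : ℝ => ⌊s / (τ n : ℝ)⌋₊ :=
      Nat.measurable_floor.comp (measurable_id.div_const _)
    have h2 : Measurable fun l : ℕ => V (x ((l : ℕ) * τ n)) := measurable_from_top
    exact (h2.comp h1).aestronglyMeasurable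
  · exact Eventually.of_forall fun n => ae_of_all _ fun s _ => hV _
  · simp
  · let C : Set ℝ≥0 := ⋃ i, {s | ¬ ContinuousAt (z i) s}
    have hC : C.Countable := Set.countable_iUnion fun i => (hz i).countable_not_continuousAt
    have hC' : ((fun s : ℝ≥0 => (s : ℝ)) '' C).Countable := hC.image _
    filter_upwards [hC'.ae_notMem volume] with s hs hs'
    rw [Set.uIoc_of_le (show (0 : ℝ) ≤ t from t.2)] at hs'
    have hsC : s.toNNReal ∉ C := fun h => hs ⟨_, h, Real.coe_toNNReal s hs'.1.le⟩
    have hcont : ∀ i, ContinuousAt (z i) s.toNNReal := by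
      intro i
      by_contra h
      exact hsC (Set.mem_iUnion.2 ⟨i, h⟩)
    have hle : ∀ n, ((⌊s / (τ n : ℝ)⌋₊ : ℕ) : ℝ≥0) * τ n ≤ s.toNNReal := by
      intro n
      rw [← NNReal.coe_le_coe, Real.coe_toNNReal s hs'.1.le]
      push_cast
      rw [← le_div_iff₀ (hτ0' n)]
      exact Nat.floor_le (div_nonneg hs'.1.le (hτ0' n).le)
    have hge : ∀ n, s.toNNReal ≤ ((⌊s / (τ n : ℝ)⌋₊ : ℕ) : ℝ≥0) * τ n + τ n := by
      intro n
      rw [← NNReal.coe_le_coe, Real.coe_toNNReal s hs'.1.le]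
      push_cast
      have h1 := (Nat.lt_floor_add_one (s / (τ n : ℝ))).le
      rw [div_le_iff₀ (hτ0' n)] at h1
      linarith
    have hlim : Tendsto (fun n => ((⌊s / (τ n : ℝ)⌋₊ : ℕ) : ℝ≥0) * τ n) atTop
        (𝓝 s.toNNReal) := by
      have h1 : Tendsto (fun n => s.toNNReal - τ n) atTop (𝓝 s.toNNReal) := by
        have := (tendsto_const_nhds (x := s.toNNReal)).sub hτlim
        simpa using this
      exact tendsto_of_tendsto_of_tendsto_of_le_of_le h1 tendsto_const_nhds
        (fun n => tsub_le_iff_right.2 (hge n)) hle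
    have hev : ∀ᶠ r in 𝓝 s.toNNReal, ∀ i, z i r = z i s.toNNReal := by
      rw [eventually_all]
      intro i
      exact (hcont i).eventually (IsOpen.mem_nhds (isOpen_discrete {z i s.toNNReal}) rfl)
    refine tendsto_const_nhds.congr' ?_
    filter_upwards [hlim.eventually hev] with n hn
    rw [hx _ _ (hle n) fun i => (hn i).symm]

theorem IsPoissonFamily.measure_integral_gt_le (hZ : IsPoissonFamily P rate Z) (U : ι → T → T)
    (X : ℝ≥0 → Ω → T) (hX : Measurable (X 0)) (hind : IndepFun (X 0) (fun ω i t => Z i t ω) P)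
    (hpath : ∀ᵐ ω ∂P, ∀ a b, a ≤ b → ((∀ i, Z i b ω = Z i a ω) → X b ω = X a ω) ∧
      ∀ i, Z i b ω = Z i a ω + 1 → (∀ j, j ≠ i → Z j b ω = Z j a ω) → X b ω = U i (X a ω))
    (V : T → ℝ) {Λ : ℝ}
    (hΛ : ∀ u : T → ℝ, ∑ x, V x * u x ^ 2 + ∑ x, u x * ∑ i, (rate i : ℝ) * (u (U i x) - u x)
      ≤ Λ * ∑ x, u x ^ 2) {t : ℝ} (ht : 0 < t) (c : ℝ) :
    P {ω | c < ∫ s in (0 : ℝ)..t, V (X s.toNNReal ω)} ≤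
      ENNReal.ofReal (Real.exp (-c) * (√(Fintype.card T) * Real.exp ((Λ + 1) * t))) := by
  classical
  lift t to ℝ≥0 using ht.le
  have ht0 : 0 < t := ht
  let τ : ℕ → ℝ≥0 := fun n => t / (n + 1 : ℕ)
  have hτ0 : ∀ n, 0 < τ n := fun n => by positivity
  have hτn : ∀ n, ((n + 1 : ℕ) : ℝ) * τ n = t := fun n => by
    simp only [τ]; push_cast; field_simp
  have hτlim : Tendsto (fun n => (τ n : ℝ)) atTop (𝓝[>] 0) := by
    refine tendsto_nhdsWithin_iff.2 ⟨?_, Eventually.of_forall fun n => hτ0 n⟩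
    have h1 : Tendsto (fun n : ℕ => ((n + 1 : ℕ) : ℝ)) atTop atTop :=
      tendsto_natCast_atTop_atTop.comp (tendsto_add_atTop_nat 1)
    have h2 := h1.const_div_atTop (t : ℝ)
    simpa [τ] using h2
  set R : ℝ := ∑ i, (rate i : ℝ) with hR
  have hR0 : 0 ≤ R := Finset.sum_nonneg fun i _ => (rate i).2
  set K : ℝ := Real.exp (-c) * (√(Fintype.card T) * Real.exp ((Λ + 1) * t)) with hK
  have hK0 : 0 ≤ K := by positivity
  let H : ℕ → Ω → ℕ → T := fun n ω => chain U (X 0 ω) (incr Z (τ n) · ω)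
  let E : ℕ → Set Ω := fun n => (⋃ l ∈ Finset.range (n + 1), multipleRings Z (τ n) l) ∪
    {ω | c ≤ τ n * ∑ l ∈ Finset.range (n + 1), V (H n ω l)}
  have hE : ∀ᶠ n in atTop, P (E n) ≤ ENNReal.ofReal ((R * t) ^ 2 * (1 / ((n : ℝ) + 1)) + K) := by
    filter_upwards [hτlim.eventually (eventually_sum_stepOp_sq_le (fun i => (rate i : ℝ)) U V hΛ
      (γ := 2) two_pos)] with n hn
    have h1 : ∀ u : T → ℝ, ∑ x, stepOp (fun i => (rate i : ℝ)) U V (τ n) u x ^ 2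
        ≤ Real.exp (2 * (Λ + 1) * τ n) * ∑ x, u x ^ 2 := fun u => by
      refine (hn u).trans (mul_le_mul_of_nonneg_right ?_ (Finset.sum_nonneg fun _ _ => sq_nonneg _))
      have := Real.add_one_le_exp (2 * (Λ + 1) * τ n)
      linarith
    have h2 := hZ.measureReal_chain_le hX hind U V (τ n) (n + 1) h1 c
    rw [hτn n] at h2
    have h3 : P.real (⋃ l ∈ Finset.range (n + 1), multipleRings Z (τ n) l)
        ≤ (R * t) ^ 2 * (1 / ((n : ℝ) + 1)) := by
      refine (measureReal_biUnion_finset_le _ _).trans ?_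
      refine (Finset.sum_le_sum fun l _ => hZ.measureReal_multipleRings_le (τ n) l).trans_eq ?_
      rw [Finset.sum_const, Finset.card_range, nsmul_eq_mul, ← hR, ← hτn n]
      push_cast
      field_simp
    have h4 : P.real (E n) ≤ (R * t) ^ 2 * (1 / ((n : ℝ) + 1)) + K :=
      (measureReal_union_le _ _).trans (add_le_add h3 h2)
    rw [← ENNReal.ofReal_toReal (measure_ne_top P (E n))]
    exact ENNReal.ofReal_le_ofReal h4
  have hlim : Tendsto (fun n : ℕ => ENNReal.ofReal ((R * t) ^ 2 * (1 / ((n : ℝ) + 1)) + K)) atTop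
      (𝓝 (ENNReal.ofReal K)) := by
    refine (ENNReal.continuous_ofReal.tendsto _).comp ?_
    have := (tendsto_one_div_add_atTop_nhds_zero_nat (𝕜 := ℝ)).const_mul ((R * t) ^ 2)
    simpa using this.add_const K
  have hsub : ∀ᵐ ω ∂P, c < (∫ s in (0 : ℝ)..t, V (X s.toNNReal ω)) →
      ω ∈ ⋃ N : ℕ, ⋂ n ∈ Set.Ici N, E n := by
    have hmono : ∀ᵐ ω ∂P, ∀ i, Monotone (fun t => Z i t ω) := ae_all_iff.2 hZ.mono
    filter_upwards [hpath, hmono] with ω hω hm hc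
    have hV : ∀ e, |V e| ≤ ∑ e, |V e| := fun e =>
      Finset.single_le_sum (f := fun e => |V e|) (fun _ _ => abs_nonneg _) (Finset.mem_univ e)
    have h1 := tendsto_riemannSum (z := fun i t => Z i t ω) hm (x := fun t => X t ω)
      (fun a b hab h => (hω a b hab).1 h) V hV t
    obtain ⟨N, hN⟩ := eventually_atTop.1 (h1.eventually (lt_mem_nhds hc))
    refine Set.mem_iUnion.2 ⟨N, Set.mem_iInter₂.2 fun n hn => ?_⟩
    by_cases hbad : ω ∈ ⋃ l ∈ Finset.range (n + 1), multipleRings Z (τ n) l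
    · exact Or.inl hbad
    · refine Or.inr ?_
      have hgood : ∀ l < n + 1, incr Z (τ n) l ω = 0 ∨ ∃ i, incr Z (τ n) l ω = Pi.single i 1 := by
        intro l hl
        by_contra h
        exact hbad (Set.mem_iUnion₂.2 ⟨l, Finset.mem_range.2 hl, h⟩)
      have hchain : ∀ l ≤ n + 1, H n ω l = X ((l : ℕ) * τ n) ω := by
        intro l
        induction l with
        | zero => intro _; simp [H, chain]
        | succ l ih =>
          intro hl
          have h2 : H n ω (l + 1) = update U (H n ω l) (incr Z (τ n) l ω) := rfl
          have hle : ((l : ℕ) : ℝ≥0) * τ n ≤ (l + 1 : ℕ) * τ n :=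
            mul_le_mul_left (Nat.cast_le.2 (Nat.le_succ l)) (τ n)
          rw [h2, ih (by omega)]
          have h3 := hω _ _ hle
          have hmle : ∀ i, Z i ((l : ℕ) * τ n) ω ≤ Z i ((l + 1 : ℕ) * τ n) ω := fun i => hm i hle
          rcases hgood l (by omega) with h0 | ⟨i, hi⟩
          · rw [h0, update_zero]
            refine (h3.1 fun i => ?_).symm
            have h4 : Z i ((l + 1 : ℕ) * τ n) ω - Z i ((l : ℕ) * τ n) ω = 0 := congrFun h0 i
            have := hmle i
            omega
          · rw [hi, update_single]
            refine (h3.2 i ?_ fun j hj => ?_).symm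
            · have h4 : Z i ((l + 1 : ℕ) * τ n) ω - Z i ((l : ℕ) * τ n) ω = 1 := by
                have := congrFun hi i
                rw [Pi.single_eq_same] at this
                exact this
              omega
            · have h4 : Z j ((l + 1 : ℕ) * τ n) ω - Z j ((l : ℕ) * τ n) ω = 0 := by
                have := congrFun hi j
                rw [Pi.single_eq_of_ne hj] at this
                exact this
              have := hmle j
              omega
      have h5 := hN n hn
      have h6 : ∑ l ∈ Finset.range (n + 1), V (H n ω l)
          = ∑ l ∈ Finset.range (n + 1), V (X ((l : ℕ) * τ n) ω) :=
        Finset.sum_congr rfl fun l hl => by rw [hchain l (Finset.mem_range.1 hl).le]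
      rw [Set.mem_ofPred_eq, h6]
      exact h5.le
  calc P {ω | c < ∫ s in (0 : ℝ)..t, V (X s.toNNReal ω)}
      ≤ P (⋃ N : ℕ, ⋂ n ∈ Set.Ici N, E n) := measure_mono_ae hsub
    _ ≤ ENNReal.ofReal K := by
        have hmon : Monotone fun N : ℕ => ⋂ n ∈ Set.Ici N, E n := fun a b hab =>
          Set.biInter_subset_biInter_left (Set.Ici_subset_Ici.2 hab)
        rw [hmon.measure_iUnion]
        refine iSup_le fun N => ge_of_tendsto hlim ?_
        filter_upwards [hE, eventually_ge_atTop N] with n hn hNn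
        exact (measure_mono (Set.biInter_subset_of_mem (show n ∈ Set.Ici N from hNn))).trans hn

end Continuous

/-! ### Càdlàg paths driven by counting paths -/

section Paths

theorem leftLim_eq_of_eqOn {E : Type*} [TopologicalSpace E] [T2Space E] {f : ℝ≥0 → E} {a t : ℝ≥0}
    {v : E} (hat : a < t) (h : ∀ s, a ≤ s → s < t → f s = v) : Function.leftLim f t = v := by
  have := nhdsLT_neBot_of_exists_lt ⟨a, hat⟩
  refine leftLim_eq_of_tendsto (tendsto_const_nhds.congr' ?_)
  filter_upwards [Ico_mem_nhdsLT hat] with s hs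
  exact (h s hs.1 hs.2).symm

theorem IsCadlag.tendsto_leftLim {E : Type*} [TopologicalSpace E] [T2Space E] {f : ℝ≥0 → E}
    (hf : IsCadlag f) {a t : ℝ≥0} (hat : a < t) :
    Tendsto f (𝓝[<] t) (𝓝 (Function.leftLim f t)) := by
  obtain ⟨y, hy⟩ := (hf t).2
  have := nhdsLT_neBot_of_exists_lt ⟨a, hat⟩
  rwa [leftLim_eq_of_tendsto hy]

theorem IsCadlag.comp_continuous {E F : Type*} [TopologicalSpace E] [TopologicalSpace F]
    {f : ℝ≥0 → E} (hf : IsCadlag f) {g : E → F} (hg : Continuous g) : IsCadlag fun s => g (f s) :=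
  fun t => ⟨hg.continuousAt.comp_continuousWithinAt (hf t).1, by
    obtain ⟨y, hy⟩ := (hf t).2
    exact ⟨g y, (hg.tendsto y).comp hy⟩⟩

theorem IsCadlag.leftLim_comp {E F : Type*} [TopologicalSpace E] [TopologicalSpace F] [T2Space E]
    [T2Space F] {f : ℝ≥0 → E} (hf : IsCadlag f) {g : E → F} (hg : Continuous g) {a t : ℝ≥0}
    (hat : a < t) : Function.leftLim (fun s => g (f s)) t = g (Function.leftLim f t) :=
  have := nhdsLT_neBot_of_exists_lt ⟨a, hat⟩
  leftLim_eq_of_tendsto ((hg.tendsto _).comp (hf.tendsto_leftLim hat))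

theorem IsCadlag.eq_of_jump_eq_zero {f : ℝ≥0 → ℝ} (hf : IsCadlag f) {D : Set ℝ} (hD : D.Countable)
    (hfD : ∀ s, f s ∈ D) {a b : ℝ≥0} (hab : a ≤ b) (hj : ∀ t, a < t → t ≤ b → jump f t = 0) :
    f b = f a := by
  have hcont : ContinuousOn f (Set.Icc a b) := by
    intro t ht
    rcases eq_or_lt_of_le ht.1 with rfl | hat
    · exact (hf a).1.mono Set.Icc_subset_Ici_self
    · refine ContinuousAt.continuousWithinAt (continuousAt_iff_continuous_left'_right'.2
        ⟨?_, (hf t).1.mono Set.Ioi_subset_Ici_self⟩)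
      have h1 := hf.tendsto_leftLim hat
      have h2 := hj t hat ht.2
      rw [jump, sub_eq_zero] at h2
      rwa [← h2] at h1
  have hpre : IsPreconnected (f '' Set.Icc a b) := (isPreconnected_Icc).image f hcont
  have hsub := hD.isTotallyDisconnected (f '' Set.Icc a b)
    (by rintro _ ⟨s, _, rfl⟩; exact hfD s) hpre
  exact hsub ⟨b, ⟨hab, le_rfl⟩, rfl⟩ ⟨a, ⟨le_rfl, hab⟩, rfl⟩

theorem exists_jump_time {z : ℝ≥0 → ℕ} (hm : Monotone z) (hz : IsCadlag z) {a b : ℝ≥0}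
    (h : z b = z a + 1) :
    ∃ τ, a < τ ∧ τ ≤ b ∧ (∀ s, a ≤ s → s < τ → z s = z a) ∧
      ∀ s, τ ≤ s → s ≤ b → z s = z a + 1 := by
  let A : Set ℝ≥0 := {s | z a + 1 ≤ z s}
  have hbA : b ∈ A := h.ge
  have hbdd : BddBelow A := OrderBot.bddBelow A
  have hτ : z a + 1 ≤ z (sInf A) := by
    have h1 : ∀ᶠ s in 𝓝[≥] (sInf A), z s = z (sInf A) :=
      (hz (sInf A)).1.eventually ((isOpen_discrete {z (sInf A)}).mem_nhds rfl)
    obtain ⟨u, hu, hsub⟩ := (mem_nhdsGE_iff_exists_Ico_subset' (lt_add_one (sInf A))).1 h1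
    obtain ⟨s, hs, hsu⟩ := exists_lt_of_csInf_lt ⟨b, hbA⟩ hu
    have h2 : z s = z (sInf A) := hsub ⟨csInf_le hbdd hs, hsu⟩
    rw [← h2]
    exact hs
  refine ⟨sInf A, ?_, csInf_le hbdd hbA, fun s h1 h2 => ?_, fun s h1 h2 => ?_⟩
  · by_contra hlt
    have := hm (not_lt.1 hlt)
    omega
  · have h3 := hm h1
    by_contra hne
    have h4 : s ∈ A := by
      change z a + 1 ≤ z s
      omega
    exact absurd (csInf_le hbdd h4) (not_le.2 h2)
  · have h3 := hm h1
    have h4 := hm h2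
    omega

theorem jump_eq_sub_of_eqOn {z : ℝ≥0 → ℕ} {a t : ℝ≥0} {v : ℕ} (hat : a < t)
    (h : ∀ s, a ≤ s → s < t → z s = v) : jump (fun s => (z s : ℝ)) t = z t - v := by
  rw [jump, leftLim_eq_of_eqOn (v := (v : ℝ)) hat fun s h1 h2 => by rw [h s h1 h2]]

theorem jump_eq_zero_of_eq {z : ℝ≥0 → ℕ} (hm : Monotone z) {a b t : ℝ≥0} (h : z b = z a)
    (hat : a < t) (htb : t ≤ b) : jump (fun s => (z s : ℝ)) t = 0 := by
  have hc : ∀ s, a ≤ s → s ≤ b → z s = z a := fun s h1 h2 =>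
    le_antisymm (h ▸ hm h2) (hm h1)
  rw [jump_eq_sub_of_eqOn hat fun s h1 h2 => hc s h1 (h2.le.trans htb), hc t hat.le htb, sub_self]

variable {ι κ : Type*} {z : ι → ℝ≥0 → ℕ} {f : κ → ℝ≥0 → ℝ}

theorem apply_eq_of_no_jump (hm : ∀ i, Monotone (z i)) (hf : ∀ k, IsCadlag (f k)) {D : Set ℝ}
    (hD : D.Countable) (hfD : ∀ k s, f k s ∈ D)
    (h0 : ∀ t, 0 < t → (∀ i, jump (fun s => (z i s : ℝ)) t = 0) → ∀ k, jump (f k) t = 0)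
    {a b : ℝ≥0} (hab : a ≤ b) (h : ∀ i, z i b = z i a) (k : κ) : f k b = f k a :=
  (hf k).eq_of_jump_eq_zero hD (hfD k) hab fun t hat htb => h0 t (pos_of_gt hat)
    (fun i => jump_eq_zero_of_eq (hm i) (h i) hat htb) k

theorem apply_eq_of_one_jump (hm : ∀ i, Monotone (z i)) (hz : ∀ i, IsCadlag (z i))
    (hf : ∀ k, IsCadlag (f k)) {D : Set ℝ} (hD : D.Countable) (hfD : ∀ k s, f k s ∈ D)
    (h0 : ∀ t, 0 < t → (∀ i, jump (fun s => (z i s : ℝ)) t = 0) → ∀ k, jump (f k) t = 0)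
    (i : ι) (G : κ → (κ → ℝ) → ℝ)
    (h1 : ∀ t, 0 < t → jump (fun s => (z i s : ℝ)) t = 1 →
      (∀ j, j ≠ i → jump (fun s => (z j s : ℝ)) t = 0) →
      ∀ k, jump (f k) t = G k fun k => Function.leftLim (f k) t)
    {a b : ℝ≥0} (hi : z i b = z i a + 1) (hj : ∀ j, j ≠ i → z j b = z j a)
    (k : κ) : f k b = f k a + G k fun k => f k a := by
  obtain ⟨τ, haτ, hτb, hbefore, hafter⟩ := exists_jump_time (hm i) (hz i) hi
  have hjb : ∀ j, j ≠ i → ∀ s, a ≤ s → s ≤ b → z j s = z j a := fun j hji s h2 h3 =>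
    le_antisymm (hj j hji ▸ hm j h3) (hm j h2)
  have hconst : ∀ k s, a ≤ s → s < τ → f k s = f k a := fun k s h2 h3 =>
    apply_eq_of_no_jump hm hf hD hfD h0 h2 (fun j => by
      by_cases hji : j = i
      · rw [hji]; exact hbefore s h2 h3
      · exact hjb j hji s h2 (h3.le.trans hτb)) k
  have hlim : ∀ k, Function.leftLim (f k) τ = f k a := fun k =>
    leftLim_eq_of_eqOn haτ fun s h2 h3 => hconst k s h2 h3
  have hend : f k b = f k τ := apply_eq_of_no_jump hm hf hD hfD h0 hτb (fun j => by
      by_cases hji : j = i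
      · rw [hji, hi, hafter τ le_rfl hτb]
      · rw [hj j hji, hjb j hji τ haτ.le hτb]) k
  have hjump := h1 τ (pos_of_gt haτ)
    (by rw [jump_eq_sub_of_eqOn haτ hbefore, hafter τ le_rfl hτb]; push_cast; ring)
    (fun j hji => jump_eq_zero_of_eq (hm j) (hj j hji) haτ hτb) k
  simp only [hlim] at hjump
  rw [jump, hlim] at hjump
  rw [hend, ← hjump]
  ring

end Paths

/-! ### Heights -/

section Heights

variable {n : ℕ}

/-- The height, in units of the lattice, of the interface of a configuration. -/
def height (x : ZMod n → Bool) (k : ℕ) : ℤ :=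
  ∑ j ∈ Finset.range k, if x ((j + 1 : ℕ) : ZMod n) then 1 else -1

theorem height_succ (x : ZMod n → Bool) (k : ℕ) :
    height x (k + 1) = height x k + if x ((k + 1 : ℕ) : ZMod n) then 1 else -1 :=
  Finset.sum_range_succ _ _

theorem two_dvd_height_sub (x y : ZMod n → Bool) (k : ℕ) : 2 ∣ height x k - height y k := by
  induction k with
  | zero => simp [height]
  | succ k ih =>
    rw [height_succ, height_succ]
    split_ifs <;> omega

theorem natCast_eq_iff_of_mem {a b : ℕ} (ha : 1 ≤ a) (han : a ≤ n) (hb : 1 ≤ b) (hbn : b ≤ n) :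
    (a : ZMod n) = (b : ZMod n) ↔ a = b := by
  have := intCast_eq_iff_of_mem (n := n) (a := a) (b := b) ⟨by omega, by omega⟩ ⟨by omega, by omega⟩
  simpa using this

theorem height_comp_swap {x : ZMod n → Bool} {b : Bool} {k : ℕ} (hk : 1 ≤ k) (hkn : k + 1 ≤ n)
    (h1 : x (k : ZMod n) = b) (h2 : x ((k + 1 : ℕ) : ZMod n) = !b) {j : ℕ} (hj : j ≤ n) :
    height (x ∘ Equiv.swap (k : ZMod n) ((k + 1 : ℕ) : ZMod n)) j
      = height x j + if j = k then (if b then -2 else 2) else 0 := by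
  induction j with
  | zero => simp [height, show 0 ≠ k by omega]
  | succ j ih =>
    rw [height_succ, height_succ, ih (by omega)]
    have e1 := natCast_eq_iff_of_mem (n := n) (a := j + 1) (b := k) (by omega) hj hk (by omega)
    have e2 := natCast_eq_iff_of_mem (n := n) (a := j + 1) (b := k + 1) (by omega) hj (by omega) hkn
    simp only [Function.comp, Equiv.swap_apply_def, e1, e2]
    rcases eq_or_ne (j + 1) k with h | h
    · have h' : j ≠ k := by omega
      rw [if_pos h, h2, if_neg h', if_pos h, h, h1]
      cases b <;> simp <;> ring
    · rw [if_neg h, if_neg h]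
      rcases eq_or_ne j k with h' | h'
      · subst h'
        rw [if_pos rfl, if_pos rfl, h1, h2]
        cases b <;> simp <;> ring
      · rw [if_neg h', if_neg (show j + 1 ≠ k + 1 by omega)]
        ring

theorem eq_of_height_eq [NeZero n] {x y : ZMod n → Bool} (h : ∀ k ≤ n, height x k = height y k) :
    x = y := by
  funext a
  have h1 := h _ (ZMod.val_lt (a - 1)).le
  have h2 := h _ (ZMod.val_lt (a - 1))
  rw [Nat.succ_eq_add_one, height_succ, height_succ, h1] at h2
  have e : (((a - 1).val + 1 : ℕ) : ZMod n) = a := by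
    rw [Nat.cast_succ, ZMod.natCast_zmod_val]; ring
  rw [e] at h2
  cases hx : x a <;> cases hy : y a <;> simp [hx, hy] at h2 <;> rfl

/-- The particle configuration of an interface. -/
def config (N : ℕ) (h : unitInterval → ℝ) (a : ZMod (2 * N)) : Bool := particles N h (a.val : ℤ)

variable {N : ℕ}

theorem particles_eq_periodic (hN : 1 ≤ N) (h : unitInterval → ℝ) :
    particles N h = periodic (config N h) := by
  have : NeZero (2 * N) := ⟨by omega⟩
  funext j
  have e : (j % (2 * N : ℤ) - 1) % (2 * N : ℤ) = (j - 1) % (2 * N : ℤ) := by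
    rw [Int.emod_sub_emod]
  have e2 : (((j : ZMod (2 * N)).val : ℕ) : ℤ) = j % (2 * N : ℤ) := by
    rw [ZMod.val_intCast]; push_cast; rfl
  rw [periodic, config, e2, particles, particles, e]

theorem config_natCast (hN : 1 ≤ N) (h : unitInterval → ℝ) {j : ℕ} (hj : j < 2 * N) :
    config N h ((j + 1 : ℕ) : ZMod (2 * N)) = true ↔ h (pt N j) < h (pt N (j + 1)) := by
  have e := congrFun (particles_eq_periodic hN h) ((j + 1 : ℕ) : ℤ)
  rw [periodic, Int.cast_natCast] at e
  rw [← e, particles]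
  have e2 : ((((j + 1 : ℕ) : ℤ) - 1) % (2 * N : ℤ)).toNat = j := by
    rw [Nat.cast_succ, add_sub_cancel_right, Int.emod_eq_of_lt (by omega) (by omega)]
    simp
  rw [e2, decide_eq_true_iff]

theorem pt_zero (N : ℕ) : pt N 0 = 0 := by
  simp [pt]

theorem pt_of_le (hN : 1 ≤ N) {k : ℕ} (hk : 2 * N ≤ k) : pt N k = 1 := by
  have hN' : (0 : ℝ) < N := by exact_mod_cast hN
  have h1 : (1 : ℝ) ≤ k / (2 * N) := by
    rw [le_div_iff₀ (by positivity)]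
    have : ((2 * N : ℕ) : ℝ) ≤ k := by exact_mod_cast hk
    push_cast at this
    linarith
  exact Set.projIcc_of_right_le _ h1

theorem sqrt_two_mul_pos (hN : 1 ≤ N) : 0 < √(2 * N : ℝ) := by
  have hN' : (0 : ℝ) < N := by exact_mod_cast hN
  positivity

theorem apply_pt_eq_height (hN : 1 ≤ N) {h : unitInterval → ℝ} (hh : h ∈ Space1 N) {k : ℕ}
    (hk : k ≤ 2 * N) : h (pt N k) = height (config N h) k / √(2 * N) := by
  have hs := sqrt_two_mul_pos hN
  induction k with
  | zero => simp [height, pt_zero, hh.1]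
  | succ k ih =>
    have ih' := ih (by omega)
    have h1 := hh.2.2.1 (k + 1) ⟨by omega, hk⟩
    rw [Nat.add_sub_cancel] at h1
    have h2 := config_natCast hN h (show k < 2 * N by omega)
    have hp : 0 < 1 / √(2 * N : ℝ) := by positivity
    rw [height_succ]
    rcases h1 with h1 | h1
    · rw [if_pos (h2.2 (by rw [h1]; linarith)), h1, ih']
      push_cast; ring
    · rw [if_neg (fun h3 => by have := h2.1 h3; rw [h1] at this; linarith), h1, ih']
      push_cast; ring

theorem height_config_last (hN : 1 ≤ N) {h : unitInterval → ℝ} (hh : h ∈ Space1 N) :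
    height (config N h) (2 * N) = 0 := by
  have h1 := apply_pt_eq_height hN hh le_rfl
  rw [pt_of_le hN le_rfl, hh.2.1, eq_comm, div_eq_zero_iff] at h1
  rcases h1 with h1 | h1
  · exact_mod_cast h1
  · exact absurd h1 (sqrt_two_mul_pos hN).ne'

theorem lap_eq (hN : 1 ≤ N) {h : unitInterval → ℝ} (hh : h ∈ Space1 N) (k : Site N) :
    lap N h k = ((if config N h (((k : ℕ) + 1 : ℕ) : ZMod (2 * N)) then 1 else -1)
      - (if config N h ((k : ℕ) : ZMod (2 * N)) then 1 else -1)) / √(2 * N) := by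
  obtain ⟨k, hk⟩ := k
  obtain ⟨hk1, hk2⟩ := hk
  obtain ⟨j, rfl⟩ : ∃ j, k = j + 1 := ⟨k - 1, by omega⟩
  simp only [lap, Nat.add_sub_cancel]
  rw [apply_pt_eq_height hN hh (by omega), apply_pt_eq_height hN hh (by omega),
    apply_pt_eq_height hN hh (by omega), height_succ, height_succ]
  push_cast
  ring

theorem lap_pos_iff (hN : 1 ≤ N) {h : unitInterval → ℝ} (hh : h ∈ Space1 N) (k : Site N) :
    0 < lap N h k ↔ config N h ((k : ℕ) : ZMod (2 * N)) = false ∧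
      config N h (((k : ℕ) + 1 : ℕ) : ZMod (2 * N)) = !false := by
  have hs := sqrt_two_mul_pos hN
  rw [lap_eq hN hh, div_pos_iff_of_pos_right hs]
  cases config N h ((k : ℕ) : ZMod (2 * N)) <;>
    cases config N h (((k : ℕ) + 1 : ℕ) : ZMod (2 * N)) <;> norm_num

theorem lap_neg_iff (hN : 1 ≤ N) {h : unitInterval → ℝ} (hh : h ∈ Space1 N) (k : Site N) :
    lap N h k < 0 ↔ config N h ((k : ℕ) : ZMod (2 * N)) = true ∧
      config N h (((k : ℕ) + 1 : ℕ) : ZMod (2 * N)) = !true := by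
  have hs := sqrt_two_mul_pos hN
  rw [lap_eq hN hh, div_lt_iff₀ hs, zero_mul]
  cases config N h ((k : ℕ) : ZMod (2 * N)) <;>
    cases config N h (((k : ℕ) + 1 : ℕ) : ZMod (2 * N)) <;> norm_num

/-- The increment of the interface at the lattice point `k` when it jumps at `j`, upward if
`b = false` and downward if `b = true`, provided that `A` holds. -/
def kick (N : ℕ) (b : Bool) (j k : ℕ) (A : Prop) : ℝ :=
  if k = j then (if b then -1 else 1) * (2 / √(2 * N)) * ind A else 0

theorem config_of_kick (hN : 1 ≤ N) {h h' : unitInterval → ℝ} (hh : h ∈ Space1 N)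
    (hh' : h' ∈ Space1 N) {b : Bool} (j : Site N) {A : Prop}
    (hA : A → config N h ((j : ℕ) : ZMod (2 * N)) = b ∧
      config N h (((j : ℕ) + 1 : ℕ) : ZMod (2 * N)) = !b)
    (hk : ∀ k, h' (pt N k) = h (pt N k) + kick N b j k A) :
    (A → config N h' = config N h ∘
      Equiv.swap ((j : ℕ) : ZMod (2 * N)) (((j : ℕ) + 1 : ℕ) : ZMod (2 * N))) ∧
    (¬ A → config N h' = config N h) := by
  have : NeZero (2 * N) := ⟨by omega⟩
  have hs := sqrt_two_mul_pos hN
  have hj := j.2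
  rw [Set.mem_Ico] at hj
  constructor
  · intro hA'
    refine eq_of_height_eq fun k hkn => ?_
    obtain ⟨h1, h2⟩ := hA hA'
    rw [height_comp_swap hj.1 (by omega) h1 h2 hkn]
    have h3 := hk k
    rw [apply_pt_eq_height hN hh' hkn, apply_pt_eq_height hN hh hkn, kick, ind, if_pos hA'] at h3
    have h4 : (height (config N h') k : ℝ) = height (config N h) k
        + if k = j then (if b then -2 else 2) else 0 := by
      rw [div_eq_iff hs.ne', add_mul, div_mul_cancel₀ _ hs.ne'] at h3
      rw [h3]
      split_ifs
      · field_simp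
      · field_simp
      · rw [zero_mul]
    exact_mod_cast h4
  · intro hA'
    refine eq_of_height_eq fun k hkn => ?_
    have h3 := hk k
    rw [apply_pt_eq_height hN hh' hkn, apply_pt_eq_height hN hh hkn, kick, ind, if_neg hA', mul_zero,
      ite_self, add_zero, div_left_inj' hs.ne'] at h3
    exact_mod_cast h3

theorem config_eq_of_apply_pt_eq {h h' : unitInterval → ℝ}
    (hk : ∀ k, h' (pt N k) = h (pt N k)) : config N h' = config N h := by
  funext a
  simp only [config, particles, hk]

theorem measurable_config (N : ℕ) : Measurable (config N) := by
  refine measurable_pi_lambda _ fun a => ?_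
  have hset : MeasurableSet {h : unitInterval → ℝ |
      h (pt N (((a.val : ℤ) - 1) % (2 * N : ℤ)).toNat)
        < h (pt N ((((a.val : ℤ) - 1) % (2 * N : ℤ)).toNat + 1))} :=
    measurableSet_lt (measurable_pi_apply _) (measurable_pi_apply _)
  refine measurable_to_bool ?_
  convert hset using 1
  ext h
  simp [config, particles]

/-- The values that an interface takes at the lattice points. -/
def latticeValues (N : ℕ) : Set ℝ := Set.range fun a : ℤ => (a : ℝ) / √(2 * N)

theorem apply_pt_mem_latticeValues (hN : 1 ≤ N) {h : unitInterval → ℝ} (hh : h ∈ Space1 N) (k : ℕ) :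
    h (pt N k) ∈ latticeValues N := by
  rcases le_total k (2 * N) with hk | hk
  · exact ⟨_, (apply_pt_eq_height hN hh hk).symm⟩
  · exact ⟨0, by rw [pt_of_le hN hk, hh.2.1]; simp⟩

end Heights

/-! ### Admissible moves -/

section Obstacle

variable {N : ℕ} {Y : Type*}

/-- The sign of the increment of the height caused by a move that brings `b` to the right. -/
def heightSign (b : Bool) : ℤ := if b then -1 else 1

/-- The closed paths, together with a parameter `y ∈ F`, that stay on the side of the obstacle `o y`
that moves bringing `c` to the right respect. -/
def obstacle (N : ℕ) (c : Bool) (F : Set Y) (o : Y → ℕ → ℤ) : Set ((ZMod (2 * N) → Bool) × Y) :=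
  {s | height s.1 (2 * N) = 0 ∧ s.2 ∈ F ∧ ∀ k ≤ 2 * N, 0 ≤ heightSign c * (height s.1 k - o s.2 k)}

variable {b c : Bool} {F : Set Y} {o : Y → ℕ → ℤ}

theorem exchange_mem_obstacle_iff {s : (ZMod (2 * N) → Bool) × Y} (hs : s ∈ obstacle N c F o) {k : ℕ}
    (hk : 1 ≤ k) (hkN : k + 1 ≤ 2 * N) (h1 : s.1 (k : ZMod (2 * N)) = b)
    (h2 : s.1 ((k + 1 : ℕ) : ZMod (2 * N)) = !b) :
    exchange (k : ZMod (2 * N)) ((k + 1 : ℕ) : ZMod (2 * N)) s ∈ obstacle N c F o ↔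
      b = c ∨ 2 ≤ heightSign c * (height s.1 k - o s.2 k) := by
  obtain ⟨e1, e2, e3⟩ := hs
  have key : ∀ j ≤ 2 * N, height (exchange (k : ZMod (2 * N)) ((k + 1 : ℕ) : ZMod (2 * N)) s).1 j
      = height s.1 j + if j = k then (if b then -2 else 2) else 0 := fun j hj =>
    height_comp_swap hk hkN h1 h2 hj
  constructor
  · rintro ⟨-, -, h⟩
    have h3 := h k (by omega)
    rw [key k (by omega), if_pos rfl] at h3
    change 0 ≤ heightSign c * (_ - o s.2 k) at h3
    cases b <;> cases c <;> simp [heightSign] at h3 ⊢ <;> omega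
  · intro h
    refine ⟨?_, e2, fun j hj => ?_⟩
    · rw [key _ le_rfl, if_neg (by omega), e1, add_zero]
    · change 0 ≤ heightSign c * (_ - o s.2 j)
      rw [key j hj]
      have h4 := e3 j hj
      split_ifs with h5 h6
      · subst h5
        subst h6
        cases c <;> simp [heightSign] at h h4 ⊢ <;> omega
      · subst h5
        have h7 : b = false := by simpa using h6
        subst h7
        cases c <;> simp [heightSign] at h h4 ⊢ <;> omega
      · rwa [add_zero]

theorem chainStable_obstacle (N : ℕ) (c : Bool) (F : Set Y) (o : Y → ℕ → ℤ) :
    ChainStable (obstacle N c F o) c := by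
  intro k hk hkN s hs h1 h2
  lift k to ℕ using by omega
  have e : (((k : ℕ) : ℤ) + 1 : ℤ) = ((k + 1 : ℕ) : ℤ) := by push_cast; rfl
  rw [e] at h2 ⊢
  simp only [Int.cast_natCast] at h1 h2 ⊢
  exact (exchange_mem_obstacle_iff hs (by omega) (by omega) h1 h2).2 (Or.inl rfl)

theorem config_eq_move (hN : 1 ≤ N) {h h' : unitInterval → ℝ} (hh : h ∈ Space1 N)
    (hh' : h' ∈ Space1 N) {y : Y} (hS : (config N h, y) ∈ obstacle N c F o) (j : Site N) {A : Prop}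
    (hA : A ↔ (config N h ((j : ℕ) : ZMod (2 * N)) = b ∧
      config N h (((j : ℕ) + 1 : ℕ) : ZMod (2 * N)) = !b) ∧
        (b = c ∨ 2 ≤ heightSign c * (height (config N h) j - o y j)))
    (hk : ∀ k, h' (pt N k) = h (pt N k) + kick N b j k A) :
    (config N h', y) = move (obstacle N c F o) b ((j : ℕ) : ZMod (2 * N))
      (((j : ℕ) + 1 : ℕ) : ZMod (2 * N)) (config N h, y) := by
  have hj := j.2
  rw [Set.mem_Ico] at hj
  obtain ⟨h1, h2⟩ := config_of_kick hN hh hh' j (fun h => (hA.1 h).1) hk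
  by_cases hA' : A
  · have h3 := hA.1 hA'
    rw [move, if_pos ⟨hS, (exchange_mem_obstacle_iff hS hj.1 hj.2 h3.1.1 h3.1.2).2 h3.2, h3.1⟩, h1 hA']
    rfl
  · rw [h2 hA', move, if_neg]
    rintro ⟨-, h3, h4⟩
    exact hA' (hA.2 ⟨h4, (exchange_mem_obstacle_iff hS hj.1 hj.2 h4.1 h4.2).1 h3⟩)

theorem config_mem_obstacle_false (hN : 1 ≤ N) {h : unitInterval → ℝ} (hh : h ∈ Space1 N) {y : Y}
    (hy : y ∈ F) (ho : ∀ k ≤ 2 * N, o y k ≤ height (config N h) k) :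
    (config N h, y) ∈ obstacle N false F o :=
  ⟨height_config_last hN hh, hy, fun k hk => by simpa [heightSign] using ho k hk⟩

theorem neg_le_height {n : ℕ} (x : ZMod n → Bool) (k : ℕ) : -(k : ℤ) ≤ height x k := by
  induction k with
  | zero => simp [height]
  | succ k ih =>
    rw [height_succ]
    push_cast
    split_ifs <;> omega

theorem height_config_le (hN : 1 ≤ N) {h h' : unitInterval → ℝ} (hh : h ∈ Space1 N)
    (hh' : h' ∈ Space1 N) (hle : ∀ x, h x ≤ h' x) {k : ℕ} (hk : k ≤ 2 * N) :
    height (config N h) k ≤ height (config N h') k := by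
  have h1 := hle (pt N k)
  rw [apply_pt_eq_height hN hh hk, apply_pt_eq_height hN hh' hk,
    div_le_div_iff_of_pos_right (sqrt_two_mul_pos hN)] at h1
  exact_mod_cast h1

theorem height_config_nonneg (hN : 1 ≤ N) {h : unitInterval → ℝ} (hh : h ∈ Space1w N) {k : ℕ}
    (hk : k ≤ 2 * N) : 0 ≤ height (config N h) k := by
  have h1 := hh.2 (pt N k)
  rw [apply_pt_eq_height hN hh.1 hk, le_div_iff₀ (sqrt_two_mul_pos hN), zero_mul] at h1
  exact_mod_cast h1

theorem one_div_lt_apply_pt_iff (hN : 1 ≤ N) {h : unitInterval → ℝ} (hh : h ∈ Space1 N) {k : ℕ}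
    (hk : k ≤ 2 * N) : 1 / √(2 * N) < h (pt N k) ↔ 2 ≤ height (config N h) k := by
  rw [apply_pt_eq_height hN hh hk, div_lt_div_iff_of_pos_right (sqrt_two_mul_pos hN)]
  constructor
  · intro h1
    have : (1 : ℤ) < height (config N h) k := by exact_mod_cast h1
    omega
  · intro h1
    have : (1 : ℤ) < height (config N h) k := by omega
    exact_mod_cast this

theorem apply_pt_lt_iff (hN : 1 ≤ N) {h h' : unitInterval → ℝ} (hh : h ∈ Space1 N)
    (hh' : h' ∈ Space1 N) {k : ℕ} (hk : k ≤ 2 * N) :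
    h (pt N k) < h' (pt N k) ↔ 2 ≤ height (config N h') k - height (config N h) k := by
  rw [apply_pt_eq_height hN hh hk, apply_pt_eq_height hN hh' hk,
    div_lt_div_iff_of_pos_right (sqrt_two_mul_pos hN), Int.cast_lt]
  have := two_dvd_height_sub (config N h') (config N h) k
  omega

end Obstacle

/-! ### Interfaces driven by clocks -/

section Driven

variable {N : ℕ} {ι J : Type*} {z : ι → ℝ≥0 → ℕ} {h : J → ℝ≥0 → unitInterval → ℝ}

theorem jump_const {r : ℝ} {t : ℝ≥0} (ht : 0 < t) : jump (fun _ => r) t = 0 := by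
  rw [jump, leftLim_eq_of_eqOn ht fun _ _ _ => rfl, sub_self]

theorem apply_pt_eq_zero_of_notMem (hN : 1 ≤ N) {g : unitInterval → ℝ} (hg : g ∈ Space1 N) {k : ℕ}
    (hk : k ∉ Set.Ico 1 (2 * N)) : g (pt N k) = 0 := by
  rcases Nat.eq_zero_or_pos k with rfl | hk0
  · rw [pt_zero, hg.1]
  · rw [pt_of_le hN (by rw [Set.mem_Ico] at hk; omega), hg.2.1]

theorem countable_latticeValues (N : ℕ) : (latticeValues N).Countable := Set.countable_range _

open Classical in
theorem apply_pt_of_clocks (hN : 1 ≤ N) (hm : ∀ i, Monotone (z i)) (hz : ∀ i, IsCadlag (z i))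
    (hcad : ∀ j, IsCadlag (h j)) (hmem : ∀ j t, h j t ∈ Space1 N) (clock : J → Bool → Site N → ι)
    (hclock : Function.Injective fun p : J × Bool × Site N => clock p.1 p.2.1 p.2.2)
    (A : J → Bool → Site N → (J → ℕ → ℝ) → Prop)
    (hsde : ∀ t, 0 < t → ∀ j, ∀ k : Site N, jump (fun s => h j s (pt N k)) t = 2 / √(2 * N) *
      (jump (fun s => z (clock j false k) s) t *
          ind (A j false k fun j k => Function.leftLim (fun s => h j s (pt N k)) t)
        - jump (fun s => z (clock j true k) s) t *
          ind (A j true k fun j k => Function.leftLim (fun s => h j s (pt N k)) t)))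
    {a b : ℝ≥0} (hab : a ≤ b) :
    ((∀ i, z i b = z i a) → ∀ j k, h j b (pt N k) = h j a (pt N k)) ∧
    ∀ j c k, z (clock j c k) b = z (clock j c k) a + 1 →
      (∀ i, i ≠ clock j c k → z i b = z i a) → ∀ j' k', h j' b (pt N k') = h j' a (pt N k')
        + if j' = j then kick N c k k' (A j c k fun j k => h j a (pt N k)) else 0 := by
  let f : J × ℕ → ℝ≥0 → ℝ := fun p s => h p.1 s (pt N p.2)
  have hf : ∀ p, IsCadlag (f p) := fun p => (hcad p.1).comp_continuous (continuous_apply (pt N p.2))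
  have hfD : ∀ p s, f p s ∈ latticeValues N := fun p s =>
    apply_pt_mem_latticeValues hN (hmem p.1 s) p.2
  have hout : ∀ j, ∀ k ∉ Set.Ico 1 (2 * N), ∀ t, 0 < t → jump (f (j, k)) t = 0 := by
    intro j k hk t ht
    have : f (j, k) = fun _ => 0 := funext fun s => apply_pt_eq_zero_of_notMem hN (hmem j s) hk
    rw [this, jump_const ht]
  have h0 : ∀ t, 0 < t → (∀ i, jump (fun s => (z i s : ℝ)) t = 0) → ∀ p, jump (f p) t = 0 := by
    rintro t ht hi ⟨j, k⟩
    by_cases hk : k ∈ Set.Ico 1 (2 * N)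
    · have := hsde t ht j ⟨k, hk⟩
      rw [hi, hi] at this
      simpa using this
    · exact hout j k hk t ht
  refine ⟨fun hi j k => apply_eq_of_no_jump hm hf (countable_latticeValues N) hfD h0 hab hi (j, k), ?_⟩
  intro j c k hi hother j' k'
  refine apply_eq_of_one_jump hm hz hf (countable_latticeValues N) hfD h0 (clock j c k)
    (fun p v => if p.1 = j then kick N c k p.2 (A j c k fun j k => v (j, k)) else 0) ?_ hi hother (j', k')
  rintro t ht hone hzero ⟨j₁, k₁⟩
  simp only
  have hne : ∀ j₂ c₂ k₂, (j₂, c₂, k₂) ≠ (j, c, k) →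
      jump (fun s => (z (clock j₂ c₂ k₂) s : ℝ)) t = 0 := fun j₂ c₂ k₂ hne' =>
    hzero _ fun e => hne' (hclock (a₁ := (j₂, c₂, k₂)) (a₂ := (j, c, k)) e)
  by_cases hk : k₁ ∈ Set.Ico 1 (2 * N)
  · have hs := hsde t ht j₁ ⟨k₁, hk⟩
    by_cases hjk : j₁ = j ∧ k₁ = k
    · obtain ⟨rfl, rfl⟩ := hjk
      rw [if_pos rfl, kick, if_pos rfl]
      refine hs.trans ?_
      cases c
      · have e := hne j₁ true k (by simp)
        rw [hone, e]
        simp [f]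
      · have e := hne j₁ false k (by simp)
        rw [hone, e]
        simp [f]
    · have e : ∀ c₂, jump (fun s => (z (clock j₁ c₂ ⟨k₁, hk⟩) s : ℝ)) t = 0 := fun c₂ =>
        hne _ _ _ fun e => hjk (by
          simp only [Prod.mk.injEq] at e
          exact ⟨e.1, by rw [← e.2.2]⟩)
      rw [e, e] at hs
      refine hs.trans ?_
      rw [zero_mul, zero_mul, sub_zero, mul_zero, eq_comm]
      by_cases hj : j₁ = j
      · rw [if_pos hj, kick, if_neg fun e => hjk ⟨hj, e⟩]
      · rw [if_neg hj]
  · rw [hout j₁ k₁ hk t ht, kick, if_neg (show k₁ ≠ k from fun e => hk (e ▸ k.2)), ite_self]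

end Driven

/-! ### The variational bound -/

section Variational

variable {N : ℕ}

/-- The rate of the moves bringing `b` to the right at `k`, for an interface that jumps upward at
rate `p_N` if `c = false` and at rate `q_N` if `c = true`. -/
def siteRate (σ : unitInterval → ℝ) (N : ℕ) (c b : Bool) (k : Site N) : ℝ :=
  if b = c then upRate σ N k else downRate σ N k

theorem siteRate_add (σ : unitInterval → ℝ) (c : Bool) (k : Site N) :
    siteRate σ N c false k + siteRate σ N c true k = (2 * N : ℝ) ^ 2 := by
  rw [← upRate_add_downRate σ N k]
  cases c <;> simp [siteRate, add_comm]

theorem abs_exp_sub_one_le (x : ℝ) : |Real.exp x - 1| ≤ |x| * (1 + Real.exp x) := by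
  have h1 := Real.add_one_le_exp x
  have h2 := Real.add_one_le_exp (-x)
  have h3 := Real.exp_pos x
  have h4 : Real.exp (-x) * Real.exp x = 1 := by rw [← Real.exp_add]; simp
  have h5 := mul_le_mul_of_nonneg_right h2 h3.le
  rw [h4] at h5
  rcases le_total 0 x with h | h
  · rw [abs_of_nonneg h, abs_of_nonneg (by linarith)]
    nlinarith
  · rw [abs_of_nonpos h, abs_of_nonpos (by have := Real.exp_le_one_iff.2 h; linarith)]
    nlinarith

theorem siteRate_sub_sq_le {σ : unitInterval → ℝ} {B : ℝ} (hB : ∀ x, |σ x| ≤ B) (hN : 1 ≤ N)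
    (c : Bool) (k : Site N) :
    (siteRate σ N c false k - siteRate σ N c true k) ^ 2 ≤ 32 * B ^ 2 * N := by
  have hN' : (0 : ℝ) < N := by exact_mod_cast hN
  have h1 : (siteRate σ N c false k - siteRate σ N c true k) ^ 2
      = ((upRate σ N k : ℝ) - downRate σ N k) ^ 2 := by
    cases c <;> simp [siteRate]
    ring
  have h2 : (upRate σ N k : ℝ) - downRate σ N k = (2 * N : ℝ) ^ 2 *
      ((Real.exp (4 * σ (pt N k) * (2 * N : ℝ) ^ (-(3 / 2) : ℝ)) - 1) /
        (1 + Real.exp (4 * σ (pt N k) * (2 * N : ℝ) ^ (-(3 / 2) : ℝ)))) := by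
    unfold upRate downRate
    rw [Real.coe_toNNReal _ (by positivity), Real.coe_toNNReal _ (by positivity), Real.exp_neg]
    have := Real.exp_pos (4 * σ (pt N k) * (2 * N : ℝ) ^ (-(3 / 2) : ℝ))
    field_simp
    ring
  rw [h1, h2]
  set x := 4 * σ (pt N k) * (2 * N : ℝ) ^ (-(3 / 2) : ℝ) with hx
  have h3 : ((Real.exp x - 1) / (1 + Real.exp x)) ^ 2 ≤ x ^ 2 := by
    have hp : 0 < 1 + Real.exp x := by have := Real.exp_pos x; linarith
    rw [sq_le_sq, abs_div, abs_of_pos hp, div_le_iff₀ hp]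
    exact abs_exp_sub_one_le x
  have h4 : ((2 * N : ℝ) ^ (-(3 / 2) : ℝ)) ^ 2 * (2 * N : ℝ) ^ 3 = 1 := by
    rw [← Real.rpow_natCast, ← Real.rpow_mul (by positivity), ← Real.rpow_natCast (2 * N : ℝ) 3,
      ← Real.rpow_add (by positivity)]
    norm_num
  have h5 : σ (pt N k) ^ 2 ≤ B ^ 2 := sq_le_sq' (abs_le.1 (hB _)).1 (abs_le.1 (hB _)).2
  calc ((2 * N : ℝ) ^ 2 * ((Real.exp x - 1) / (1 + Real.exp x))) ^ 2
      = (2 * N : ℝ) ^ 4 * ((Real.exp x - 1) / (1 + Real.exp x)) ^ 2 := by ring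
    _ ≤ (2 * N : ℝ) ^ 4 * x ^ 2 := mul_le_mul_of_nonneg_left h3 (by positivity)
    _ = 32 * σ (pt N k) ^ 2 * N * (((2 * N : ℝ) ^ (-(3 / 2) : ℝ)) ^ 2 * (2 * N : ℝ) ^ 3) := by
        rw [hx]; ring
    _ = 32 * σ (pt N k) ^ 2 * N := by rw [h4, mul_one]
    _ ≤ 32 * B ^ 2 * N := by gcongr

/-- The quadratic form of the generator of the moves in `S`. -/
def generatorForm {Y : Type*} [NeZero (2 * N)] [Fintype Y] (σ : unitInterval → ℝ)
    (S : Set ((ZMod (2 * N) → Bool) × Y)) (c : Bool) (u : (ZMod (2 * N) → Bool) × Y → ℝ) : ℝ :=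
  ∑ s, u s * ∑ k, ∑ b, siteRate σ N c b k *
    (u (move S b ((k : ℕ) : ZMod (2 * N)) (((k : ℕ) + 1 : ℕ) : ZMod (2 * N)) s) - u s)

theorem wsum_one_le {n : ℕ} [NeZero n] {Y : Type*} [Fintype Y] (S : Set ((ZMod n → Bool) × Y))
    (u : (ZMod n → Bool) × Y → ℝ) : wsum S u 1 ≤ ∑ s, u s ^ 2 := by
  refine Finset.sum_le_sum fun s _ => ?_
  rw [Pi.one_apply, one_mul]
  exact Set.indicator_le_self' (fun _ _ => sq_nonneg _) s

theorem ChainStable.generatorForm_le {Y : Type*} [NeZero (2 * N)] [Fintype Y]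
    {S : Set ((ZMod (2 * N) → Bool) × Y)} {c : Bool} (h : ChainStable S c) {σ : unitInterval → ℝ}
    {B : ℝ} (hB : ∀ x, |σ x| ≤ B) (hN : 1 ≤ N) (c' : Bool) (u : (ZMod (2 * N) → Bool) × Y → ℝ) :
    generatorForm σ S c' u ≤ -(N : ℝ) ^ 2 * chainEnergy S c u + 8 * B ^ 2 * wsum S u 1 := by
  have hN' : (0 : ℝ) < N := by exact_mod_cast hN
  refine (h.sum_move_le u (siteRate σ N c') (R := (2 * N : ℝ) ^ 2) (by positivity) (siteRate_add σ c')
    (siteRate_sub_sq_le hB hN c')).trans_eq ?_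
  field_simp
  ring

theorem eventually_potential_add_generatorForm_le {σ : unitInterval → ℝ} {B : ℝ}
    (hB : ∀ x, |σ x| ≤ B) {l : ℕ} (Φ : (Fin l → Bool) → ℝ) {a κ : ℝ} (ha : 0 < a) (hκ : 0 < κ) :
    ∀ᶠ ε : ℝ in 𝓝[>] 0, ∀ᶠ N : ℕ in atTop, ∀ (_ : NeZero (2 * N)) (Y : Type) (_ : Fintype Y)
      (S : Set ((ZMod (2 * N) → Bool) × Y)) (c c' : Bool) (u : (ZMod (2 * N) → Bool) × Y → ℝ),
      ChainStable S c →
      a * wsum S u (fun s => blockPotential Φ (2 * N) ⌊ε * N⌋ (periodic s.1)) + generatorForm σ S c' u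
        ≤ (a * κ * N + 8 * B ^ 2) * ∑ s, u s ^ 2 := by
  set A : ℝ := (∑ ξ, |Φ ξ|) * l with hA
  have hA0 : 0 ≤ A := mul_nonneg (Finset.sum_nonneg fun _ _ => abs_nonneg _) (Nat.cast_nonneg _)
  obtain ⟨θ, hθ, hθ'⟩ : ∃ θ > 0, A * θ ≤ κ / 8 :=
    ⟨κ / (8 * (A + 1)), by positivity, by
      rw [mul_div_assoc', div_le_div_iff₀ (by positivity) (by norm_num)]; nlinarith⟩
  obtain ⟨lam, hlam, hlam'⟩ : ∃ lam > 0, A / θ * (4 / lam) ≤ κ / 4 :=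
    ⟨16 * (A + 1) / (θ * κ), by positivity, by
      field_simp
      nlinarith⟩
  have hev : ∀ K : ℝ, ∀ r > 0, ∀ᶠ ε : ℝ in 𝓝[>] 0, K * ε ≤ r := by
    intro K r hr
    have : Tendsto (fun ε : ℝ => K * ε) (𝓝[>] 0) (𝓝 (K * 0)) :=
      ((continuous_const.mul continuous_id).tendsto 0).mono_left nhdsWithin_le_nhds
    rw [mul_zero] at this
    exact (this.eventually (gt_mem_nhds hr)).mono fun _ => le_of_lt
  filter_upwards [self_mem_nhdsWithin, hev (A * 3) (κ / 8) (by positivity),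
    hev (A / θ * 3) (κ / 8) (by positivity), hev (a * (A / θ) * 2 * lam * 3) 1 one_pos,
    hev 3 2 two_pos] with ε hε h1 h2 h3 h4
  rw [Set.mem_Ioi] at hε
  have hεN : Tendsto (fun N : ℕ => ε * (N : ℝ)) atTop atTop :=
    Tendsto.const_mul_atTop hε tendsto_natCast_atTop_atTop
  filter_upwards [eventually_ge_atTop 1, hεN.eventually_ge_atTop (l : ℝ),
    hεN.eventually_ge_atTop (A / θ * (28 * l) / κ + 1)] with N hN h5 h6
  intro _ Y _ S c c' u hS
  have hN' : (0 : ℝ) < N := by exact_mod_cast hN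
  set m : ℤ := ⌊ε * N⌋ with hm
  have hm0 : 0 ≤ m := Int.floor_nonneg.2 (by positivity)
  have hm1 : (m : ℝ) ≤ ε * N := Int.floor_le _
  have hm2 : ε * N < m + 1 := Int.lt_floor_add_one _
  have hw : 2 * (m : ℝ) + l ≤ 3 * ε * N := by linarith
  have hn : 2 * m + (l : ℤ) ≤ (2 * N : ℕ) := by
    have : 2 * (m : ℝ) + l ≤ 2 * N := hw.trans (by nlinarith)
    exact_mod_cast this
  have key := hS.wsum_blockPotential_le u hm0 Φ hn hlam hθ
  have hgen := hS.generatorForm_le hB hN c' u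
  have hQ := wsum_one_le S u
  have hQ0 : 0 ≤ wsum S u 1 := wsum_nonneg _ _ fun _ => zero_le_one
  have hE0 := chainEnergy_nonneg S c u
  rw [← hA] at key
  push_cast at key
  set Q := wsum S u 1
  set E := chainEnergy S c u
  set w : ℝ := 2 * (m : ℝ) + l with hwdef
  have hm0' : (0 : ℝ) ≤ m := by exact_mod_cast hm0
  have hw0 : 0 ≤ w := by positivity
  have hAθ : 0 ≤ A / θ := by positivity
  have c1 : A * w ≤ κ / 8 * N := by
    calc A * w ≤ A * (3 * ε * N) := mul_le_mul_of_nonneg_left hw hA0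
      _ = A * 3 * ε * N := by ring
      _ ≤ κ / 8 * N := mul_le_mul_of_nonneg_right h1 hN'.le
  have c2 : A / θ * w ≤ κ / 8 * N := by
    calc A / θ * w ≤ A / θ * (3 * ε * N) := mul_le_mul_of_nonneg_left hw hAθ
      _ = A / θ * 3 * ε * N := by ring
      _ ≤ κ / 8 * N := mul_le_mul_of_nonneg_right h2 hN'.le
  have c3 : a * (A / θ) * (2 * N) * lam * w ≤ N ^ 2 := by
    calc a * (A / θ) * (2 * N) * lam * w ≤ a * (A / θ) * (2 * N) * lam * (3 * ε * N) :=
          mul_le_mul_of_nonneg_left hw (by positivity)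
      _ = a * (A / θ) * 2 * lam * 3 * ε * N ^ 2 := by ring
      _ ≤ 1 * N ^ 2 := mul_le_mul_of_nonneg_right h3 (by positivity)
      _ = N ^ 2 := one_mul _
  have c4 : A / θ * (2 * (7 * l / (2 * (m : ℝ) + 1))) ≤ κ / 4 := by
    have h7 : A / θ * (28 * l) / κ ≤ m := by linarith
    rw [div_le_iff₀ hκ] at h7
    rw [mul_div_assoc', mul_div_assoc', div_le_div_iff₀ (by positivity) (by norm_num)]
    nlinarith
  have hmain : a * wsum S u (fun s => blockPotential Φ (2 * N) m (periodic s.1)) ≤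
      a * (A * w) * Q + a * N * 2 * (A * θ) * Q + a * (A / θ * w) * Q
        + a * (A / θ) * (2 * N) * lam * w * E
        + a * N * (A / θ * (4 / lam)) * Q + a * N * (A / θ * (2 * (7 * l / (2 * (m : ℝ) + 1)))) * Q := by
    refine (mul_le_mul_of_nonneg_left key ha.le).trans_eq ?_
    ring
  have d1 := mul_le_mul_of_nonneg_left c1 ha.le
  have d2 := mul_le_mul_of_nonneg_left c2 ha.le
  have haN : 0 ≤ a * N := by positivity
  have d3 := mul_le_mul_of_nonneg_left hθ' haN
  have d4 := mul_le_mul_of_nonneg_left hlam' haN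
  have d5 := mul_le_mul_of_nonneg_left c4 haN
  have d6 := mul_le_mul_of_nonneg_right c3 hE0
  have hcoef : a * (A * w) + a * N * 2 * (A * θ) + a * (A / θ * w) + a * N * (A / θ * (4 / lam))
      + a * N * (A / θ * (2 * (7 * l / (2 * (m : ℝ) + 1)))) ≤ a * κ * N := by
    linear_combination d1 + d2 + 2 * d3 + d4 + d5
  have hcoef' := mul_le_mul_of_nonneg_right hcoef hQ0
  have hfin := mul_le_mul_of_nonneg_left hQ (show 0 ≤ a * κ * N + 8 * B ^ 2 by positivity)
  linear_combination hmain + hgen + d6 + hcoef' + hfin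

end Variational

/-! ### The interfaces as Markov chains of configurations -/

section Models

variable {N : ℕ}

/-- The admissible move at the site `k` that brings `b` to the right. -/
def siteMove {Y : Type*} (S : Set ((ZMod (2 * N) → Bool) × Y)) (b : Bool) (k : Site N)
    (s : (ZMod (2 * N) → Bool) × Y) : (ZMod (2 * N) → Bool) × Y :=
  move S b ((k : ℕ) : ZMod (2 * N)) (((k : ℕ) + 1 : ℕ) : ZMod (2 * N)) s

theorem generatorForm_eq {Y : Type*} [NeZero (2 * N)] [Fintype Y] (σ : unitInterval → ℝ)
    (S : Set ((ZMod (2 * N) → Bool) × Y)) (c : Bool) (u : (ZMod (2 * N) → Bool) × Y → ℝ) :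
    generatorForm σ S c u = ∑ s, u s * (∑ k, siteRate σ N c false k * (u (siteMove S false k s) - u s)
      + ∑ k, siteRate σ N c true k * (u (siteMove S true k s) - u s)) := by
  refine Finset.sum_congr rfl fun s _ => ?_
  rw [← Finset.sum_add_distrib]
  congr 1
  refine Finset.sum_congr rfl fun k _ => ?_
  rw [Fintype.sum_bool, add_comm]
  rfl

theorem single_interface_step (hN : 1 ≤ N) {z : Site N ⊕ Site N → ℝ≥0 → ℕ} (hm : ∀ i, Monotone (z i))
    (hz : ∀ i, IsCadlag (z i)) {h : ℝ≥0 → unitInterval → ℝ} (hcad : IsCadlag h)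
    (hmem : ∀ t, h t ∈ Space1 N) {o : ℕ → ℤ} (ho : ∀ t, ∀ k ≤ 2 * N, o k ≤ height (config N (h t)) k)
    (A : Bool → Site N → (ℕ → ℝ) → Prop)
    (hA : ∀ t b (k : Site N), A b k (fun k => h t (pt N k)) ↔
      (config N (h t) ((k : ℕ) : ZMod (2 * N)) = b ∧
        config N (h t) (((k : ℕ) + 1 : ℕ) : ZMod (2 * N)) = !b) ∧
        (b = false ∨ 2 ≤ height (config N (h t)) k - o k))
    (hsde : ∀ t, 0 < t → ∀ k : Site N, jump (fun s => h s (pt N k)) t = 2 / √(2 * N) *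
      (jump (fun s => z (Sum.inl k) s) t *
          ind (A false k fun k => (Function.leftLim h t) (pt N k))
        - jump (fun s => z (Sum.inr k) s) t *
          ind (A true k fun k => (Function.leftLim h t) (pt N k))))
    {a b : ℝ≥0} (hab : a ≤ b) :
    ((∀ i, z i b = z i a) → (config N (h b), ()) = (config N (h a), ())) ∧
    ∀ i, z i b = z i a + 1 → (∀ j, j ≠ i → z j b = z j a) → (config N (h b), ()) =
      Sum.elim (siteMove (obstacle N false Set.univ fun _ : Unit => o) false)
        (siteMove (obstacle N false Set.univ fun _ : Unit => o) true) i (config N (h a), ()) := by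
  have key := apply_pt_of_clocks (J := Unit) (h := fun _ => h) hN hm hz (fun _ => hcad)
    (fun _ => hmem) (fun _ b k => if b then Sum.inr k else Sum.inl k)
    (by rintro ⟨_, b, k⟩ ⟨_, b', k'⟩ e; cases b <;> cases b' <;> simp at e ⊢ <;> exact e)
    (fun _ b k v => A b k (v ())) (fun t ht _ k => by
      have := hsde t ht k
      have e : ∀ x, Function.leftLim (fun s => h s x) t = (Function.leftLim h t) x := fun x =>
        hcad.leftLim_comp (continuous_apply x) ht
      simpa [e] using this) hab
  have hS : (config N (h a), ()) ∈ obstacle N false Set.univ fun _ : Unit => o :=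
    config_mem_obstacle_false hN (hmem a) (Set.mem_univ _) (ho a)
  have hkick : ∀ c k, z (if c then Sum.inr k else Sum.inl k) b
      = z (if c then Sum.inr k else Sum.inl k) a + 1 →
      (∀ j, j ≠ (if c then Sum.inr k else Sum.inl k) → z j b = z j a) →
      (config N (h b), ()) = siteMove (obstacle N false Set.univ fun _ : Unit => o) c k
        (config N (h a), ()) := by
    intro c k hi hj
    refine config_eq_move hN (hmem a) (hmem b) hS k (by simpa [heightSign] using hA a c k) fun k' => ?_
    have := key.2 () c k (by cases c <;> exact hi) (by cases c <;> exact hj) () k'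
    rwa [if_pos rfl] at this
  refine ⟨fun hi => by rw [config_eq_of_apply_pt_eq fun k => key.1 hi () k], ?_⟩
  rintro (k | k) hi hj
  · exact hkick false k hi hj
  · exact hkick true k hi hj

/-- The states of a pair of interfaces of which the first one is above (`c = false`) or below
(`c = true`) the second one. -/
def orderedPairs (N : ℕ) (c : Bool) : Set ((ZMod (2 * N) → Bool) × (ZMod (2 * N) → Bool)) :=
  obstacle N c {y | height y (2 * N) = 0} height

theorem swap_mem_orderedPairs_iff {s : (ZMod (2 * N) → Bool) × (ZMod (2 * N) → Bool)} :
    s.swap ∈ orderedPairs N true ↔ s ∈ orderedPairs N false := by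
  simp only [orderedPairs, obstacle, Set.mem_ofPred_eq, heightSign, Prod.fst_swap, Prod.snd_swap]
  constructor
  · rintro ⟨h1, h2, h3⟩
    refine ⟨h2, h1, fun k hk => ?_⟩
    have := h3 k hk
    simp at this ⊢
    omega
  · rintro ⟨h1, h2, h3⟩
    refine ⟨h2, h1, fun k hk => ?_⟩
    have := h3 k hk
    simp at this ⊢
    omega

/-- The clocks of a pair of interfaces. -/
abbrev PairClock (N : ℕ) : Type := (Site N ⊕ Site N) ⊕ (Site N ⊕ Site N)

/-- The moves of a pair of interfaces. -/
def pairMove (N : ℕ) : PairClock N → (ZMod (2 * N) → Bool) × (ZMod (2 * N) → Bool) →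
    (ZMod (2 * N) → Bool) × (ZMod (2 * N) → Bool) :=
  Sum.elim
    (Sum.elim (siteMove (orderedPairs N false) false) (siteMove (orderedPairs N false) true))
    (Sum.elim (fun k s => (siteMove (orderedPairs N true) false k s.swap).swap)
      (fun k s => (siteMove (orderedPairs N true) true k s.swap).swap))

theorem config_pair_mem (hN : 1 ≤ N) {h : (unitInterval → ℝ) × (unitInterval → ℝ)}
    (hh : h ∈ Space2 N) : (config N h.1, config N h.2) ∈ orderedPairs N false :=
  config_mem_obstacle_false hN hh.1 (height_config_last hN hh.2.1) fun _ hk =>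
    height_config_le hN hh.2.1 hh.1 hh.2.2 hk

theorem pair_step (hN : 1 ≤ N) {z : PairClock N → ℝ≥0 → ℕ} (hm : ∀ i, Monotone (z i))
    (hz : ∀ i, IsCadlag (z i)) {h : ℝ≥0 → (unitInterval → ℝ) × (unitInterval → ℝ)} (hcad : IsCadlag h)
    (hmem : ∀ t, h t ∈ Space2 N)
    (hsde₁ : ∀ t, 0 < t → ∀ k : Site N, jump (fun s => (h s).1 (pt N k)) t = 2 / √(2 * N) *
      (jump (fun s => z (Sum.inl (Sum.inl k)) s) t * ind (0 < lap N (Function.leftLim h t).1 k)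
        - jump (fun s => z (Sum.inl (Sum.inr k)) s) t * ind (lap N (Function.leftLim h t).1 k < 0 ∧
            (Function.leftLim h t).2 (pt N k) < (Function.leftLim h t).1 (pt N k))))
    (hsde₂ : ∀ t, 0 < t → ∀ k : Site N, jump (fun s => (h s).2 (pt N k)) t = 2 / √(2 * N) *
      (jump (fun s => z (Sum.inr (Sum.inl k)) s) t * ind (0 < lap N (Function.leftLim h t).2 k ∧
            (Function.leftLim h t).2 (pt N k) < (Function.leftLim h t).1 (pt N k))
        - jump (fun s => z (Sum.inr (Sum.inr k)) s) t * ind (lap N (Function.leftLim h t).2 k < 0)))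
    {a b : ℝ≥0} (hab : a ≤ b) :
    ((∀ i, z i b = z i a) →
      (config N (h b).1, config N (h b).2) = (config N (h a).1, config N (h a).2)) ∧
    ∀ i, z i b = z i a + 1 → (∀ j, j ≠ i → z j b = z j a) →
      (config N (h b).1, config N (h b).2) = pairMove N i (config N (h a).1, config N (h a).2) := by
  let g : Bool → ℝ≥0 → unitInterval → ℝ := fun j s => if j then (h s).2 else (h s).1
  let clock : Bool → Bool → Site N → PairClock N := fun j c k =>
    if j then Sum.inr (if c then Sum.inr k else Sum.inl k)
    else Sum.inl (if c then Sum.inr k else Sum.inl k)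
  let Δ : (ℕ → ℝ) → Site N → ℝ := fun v k => v (k + 1) - 2 * v k + v (k - 1)
  let A : Bool → Bool → Site N → (Bool → ℕ → ℝ) → Prop := fun j c k v =>
    (if c then Δ (v j) k < 0 else 0 < Δ (v j) k) ∧ (j ≠ c → v true k < v false k)
  have hg : ∀ j t, g j t ∈ Space1 N := by
    rintro (_ | _) t
    · exact (hmem t).1
    · exact (hmem t).2.1
  have key := apply_pt_of_clocks (J := Bool) (h := g) hN hm hz
    (by
      rintro (_ | _)
      · exact hcad.comp_continuous continuous_fst
      · exact hcad.comp_continuous continuous_snd) hg clock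
    (by
      rintro ⟨j, c, k⟩ ⟨j', c', k'⟩ e
      cases j <;> cases j' <;> cases c <;> cases c' <;> simp [clock] at e ⊢ <;> exact e)
    A (fun t ht j k => by
      have e1 : ∀ x, Function.leftLim (fun s => (h s).1 x) t = (Function.leftLim h t).1 x := fun x =>
        hcad.leftLim_comp (g := fun p => p.1 x) (by fun_prop) ht
      have e2 : ∀ x, Function.leftLim (fun s => (h s).2 x) t = (Function.leftLim h t).2 x := fun x =>
        hcad.leftLim_comp (g := fun p => p.2 x) (by fun_prop) ht
      cases j
      · simpa [g, clock, A, Δ, e1, e2, lap] using hsde₁ t ht k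
      · simpa [g, clock, A, Δ, e1, e2, lap] using hsde₂ t ht k) hab
  have hS := config_pair_mem hN (hmem a)
  have hfix : ∀ j c k, z (clock j c k) b = z (clock j c k) a + 1 →
      (∀ i, i ≠ clock j c k → z i b = z i a) → config N (g (!j) b) = config N (g (!j) a) := by
    intro j c k hi hother
    refine config_eq_of_apply_pt_eq fun k' => ?_
    have := key.2 j c k hi hother (!j) k'
    rwa [if_neg (by cases j <;> simp), add_zero] at this
  have hkick : ∀ j c k, z (clock j c k) b = z (clock j c k) a + 1 →
      (∀ i, i ≠ clock j c k → z i b = z i a) → ∀ k', g j b (pt N k') = g j a (pt N k') +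
        kick N c k k' (A j c k fun j k => g j a (pt N k)) := by
    intro j c k hi hother k'
    have := key.2 j c k hi hother j k'
    rwa [if_pos rfl] at this
  have hloc : ∀ j c (k : Site N), (if c then Δ (fun k => g j a (pt N k)) k < 0
      else 0 < Δ (fun k => g j a (pt N k)) k) ↔ (config N (g j a) ((k : ℕ) : ZMod (2 * N)) = c ∧
        config N (g j a) (((k : ℕ) + 1 : ℕ) : ZMod (2 * N)) = !c) := by
    rintro j (_ | _) k
    · exact lap_pos_iff hN (hg j a) k
    · exact lap_neg_iff hN (hg j a) k
  have hgap : ∀ k : Site N, g true a (pt N k) < g false a (pt N k) ↔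
      2 ≤ height (config N (h a).1) k - height (config N (h a).2) k := fun k => by
    have hk := k.2
    rw [Set.mem_Ico] at hk
    exact apply_pt_lt_iff hN (hg true a) (hg false a) (by omega)
  have hupper : ∀ c k, z (clock false c k) b = z (clock false c k) a + 1 →
      (∀ i, i ≠ clock false c k → z i b = z i a) → (config N (h b).1, config N (h b).2)
        = siteMove (orderedPairs N false) c k (config N (h a).1, config N (h a).2) := by
    intro c k hi hother
    have e : config N (h b).2 = config N (h a).2 := hfix false c k hi hother
    rw [e]
    refine config_eq_move hN (hg false a) (hg false b) hS k ?_ (hkick false c k hi hother)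
    refine and_congr (hloc false c k) ?_
    rw [hgap]
    cases c <;> simp [heightSign, g]
  have hlower : ∀ c k, z (clock true c k) b = z (clock true c k) a + 1 →
      (∀ i, i ≠ clock true c k → z i b = z i a) → (config N (h b).1, config N (h b).2)
        = (siteMove (orderedPairs N true) c k (config N (h a).2, config N (h a).1)).swap := by
    intro c k hi hother
    have e : config N (h b).1 = config N (h a).1 := hfix true c k hi hother
    rw [e]
    refine congrArg Prod.swap (config_eq_move hN (hg true a) (hg true b)
      (swap_mem_orderedPairs_iff.2 hS) k ?_ (hkick true c k hi hother))
    refine and_congr (hloc true c k) ?_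
    rw [hgap]
    cases c <;> simp [heightSign, g]
  refine ⟨fun hi => Prod.ext (config_eq_of_apply_pt_eq fun k => key.1 hi false k)
    (config_eq_of_apply_pt_eq fun k => key.1 hi true k), ?_⟩
  rintro ((k | k) | (k | k)) hi hj
  · exact hupper false k hi hj
  · exact hupper true k hi hj
  · exact hlower false k hi hj
  · exact hlower true k hi hj

end Models

/-! ### The probability bounds -/

section Bounds

variable {N : ℕ} {Ω : Type*} [MeasurableSpace Ω] {P : Measure Ω}

theorem IsPoissonFamily.measure_average_gt_le {ι T : Type*} [Fintype ι] [Fintype T]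
    [MeasurableSpace T] [MeasurableSingletonClass T] [IsProbabilityMeasure P] {rate : ι → ℝ≥0}
    {Z : ι → ℝ≥0 → Ω → ℕ} (hZ : IsPoissonFamily P rate Z) (U : ι → T → T)
    (X : ℝ≥0 → Ω → T) (hX : Measurable (X 0)) (hind : IndepFun (X 0) (fun ω i t => Z i t ω) P)
    (hpath : ∀ᵐ ω ∂P, ∀ a b, a ≤ b → ((∀ i, Z i b ω = Z i a ω) → X b ω = X a ω) ∧
      ∀ i, Z i b ω = Z i a ω + 1 → (∀ j, j ≠ i → Z j b ω = Z j a ω) → X b ω = U i (X a ω))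
    (V : T → ℝ) {Λ : ℝ}
    (hΛ : ∀ u : T → ℝ, ∑ x, V x * u x ^ 2 + ∑ x, u x * ∑ i, (rate i : ℝ) * (u (U i x) - u x)
      ≤ Λ * ∑ x, u x ^ 2) {a : ℝ} (ha : 0 < a) {W : ℝ≥0 → Ω → ℝ}
    (hV : ∀ᵐ ω ∂P, ∀ s, V (X s ω) = a * W s ω) (hN : 1 ≤ N) (hT : Fintype.card T ≤ 16 ^ N)
    {t : ℝ} (ht : 0 < t) (δ : ℝ) :
    P {ω | δ < (1 / (N : ℝ)) * ∫ s in (0 : ℝ)..t, W s.toNNReal ω} ≤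
      ENNReal.ofReal (Real.exp (-(a * δ * N)) * (4 ^ N * Real.exp ((Λ + 1) * t))) := by
  have hN' : (0 : ℝ) < N := by exact_mod_cast hN
  have h1 : P {ω | δ < (1 / (N : ℝ)) * ∫ s in (0 : ℝ)..t, W s.toNNReal ω} ≤
      P {ω | a * δ * N < ∫ s in (0 : ℝ)..t, V (X s.toNNReal ω)} := by
    refine measure_mono_ae ?_
    filter_upwards [hV] with ω hω h
    change a * δ * N < ∫ s in (0 : ℝ)..t, V (X s.toNNReal ω)
    change δ < (1 / (N : ℝ)) * ∫ s in (0 : ℝ)..t, W s.toNNReal ω at h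
    simp only [hω]
    rw [intervalIntegral.integral_const_mul, mul_assoc]
    rw [one_div, inv_mul_eq_div, lt_div_iff₀ hN'] at h
    exact mul_lt_mul_of_pos_left h ha
  refine h1.trans ((hZ.measure_integral_gt_le U X hX hind hpath V hΛ ht _).trans ?_)
  refine ENNReal.ofReal_le_ofReal ?_
  have h2 : √(Fintype.card T : ℝ) ≤ 4 ^ N := by
    rw [Real.sqrt_le_left (by positivity), ← pow_mul, mul_comm, pow_mul]
    norm_num
    exact_mod_cast hT
  gcongr

theorem potential_particles_eq (hN : 1 ≤ N) {l : ℕ} (Φ : (Fin l → Bool) → ℝ) (ε : ℝ)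
    (h : unitInterval → ℝ) : potential Φ N ε (particles N h)
      = blockPotential Φ (2 * N) ⌊ε * N⌋ (periodic (config N h)) := by
  rw [particles_eq_periodic hN]
  simp only [potential, blockPotential, blockAvg_eq_bavg, Nat.cast_mul, Nat.cast_ofNat]
  rfl

theorem IsPoissonFamily.forall_monotone_isCadlag {ι : Type*} [Countable ι] {rate : ι → ℝ≥0}
    {Z : ι → ℝ≥0 → Ω → ℕ} (hZ : IsPoissonFamily P rate Z) :
    ∀ᵐ ω ∂P, (∀ i, Monotone fun t => Z i t ω) ∧ ∀ i, IsCadlag fun t => Z i t ω :=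
  (ae_all_iff.2 hZ.mono).and (ae_all_iff.2 hZ.cadlag)

theorem measure_single_interface_le [NeZero (2 * N)] [IsProbabilityMeasure P] (hN : 1 ≤ N)
    {σ : unitInterval → ℝ} {Z : Site N ⊕ Site N → ℝ≥0 → Ω → ℕ}
    (hZ : IsPoissonFamily P
      (Sum.elim (fun k : Site N => upRate σ N k) (fun k : Site N => downRate σ N k)) Z)
    {h : ℝ≥0 → Ω → unitInterval → ℝ} (hmeas : Measurable (h 0))
    (hind : IndepFun (h 0) (fun ω i t => Z i t ω) P) (hmem : ∀ᵐ ω ∂P, ∀ t, h t ω ∈ Space1 N)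
    (hcad : ∀ᵐ ω ∂P, IsCadlag fun t => h t ω) (o : ℕ → ℤ)
    (ho : ∀ᵐ ω ∂P, ∀ t, ∀ k ≤ 2 * N, o k ≤ height (config N (h t ω)) k)
    (A : Bool → Site N → (ℕ → ℝ) → Prop)
    (hA : ∀ g ∈ Space1 N, ∀ b (k : Site N), A b k (fun k => g (pt N k)) ↔
      (config N g ((k : ℕ) : ZMod (2 * N)) = b ∧
        config N g (((k : ℕ) + 1 : ℕ) : ZMod (2 * N)) = !b) ∧
        (b = false ∨ 2 ≤ height (config N g) k - o k))
    (hsde : ∀ᵐ ω ∂P, ∀ t, 0 < t → ∀ k : Site N,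
      jump (fun s => h s ω (pt N k)) t = 2 / √(2 * N) *
        (jump (fun s => Z (Sum.inl k) s ω) t *
            ind (A false k fun k => (Function.leftLim (fun s => h s ω) t) (pt N k))
          - jump (fun s => Z (Sum.inr k) s ω) t *
            ind (A true k fun k => (Function.leftLim (fun s => h s ω) t) (pt N k))))
    {l : ℕ} (Φ : (Fin l → Bool) → ℝ) (ε : ℝ) {a Λ : ℝ} (ha : 0 < a)
    (hΛ : ∀ (S : Set ((ZMod (2 * N) → Bool) × Unit)) (c c' : Bool)
      (u : (ZMod (2 * N) → Bool) × Unit → ℝ), ChainStable S c →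
      a * wsum S u (fun s => blockPotential Φ (2 * N) ⌊ε * N⌋ (periodic s.1)) + generatorForm σ S c' u
        ≤ Λ * ∑ s, u s ^ 2) {t : ℝ} (ht : 0 < t) (δ : ℝ) :
    P {ω | δ < (1 / (N : ℝ)) * ∫ s in (0 : ℝ)..t, potential Φ N ε (particles N (h s.toNNReal ω))} ≤
      ENNReal.ofReal (Real.exp (-(a * δ * N)) * (4 ^ N * Real.exp ((Λ + 1) * t))) := by
  let S : Set ((ZMod (2 * N) → Bool) × Unit) := obstacle N false Set.univ fun _ => o
  have hconf : Measurable fun g : unitInterval → ℝ => (config N g, ()) :=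
    (measurable_config N).prodMk measurable_const
  refine hZ.measure_average_gt_le (Sum.elim (siteMove S false) (siteMove S true))
    (fun s ω => (config N (h s ω), ())) (hconf.comp hmeas) (hind.comp hconf measurable_id) ?_
    (fun s => a * (blockPotential Φ (2 * N) ⌊ε * N⌋ (periodic s.1) * S.indicator 1 s)) ?_ ha
    (W := fun s ω => potential Φ N ε (particles N (h s ω))) ?_ hN ?_ ht δ
  · filter_upwards [hZ.forall_monotone_isCadlag, hmem, hcad, ho, hsde] with ω h1 h2 h3 h4 h5 a b hab
    exact single_interface_step hN h1.1 h1.2 h3 h2 h4 A (fun t => hA _ (h2 t)) h5 hab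
  · intro u
    refine le_of_eq_of_le ?_ (hΛ S false false u (chainStable_obstacle _ _ _ _))
    congr 1
    · rw [wsum, Finset.mul_sum]
      refine Finset.sum_congr rfl fun s _ => ?_
      by_cases hs : s ∈ S <;> simp [hs, mul_assoc]
    · rw [generatorForm_eq]
      refine Finset.sum_congr rfl fun s _ => ?_
      rw [Fintype.sum_sum_type]
      rfl
  · filter_upwards [hmem, ho] with ω h1 h2 s
    have hs : (config N (h s ω), ()) ∈ S :=
      config_mem_obstacle_false hN (h1 s) (Set.mem_univ _) (h2 s)
    rw [potential_particles_eq hN, Set.indicator_of_mem hs, Pi.one_apply, mul_one]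
  · rw [Fintype.card_prod, Fintype.card_unit, mul_one, Fintype.card_fun, ZMod.card,
      Fintype.card_bool, pow_mul]
    exact Nat.pow_le_pow_left (by norm_num) N

theorem IsModel1.measure_le [NeZero (2 * N)] [IsProbabilityMeasure P] (hN : 1 ≤ N)
    {σ : unitInterval → ℝ} {ν : Measure (unitInterval → ℝ)} {L R : Site N → ℝ≥0 → Ω → ℕ}
    {h : ℝ≥0 → Ω → unitInterval → ℝ} (hM : IsModel1 σ N P ν L R h)
    {l : ℕ} (Φ : (Fin l → Bool) → ℝ) (ε : ℝ) {a Λ : ℝ} (ha : 0 < a)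
    (hΛ : ∀ (S : Set ((ZMod (2 * N) → Bool) × Unit)) (c c' : Bool)
      (u : (ZMod (2 * N) → Bool) × Unit → ℝ), ChainStable S c →
      a * wsum S u (fun s => blockPotential Φ (2 * N) ⌊ε * N⌋ (periodic s.1)) + generatorForm σ S c' u
        ≤ Λ * ∑ s, u s ^ 2) {t : ℝ} (ht : 0 < t) (δ : ℝ) :
    P {ω | δ < (1 / (N : ℝ)) * ∫ s in (0 : ℝ)..t, potential Φ N ε (particles N (h s.toNNReal ω))} ≤
      ENNReal.ofReal (Real.exp (-(a * δ * N)) * (4 ^ N * Real.exp ((Λ + 1) * t))) := by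
  have hlow : ∀ g : unitInterval → ℝ, ∀ k ≤ 2 * N, -(2 * N + 2 : ℤ) + 2 ≤ height (config N g) k :=
    fun g k hk => by have := neg_le_height (config N g) k; omega
  refine measure_single_interface_le hN hM.clocks (hM.measurable 0) hM.indep_zero hM.mem hM.cadlag
    (fun _ => -(2 * N + 2 : ℤ)) (ae_of_all _ fun ω t k hk => by have := hlow (h t ω) k hk; omega)
    (fun b k v => if b then v (k + 1) - 2 * v k + v (k - 1) < 0
      else 0 < v (k + 1) - 2 * v k + v (k - 1)) ?_ ?_ Φ ε ha hΛ ht δ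
  · intro g hg b k
    have hk := k.2
    rw [Set.mem_Ico] at hk
    have h2 : b = false ∨ 2 ≤ height (config N g) k - (-(2 * N + 2 : ℤ)) :=
      Or.inr (by have := hlow g k (by omega); omega)
    rw [and_iff_left h2]
    cases b
    · exact lap_pos_iff hN hg k
    · exact lap_neg_iff hN hg k
  · filter_upwards [hM.sde] with ω h1 s hs k
    simpa [lap] using h1 s hs k

theorem IsModel1w.measure_le [NeZero (2 * N)] [IsProbabilityMeasure P] (hN : 1 ≤ N)
    {σ : unitInterval → ℝ} {ν : Measure (unitInterval → ℝ)} {L R : Site N → ℝ≥0 → Ω → ℕ}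
    {h : ℝ≥0 → Ω → unitInterval → ℝ} (hM : IsModel1w σ N P ν L R h)
    {l : ℕ} (Φ : (Fin l → Bool) → ℝ) (ε : ℝ) {a Λ : ℝ} (ha : 0 < a)
    (hΛ : ∀ (S : Set ((ZMod (2 * N) → Bool) × Unit)) (c c' : Bool)
      (u : (ZMod (2 * N) → Bool) × Unit → ℝ), ChainStable S c →
      a * wsum S u (fun s => blockPotential Φ (2 * N) ⌊ε * N⌋ (periodic s.1)) + generatorForm σ S c' u
        ≤ Λ * ∑ s, u s ^ 2) {t : ℝ} (ht : 0 < t) (δ : ℝ) :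
    P {ω | δ < (1 / (N : ℝ)) * ∫ s in (0 : ℝ)..t, potential Φ N ε (particles N (h s.toNNReal ω))} ≤
      ENNReal.ofReal (Real.exp (-(a * δ * N)) * (4 ^ N * Real.exp ((Λ + 1) * t))) := by
  refine measure_single_interface_le hN hM.clocks (hM.measurable 0) hM.indep_zero
    (hM.mem.mono fun ω h1 t => (h1 t).1) hM.cadlag
    (fun _ => 0) (hM.mem.mono fun ω h1 t k hk => height_config_nonneg hN (h1 t) hk)
    (fun b k v => if b then v (k + 1) - 2 * v k + v (k - 1) < 0 ∧ 1 / √(2 * N) < v k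
      else 0 < v (k + 1) - 2 * v k + v (k - 1)) ?_ ?_ Φ ε ha hΛ ht δ
  · intro g hg b k
    have hk := k.2
    rw [Set.mem_Ico] at hk
    cases b
    · rw [and_iff_left (Or.inl rfl)]
      exact lap_pos_iff hN hg k
    · refine and_congr (lap_neg_iff hN hg k) ?_
      rw [one_div_lt_apply_pt_iff hN hg (by omega)]
      simp
  · filter_upwards [hM.sde] with ω h1 s hs k
    simpa [lap] using h1 s hs k

theorem IsModel2.measure_le [NeZero (2 * N)] [IsProbabilityMeasure P] (hN : 1 ≤ N)
    {σ : unitInterval → ℝ} {ν : Measure ((unitInterval → ℝ) × (unitInterval → ℝ))}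
    {L₁ R₁ L₂ R₂ : Site N → ℝ≥0 → Ω → ℕ} {h : ℝ≥0 → Ω → (unitInterval → ℝ) × (unitInterval → ℝ)}
    (hM : IsModel2 σ N P ν L₁ R₁ L₂ R₂ h) {l : ℕ} (Φ : (Fin l → Bool) → ℝ) (ε : ℝ) {a Λ : ℝ}
    (ha : 0 < a)
    (hΛ : ∀ (S : Set ((ZMod (2 * N) → Bool) × (ZMod (2 * N) → Bool))) (c c' : Bool)
      (u : (ZMod (2 * N) → Bool) × (ZMod (2 * N) → Bool) → ℝ), ChainStable S c →
      a * wsum S u (fun s => blockPotential Φ (2 * N) ⌊ε * N⌋ (periodic s.1)) + generatorForm σ S c' u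
        ≤ Λ * ∑ s, u s ^ 2) {t : ℝ} (ht : 0 < t) (δ : ℝ) :
    P {ω | δ < (1 / (N : ℝ)) * ∫ s in (0 : ℝ)..t,
        (potential Φ N ε (particles N (h s.toNNReal ω).1)
          + potential Φ N ε (particles N (h s.toNNReal ω).2))} ≤
      ENNReal.ofReal (Real.exp (-(a * δ * N)) * (4 ^ N * Real.exp ((2 * Λ + 1) * t))) := by
  let S := orderedPairs N false
  let S' := orderedPairs N true
  let p : (ZMod (2 * N) → Bool) → ℝ := fun x => blockPotential Φ (2 * N) ⌊ε * N⌋ (periodic x)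
  have hconf : Measurable fun g : (unitInterval → ℝ) × (unitInterval → ℝ) =>
      (config N g.1, config N g.2) :=
    ((measurable_config N).comp measurable_fst).prodMk ((measurable_config N).comp measurable_snd)
  refine hM.clocks.measure_average_gt_le (pairMove N)
    (fun s ω => (config N (h s ω).1, config N (h s ω).2)) (hconf.comp (hM.measurable 0))
    (hM.indep_zero.comp hconf measurable_id) ?_
    (fun s => a * ((p s.1 + p s.2) * S.indicator 1 s)) ?_ ha
    (W := fun s ω => potential Φ N ε (particles N (h s ω).1)
      + potential Φ N ε (particles N (h s ω).2)) ?_ hN ?_ ht δ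
  · filter_upwards [hM.clocks.forall_monotone_isCadlag, hM.mem, hM.cadlag, hM.sde_upper,
      hM.sde_lower] with ω h1 h2 h3 h4 h5 a b hab
    exact pair_step hN h1.1 h1.2 h3 h2 h4 h5 hab
  · intro u
    have k1 := hΛ S false false u (chainStable_obstacle _ _ _ _)
    have k2 := hΛ S' true true (fun s => u s.swap) (chainStable_obstacle _ _ _ _)
    have e0 : ∑ s : (ZMod (2 * N) → Bool) × (ZMod (2 * N) → Bool), u s.swap ^ 2 = ∑ s, u s ^ 2 :=
      Equiv.sum_comp (Equiv.prodComm _ _) fun s => u s ^ 2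
    have e1 : ∑ s, a * ((p s.1 + p s.2) * S.indicator 1 s) * u s ^ 2
        = a * wsum S u (fun s => p s.1) + a * wsum S' (fun s => u s.swap) (fun s => p s.1) := by
      have e2 : wsum S' (fun s => u s.swap) (fun s => p s.1)
          = ∑ s, p s.2 * S.indicator (fun s => u s ^ 2) s := by
        rw [wsum, ← Equiv.sum_comp (Equiv.prodComm _ _)]
        refine Finset.sum_congr rfl fun s _ => ?_
        simp only [Equiv.prodComm_apply, Prod.fst_swap]
        by_cases hs : s ∈ S
        · rw [Set.indicator_of_mem hs, Set.indicator_of_mem (swap_mem_orderedPairs_iff.2 hs),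
            Prod.swap_swap]
        · rw [Set.indicator_of_notMem hs,
            Set.indicator_of_notMem fun hs' => hs (swap_mem_orderedPairs_iff.1 hs')]
      rw [e2, wsum, ← mul_add, ← Finset.sum_add_distrib, Finset.mul_sum]
      refine Finset.sum_congr rfl fun s _ => ?_
      by_cases hs : s ∈ S
      · simp only [Set.indicator_of_mem hs, Pi.one_apply]
        ring
      · simp only [Set.indicator_of_notMem hs]
        ring
    have e3 : generatorForm σ S' true (fun s => u s.swap)
        = ∑ s : (ZMod (2 * N) → Bool) × (ZMod (2 * N) → Bool), u s *
          (∑ k : Site N, (downRate σ N k : ℝ) * (u (siteMove S' false k s.swap).swap - u s)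
            + ∑ k : Site N, (upRate σ N k : ℝ) * (u (siteMove S' true k s.swap).swap - u s)) := by
      rw [generatorForm_eq, ← Equiv.sum_comp (Equiv.prodComm _ _)]
      rfl
    have e4 : ∑ x, u x * ∑ i, ((Sum.elim
        (Sum.elim (fun k : Site N => upRate σ N k) (fun k : Site N => downRate σ N k))
        (Sum.elim (fun k : Site N => downRate σ N k) (fun k : Site N => upRate σ N k)) i : ℝ≥0) : ℝ)
          * (u (pairMove N i x) - u x)
        = generatorForm σ S false u + generatorForm σ S' true (fun s => u s.swap) := by
      rw [e3, generatorForm_eq, ← Finset.sum_add_distrib]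
      refine Finset.sum_congr rfl fun s _ => ?_
      rw [Fintype.sum_sum_type, Fintype.sum_sum_type, Fintype.sum_sum_type, ← mul_add]
      rfl
    rw [e0] at k2
    rw [e1, e4]
    linear_combination k1 + k2
  · filter_upwards [hM.mem] with ω h1 s
    rw [potential_particles_eq hN, potential_particles_eq hN,
      Set.indicator_of_mem (config_pair_mem hN (h1 s)), Pi.one_apply, mul_one]
  · rw [Fintype.card_prod, Fintype.card_fun, ZMod.card, Fintype.card_bool, pow_mul, ← mul_pow]
    norm_num

end Bounds

/-! ### The super-exponential estimate -/

section Limit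

theorem limsup_log_eq_bot {p : ℝ → ℕ → ℝ≥0∞}
    (h : ∀ M : ℝ, ∀ᶠ ε in 𝓝[>] (0 : ℝ), ∀ᶠ N : ℕ in atTop,
      p ε N ≤ ENNReal.ofReal (Real.exp (M * N))) :
    limsup (fun ε : ℝ => limsup (fun N : ℕ => ENNReal.log (p ε N) / ((N : ℝ) : EReal)) atTop)
      (𝓝[>] 0) = ⊥ := by
  rw [EReal.eq_bot_iff_forall_lt]
  intro M
  refine lt_of_le_of_lt (b := ((M - 1 : ℝ) : EReal)) ?_ (by exact_mod_cast sub_one_lt M)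
  refine limsup_le_of_le (by isBoundedDefault) ?_
  filter_upwards [h (M - 1)] with ε hε
  refine limsup_le_of_le (by isBoundedDefault) ?_
  filter_upwards [hε, eventually_ge_atTop 1] with N hN hN1
  have hN' : (0 : ℝ) < N := by exact_mod_cast hN1
  have h1 := ENNReal.log_monotone hN
  rw [ENNReal.log_ofReal_of_pos (Real.exp_pos _), Real.log_exp] at h1
  rw [EReal.div_le_iff_le_mul (by exact_mod_cast hN') (EReal.coe_ne_top _), mul_comm]
  exact_mod_cast h1

theorem limsup_log_eq_bot_of_le {p : ℝ → ℕ → ℝ≥0∞} {δ t C : ℝ} (hδ : 0 < δ) (ht : 0 < t)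
    (h : ∀ a > 0, ∀ κ > 0, ∀ᶠ ε in 𝓝[>] (0 : ℝ), ∀ᶠ N : ℕ in atTop, p ε N ≤ ENNReal.ofReal
      (Real.exp (-(a * δ * N)) * (4 ^ N * Real.exp ((2 * (a * κ * N + C) + 1) * t)))) :
    limsup (fun ε : ℝ => limsup (fun N : ℕ => ENNReal.log (p ε N) / ((N : ℝ) : EReal)) atTop)
      (𝓝[>] 0) = ⊥ := by
  refine limsup_log_eq_bot fun M => ?_
  have ha : 0 < 2 * (|M| + 3) / δ := by positivity
  filter_upwards [h _ ha (δ / (4 * t)) (by positivity)] with ε hε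
  filter_upwards [hε, tendsto_natCast_atTop_atTop.eventually_ge_atTop ((2 * C + 1) * t)] with N h1 h2
  refine h1.trans (ENNReal.ofReal_le_ofReal ?_)
  have h4 : (4 : ℝ) ^ N ≤ Real.exp (2 * N) := by
    rw [mul_comm, Real.exp_nat_mul]
    refine pow_le_pow_left₀ (by norm_num) ?_ N
    have := Real.add_one_le_exp (1 : ℝ)
    rw [show (2 : ℝ) = 1 + 1 by norm_num, Real.exp_add]
    nlinarith
  calc _ ≤ Real.exp (-(2 * (|M| + 3) / δ * δ * N)) * (Real.exp (2 * N) *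
        Real.exp ((2 * (2 * (|M| + 3) / δ * (δ / (4 * t)) * N + C) + 1) * t)) := by gcongr
    _ = Real.exp (-(|M| + 1) * N + (2 * C + 1) * t) := by
        rw [← Real.exp_add, ← Real.exp_add]
        congr 1
        field_simp
        ring
    _ ≤ Real.exp (M * N) := by
        refine Real.exp_le_exp.2 ?_
        have := mul_le_mul_of_nonneg_right (neg_abs_le M) (Nat.cast_nonneg (α := ℝ) N)
        linarith

theorem exists_abs_le_of_holder {σ : unitInterval → ℝ} (hσ : ∃ C : ℝ≥0, HolderWith C (1 / 2) σ) :
    ∃ B, ∀ x, |σ x| ≤ B := by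
  obtain ⟨C, hC⟩ := hσ
  have hc : Continuous fun x => |σ x| := (hC.continuous (by norm_num)).abs
  obtain ⟨x, -, hx⟩ := isCompact_univ.exists_isMaxOn Set.univ_nonempty hc.continuousOn
  exact ⟨_, fun y => hx (Set.mem_univ y)⟩

theorem four_pow_mul_exp_mono {a δ Λ Λ' t : ℝ} (h : Λ ≤ Λ') (ht : 0 < t) (N : ℕ) :
    ENNReal.ofReal (Real.exp (-(a * δ * N)) * (4 ^ N * Real.exp ((Λ + 1) * t))) ≤
      ENNReal.ofReal (Real.exp (-(a * δ * N)) * (4 ^ N * Real.exp ((Λ' + 1) * t))) := by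
  gcongr

end Limit

end

end InterfaceModel

theorem mainTheorem6
    (σ : unitInterval → ℝ) (hσ : ∃ C : ℝ≥0, HolderWith C (1 / 2) σ)
    (l : ℕ) (hl : 1 ≤ l) (Φ : (Fin l → Bool) → ℝ)
    {Ω : ℕ → Type*} [∀ N, MeasurableSpace (Ω N)]
    (P : ∀ N, Measure (Ω N)) [∀ N, IsProbabilityMeasure (P N)]
    (δ : ℝ) (hδ : 0 < δ) (t : ℝ) (ht : 0 < t) :
    (∀ (ν : ℕ → Measure (unitInterval → ℝ))
        (L R : ∀ N, InterfaceModel.Site N → ℝ≥0 → Ω N → ℕ) (h : ∀ N, ℝ≥0 → Ω N → unitInterval → ℝ),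
      (∀ N, 1 ≤ N → InterfaceModel.IsModel1 σ N (P N) (ν N) (L N) (R N) (h N)) →
      limsup (fun ε : ℝ => limsup (fun N : ℕ =>
        ENNReal.log (P N {ω | δ < (1 / (N : ℝ)) * ∫ s in (0 : ℝ)..t,
          InterfaceModel.potential Φ N ε (InterfaceModel.particles N (h N s.toNNReal ω))})
        / ((N : ℝ) : EReal)) atTop) (𝓝[>] 0) = ⊥) ∧
    (∀ (ν : ℕ → Measure (unitInterval → ℝ))
        (L R : ∀ N, InterfaceModel.Site N → ℝ≥0 → Ω N → ℕ) (h : ∀ N, ℝ≥0 → Ω N → unitInterval → ℝ),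
      (∀ N, 1 ≤ N → InterfaceModel.IsModel1w σ N (P N) (ν N) (L N) (R N) (h N)) →
      limsup (fun ε : ℝ => limsup (fun N : ℕ =>
        ENNReal.log (P N {ω | δ < (1 / (N : ℝ)) * ∫ s in (0 : ℝ)..t,
          InterfaceModel.potential Φ N ε (InterfaceModel.particles N (h N s.toNNReal ω))})
        / ((N : ℝ) : EReal)) atTop) (𝓝[>] 0) = ⊥) ∧
    (∀ (ν : ℕ → Measure ((unitInterval → ℝ) × (unitInterval → ℝ)))
        (L₁ R₁ L₂ R₂ : ∀ N, InterfaceModel.Site N → ℝ≥0 → Ω N → ℕ)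
        (h : ∀ N, ℝ≥0 → Ω N → (unitInterval → ℝ) × (unitInterval → ℝ)),
      (∀ N, 1 ≤ N →
        InterfaceModel.IsModel2 σ N (P N) (ν N) (L₁ N) (R₁ N) (L₂ N) (R₂ N) (h N)) →
      limsup (fun ε : ℝ => limsup (fun N : ℕ =>
        ENNReal.log (P N {ω | δ < (1 / (N : ℝ)) * ∫ s in (0 : ℝ)..t,
          (InterfaceModel.potential Φ N ε (InterfaceModel.particles N (h N s.toNNReal ω).1)
            + InterfaceModel.potential Φ N ε
                (InterfaceModel.particles N (h N s.toNNReal ω).2))})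
        / ((N : ℝ) : EReal)) atTop) (𝓝[>] 0) = ⊥) := by
  obtain ⟨B, hB⟩ := InterfaceModel.exists_abs_le_of_holder hσ
  have hmono : ∀ a > 0, ∀ κ > 0, ∀ N : ℕ,
      a * κ * N + 8 * B ^ 2 ≤ 2 * (a * κ * N + 8 * B ^ 2) := fun a ha κ hκ N => by
    have : 0 ≤ a * κ * N + 8 * B ^ 2 := by positivity
    linarith
  refine ⟨fun ν L R h hM => ?_, fun ν L R h hM => ?_, fun ν L₁ R₁ L₂ R₂ h hM => ?_⟩
  all_goals
    refine InterfaceModel.limsup_log_eq_bot_of_le (C := 8 * B ^ 2) hδ ht fun a ha κ hκ => ?_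
    filter_upwards [InterfaceModel.eventually_potential_add_generatorForm_le hB Φ ha hκ] with ε hε
    filter_upwards [hε, eventually_ge_atTop 1] with N hΛ hN
    have : NeZero (2 * N) := ⟨by omega⟩
  · exact ((hM N hN).measure_le hN Φ ε ha (hΛ _ _ _) ht δ).trans
      (InterfaceModel.four_pow_mul_exp_mono (hmono a ha κ hκ N) ht N)
  · exact ((hM N hN).measure_le hN Φ ε ha (hΛ _ _ _) ht δ).trans
      (InterfaceModel.four_pow_mul_exp_mono (hmono a ha κ hκ N) ht N)
  · exact (hM N hN).measure_le hN Φ ε ha (hΛ _ _ _) ht δ
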